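/- **Setting.** Let $\mathcal N(\mathbb R)$ be the set of Borel measures on $\mathbb R$ with values in $\{0,1,2,\dots\}\cup\{+\infty\}$ which are finite on bounded sets, with the weakest topology making $\nu\mapsto\int f\,d\nu$ continuous for every continuous $f$ with bounded support, and its Borel $\sigma$-field. For $I\subset\mathbb R$ let $\nu|_I=\mathbf 1_I\,\nu$, and for $t\in\mathbb R$ let $S_t\nu=\nu(\cdot+t)$ be the image of $\nu$ by $x\mapsto x-t$. For $A\in[0,\infty)$, $\mathcal N((-A,0])$ denotes the set of $\nu\in\mathcal N(\mathbb R)$ that vanish outside $(-A,0]$, with the trace topology and $\sigma$-field. $\mathbb D(\mathbb R_+,\mathcal N((-A,0]))$ denotes the set of paths $w:\mathbb R_+\to\mathcal N((-A,0])$ that are right continuous and have left limits in $\mathcal N(\mathbb R)$ (a left limit may have an atom at $-A$); its $\sigma$-field is generated by the coordinate maps. For $s\ge 0$ put $(\theta_sw)(t)=w(s+t)$. Let $(\Omega,\mathcal F,(\mathcal F_t)_{t\ge0},\mathbb P)$ be a filtered probability space satisfying the usual assumptions, and let $Q$ be an $(\mathcal F_t)$-Poisson point process on $(0,\infty)^2$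 with unit intensity: a boundedly finite random counting measure such that for all $t,r,a>0$ the variable $Q((t,t+r]\times(0,a])$ is $\mathcal F_{t+r}$-measurable, independent of $\mathcal F_t$, and Poisson with parameter $ra$. Let $\lambda>0$, let $h:(0,\infty)\to\mathbb R$ be measurable, and put $L(h)=\sup\{t>0:|h(t)|>0\}\in[0,\infty]$ ($=0$ if $h$ vanishes). Let $N^0$ be an $\mathcal F_0$-measurable random element of $\mathcal N(\mathbb R)$ carried by $(-\infty,0]$. Assume $$L(h)<\infty,\qquad \int_0^\infty h^+(t)\,dt<1,\qquad \mathbb E\big[N^0((-L(h),0])\big]<\infty .$$ Let $N^h$ be a point process with values in $\mathcal N(\mathbb R)$, with $N^h|_{(-\infty,t]}$ $\mathcal F_t$-measurable for every $t\ge0$, such that almost surely $$N^h=N^0+\int_{(0,\infty)^2}\delta_u\,\mathbf 1_{\{\theta\le\Lambda^h(u)\}}\,Q(du,d\theta),\qquad \Lambda^h(u)=\Big(\lambda+\int_{(-\infty,u)}h(u-s)\,N^h(ds)\Big)^+ .$$ Let $A<\infty$ with $A\ge L(h)$, and set $X_t=(S_tN^h)|_{(-A,0]}=N^h|_{(t-A,t]}(\cdot+t)$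 for $t\ge0$. **Proposition 3.1.** The process $X=(X_t)_{t\ge0}$ is a strong $(\mathcal F_t)$-Markov process with $X_0=N^0|_{(-A,0]}$ a.s. and sample paths in $\mathbb D(\mathbb R_+,\mathcal N((-A,0]))$. Precisely: 1. For every $\omega$, the path $t\mapsto X_t$ belongs to $\mathbb D(\mathbb R_+,\mathcal N((-A,0]))$, and for every $t>0$ its left limit in $\mathcal N(\mathbb R)$ is $X_{t-}=N^h|_{[t-A,t)}(\cdot+t)$. Almost surely $X_0=N^0|_{(-A,0]}$. 2. $X$ is $(\mathcal F_t)$-adapted, and there is a Markov kernel $\Pi$ from $\mathcal N((-A,0])$ to $\mathbb D(\mathbb R_+,\mathcal N((-A,0]))$, depending only on $\lambda$, $h$ and $A$ (not on the probability space, the filtration, $Q$, or the law of $N^0$), such that for every $(\mathcal F_t)$-stopping time $T$ with values in $[0,\infty]$ and every bounded measurable $F:\mathbb D(\mathbb R_+,\mathcal N((-A,0]))\to\mathbb R$, $$\mathbb E\big[F((X_{T+t})_{t\ge0})\,\mathbf 1_{\{T<\infty\}}\,\big|\,\mathcal F_T\big]=\mathbf 1_{\{T<\infty\}}\int F\,d\Pi(X_T)\qquad\text{a.s.}$$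 Moreover, for all $x\in\mathcal N((-A,0])$, $s\ge0$ and measurable $C$, one has $w(0)=x$ for $\Pi(x)$-almost every $w$, and $\Pi(x)(\theta_s^{-1}C)=\int\Pi(w(s))(C)\,\Pi(x)(dw)$; in particular the kernels $x\mapsto\Pi(x)(w(t)\in\cdot)$, $t\ge 0$, form a transition semigroup. -/

import Mathlib

open MeasureTheory ProbabilityTheory Set Filter Topology
open scoped NNReal ENNReal CompactlySupported

noncomputable section

namespace Hawkes

/-- `N(ℝ)`: the boundedly finite counting measures on the real line. -/
structure PointMeasure where
  /-- the underlying Borel measure -/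
  toMeasure : Measure ℝ
  counting : ∀ B : Set ℝ, MeasurableSet B → ∃ n : ℕ∞, toMeasure B = (n : ℝ≥0∞)
  finite_of_isBounded : ∀ B : Set ℝ, Bornology.IsBounded B → toMeasure B < ∞

namespace PointMeasure

/-- The weak topology `σ(N(ℝ), C_bs(ℝ))`: the coarsest topology for which `ν ↦ ∫ f dν` is
continuous for every continuous `f` with bounded (equivalently, compact) support. -/
instance : TopologicalSpace PointMeasure :=
  ⨅ f : C_c(ℝ, ℝ), TopologicalSpace.induced (fun ν : PointMeasure => ∫ x, f x ∂ν.toMeasure)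
    inferInstance

instance : MeasurableSpace PointMeasure := borel PointMeasure

instance : BorelSpace PointMeasure := ⟨rfl⟩

/-- The restriction `ν|_I = 1_I ν`, extended by zero outside of `I`. -/
def restrict (ν : PointMeasure) (I : Set ℝ) : PointMeasure where
  toMeasure := ν.toMeasure.restrict I
  counting B hB := by
    rw [Measure.restrict_apply hB, ← measure_toMeasurable]
    exact ν.counting _ (measurableSet_toMeasurable _ _)
  finite_of_isBounded B hB :=
    (Measure.restrict_apply_le I B).trans_lt (ν.finite_of_isBounded B hB)

/-- The shift `S_t ν = ν(· + t)`: the image of `ν` by `x ↦ x - t`, which moves every atom by `t`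
units of time to the left. -/
def shift (t : ℝ) (ν : PointMeasure) : PointMeasure where
  toMeasure := ν.toMeasure.map (fun x => x - t)
  counting B hB := by
    have hm : Measurable (fun x : ℝ => x - t) := by fun_prop
    rw [Measure.map_apply hm hB]
    exact ν.counting _ (hm hB)
  finite_of_isBounded B hB := by
    have hm : Measurable (fun x : ℝ => x - t) := by fun_prop
    obtain ⟨r, hr⟩ := hB.subset_closedBall 0
    refine (measure_mono hr).trans_lt ?_
    rw [Measure.map_apply hm Metric.isClosed_closedBall.measurableSet]
    refine ν.finite_of_isBounded _ ((Metric.isBounded_closedBall (x := t) (r := r)).subset ?_)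
    intro x hx
    simpa [Real.dist_eq] using hx

end PointMeasure

/-- `N((-A,0])`, identified with the point measures on `ℝ` which vanish outside of `(-A,0]`. It
carries the trace topology and the trace of the Borel σ-field of `N(ℝ)`. -/
abbrev WindowSpace (A : ℝ≥0) : Type :=
  {ν : PointMeasure // ν.toMeasure (Ioc (-(A : ℝ)) 0)ᶜ = 0}

/-- The restriction of `ν` to `(-A,0]`, as an element of `N((-A,0])`. -/
def toWindow (A : ℝ≥0) (ν : PointMeasure) : WindowSpace A :=
  ⟨ν.restrict (Ioc (-(A : ℝ)) 0), by
    change ν.toMeasure.restrict _ _ = 0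
    rw [Measure.restrict_apply measurableSet_Ioc.compl]
    simp⟩

/-- Sample paths `ℝ₊ → N((-A,0])` which are right continuous with left limits. The left limits are
taken in `N(ℝ)`, as an atom which leaves the half-open window through its left end sits at `-A` in
the left limit at that time. -/
def IsCadlag {A : ℝ≥0} (w : ℝ≥0 → WindowSpace A) : Prop :=
  (∀ t, ContinuousWithinAt w (Ici t) t) ∧
    ∀ t, ∃ l : PointMeasure, Tendsto (fun s => (w s).1) (𝓝[<] t) (𝓝 l)

/-- The path space `D(ℝ₊, N((-A,0]))`. Its σ-field is generated by the coordinate maps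
`w ↦ w t`. -/
abbrev PathSpace (A : ℝ≥0) : Type := {w : ℝ≥0 → WindowSpace A // IsCadlag w}

/-- The shifted path `t ↦ w (s + t)`. -/
def PathSpace.shift {A : ℝ≥0} (s : ℝ≥0) (w : PathSpace A) : PathSpace A :=
  ⟨fun t => w.1 (s + t), by
    refine ⟨fun t => ?_, fun t => ?_⟩
    · refine (w.2.1 (s + t)).comp (by fun_prop) ?_
      intro u hu
      exact add_le_add le_rfl (mem_Ici.1 hu)
    · obtain ⟨l, hl⟩ := w.2.2 (s + t)
      refine ⟨l, hl.comp ?_⟩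
      refine tendsto_nhdsWithin_iff.2 ⟨?_, ?_⟩
      · exact ((continuous_const.add continuous_id).tendsto t).mono_left nhdsWithin_le_nhds
      · filter_upwards [self_mem_nhdsWithin] with u hu
        exact add_lt_add_of_le_of_lt le_rfl (mem_Iio.1 hu)⟩

/-- `L(h) = sup {t > 0 : |h(t)| > 0}` in `[0, +∞]`. -/
def supportBound (h : ℝ → ℝ) : ℝ≥0∞ := ⨆ t ∈ {t : ℝ | 0 < t ∧ 0 < |h t|}, ENNReal.ofReal t

/-- The intensity `Λ^h(t) = (lam + ∫_{(-∞,t)} h(t-u) ν(du))⁺`. -/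
def intensity (lam : ℝ) (h : ℝ → ℝ) (ν : PointMeasure) (t : ℝ) : ℝ :=
  max (lam + ∫ u in Iio t, h (t - u) ∂ν.toMeasure) 0

section Probability

variable {Ω : Type*} {mΩ : MeasurableSpace Ω}

/-- The usual assumptions: completeness and right continuity. -/
structure UsualConditions (P : Measure Ω) (𝓕 : Filtration ℝ≥0 mΩ) : Prop where
  null : ∀ s : Set Ω, P s = 0 → MeasurableSet[𝓕 0] s
  rightContinuous : 𝓕.IsRightContinuous

/-- `Q` is an `(𝓕_t)`-Poisson point process on `(0,+∞) × (0,+∞)` with unit intensity. -/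
structure IsPoissonPointProcess (P : Measure Ω) (𝓕 : Filtration ℝ≥0 mΩ)
    (Q : Ω → Measure (ℝ × ℝ)) : Prop where
  counting : ∀ ω, ∀ B : Set (ℝ × ℝ), MeasurableSet B → ∃ n : ℕ∞, Q ω B = (n : ℝ≥0∞)
  finite_of_isBounded : ∀ ω, ∀ B : Set (ℝ × ℝ), Bornology.IsBounded B → Q ω B < ∞
  support : ∀ ω, Q ω (Ioi (0 : ℝ) ×ˢ Ioi (0 : ℝ))ᶜ = 0
  measurable : ∀ t r a : ℝ≥0, 0 < t → 0 < r → 0 < a →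
    Measurable[𝓕 (t + r)] fun ω => Q ω (Ioc (t : ℝ) (t + r) ×ˢ Ioc (0 : ℝ) a)
  indep : ∀ t r a : ℝ≥0, 0 < t → 0 < r → 0 < a →
    Indep (MeasurableSpace.comap (fun ω => Q ω (Ioc (t : ℝ) (t + r) ×ˢ Ioc (0 : ℝ) a))
      inferInstance) (𝓕 t) P
  law : ∀ t r a : ℝ≥0, 0 < t → 0 < r → 0 < a →
    P.map (fun ω => Q ω (Ioc (t : ℝ) (t + r) ×ˢ Ioc (0 : ℝ) a)) =
      (poissonMeasure (r * a)).map (fun n : ℕ => (n : ℝ≥0∞))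

/-- `N0` is an `𝓕_0`-measurable random point process on `(-∞,0]`. -/
structure IsInitialCondition (𝓕 : Filtration ℝ≥0 mΩ) (N0 : Ω → PointMeasure) : Prop where
  measurable : Measurable[𝓕 0] N0
  support : ∀ ω, (N0 ω).toMeasure (Ioi 0) = 0

/-- `N` is an adapted point process on `ℝ` which solves, almost surely,
`N = N0 + ∫ δ_u 1{θ ≤ Λ^h(u)} Q(du, dθ)`, where `Λ^h` is the intensity computed from `N`. -/
structure IsHawkesSolution (P : Measure Ω) (𝓕 : Filtration ℝ≥0 mΩ) (lam : ℝ) (h : ℝ → ℝ)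
    (Q : Ω → Measure (ℝ × ℝ)) (N0 N : Ω → PointMeasure) : Prop where
  adapted : ∀ t : ℝ≥0, Measurable[𝓕 t] fun ω => (N ω).restrict (Iic (t : ℝ))
  equation : ∀ᵐ ω ∂P, (N ω).toMeasure = (N0 ω).toMeasure +
    ((Q ω).restrict {p | p.2 ≤ intensity lam h (N ω) p.1}).map Prod.fst

/-- `κ` is a family of path laws of a time-homogeneous Markov process: under the probability `κ x`
the path starts at `x`, and its shift by any `s` has law `∫ κ (w s) κ x(dw)`. In particular the
kernels `x ↦ κ x {w | w t ∈ ·}` form a transition semigroup. -/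
structure IsMarkovFamily {A : ℝ≥0} (κ : Kernel (WindowSpace A) (PathSpace A)) : Prop where
  isMarkovKernel : IsMarkovKernel κ
  start : ∀ x, ∀ᵐ w ∂κ x, w.1 0 = x
  semigroup : ∀ (x : WindowSpace A) (s : ℝ≥0) (C : Set (PathSpace A)), MeasurableSet C →
    κ x {w | w.shift s ∈ C} = ∫⁻ w, κ (w.1 s) C ∂κ x

/-- `X` is a strong `(𝓕_t)`-Markov process with path laws `κ`: it is adapted and, for every
stopping time `T` and every bounded measurable functional `F` of the path, the conditional
expectation of `F((X_{T+t})_{t ≥ 0})` given `𝓕_T` is `∫ F dκ(X_T)` on `{T < ∞}`. -/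
structure IsStrongMarkov {A : ℝ≥0} (P : Measure Ω) (𝓕 : Filtration ℝ≥0 mΩ)
    (κ : Kernel (WindowSpace A) (PathSpace A)) (X : Ω → PathSpace A) : Prop where
  adapted : ∀ t : ℝ≥0, Measurable[𝓕 t] fun ω => (X ω).1 t
  strongMarkov : ∀ (T : Ω → WithTop ℝ≥0) (hT : IsStoppingTime 𝓕 T) (F : PathSpace A → ℝ),
    Measurable F → (∃ c : ℝ, ∀ w, |F w| ≤ c) →
    P[{ω | T ω < ⊤}.indicator (fun ω => F ((X ω).shift ((T ω).untopD 0))) | hT.measurableSpace]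
      =ᵐ[P] {ω | T ω < ⊤}.indicator (fun ω => ∫ w, F w ∂κ ((X ω).1 ((T ω).untopD 0)))

end Probability

end Hawkes

end

open Hawkes

/-! The window process is a deterministic flow driven by Poisson noise. When a dominating process
does not explode, the Hawkes equation with past `x` and configuration `q` has exactly one boundedly
finite solution, `solution lam h x q`. As `h` vanishes beyond `A`, the equation seen from time `T`
involves the past only through the window `(T - A, T]` and the noise only through its points after
`T` (`shift_eq_thin`). By uniqueness the shifted path is the flow started from the current window
and driven by the shifted noise (`windowPath_shift_eq_flow`). After a stopping time the noise is a
Poisson process independent of the past (`map_shift_stopping`), so the conditional law of the future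
is the image of `poissonLaw` under the flow. This image is the kernel `pathKernel`.

Existence: since `h` is signed, the Picard scheme is not monotone. It is kept below a monotone
scheme driven by the positive part of `h` and the base rate `lam + 1`, whose mean mass on a
half-line satisfies an affine recursion of slope `∫ h⁺ < 1` (`ae_noExplosion`). Under a boundedly
finite counting measure nothing happens between atoms and one further iteration settles each atom,
so the iterates stabilise on every half-line (`eventually_restrict_eq`). The same lemma, applied to
constant sequences, gives uniqueness.

Noise: the assumptions on `Q` concern one rectangle at a time, always based at height zero, and say
nothing on joint laws of stacked rectangles. Time is therefore cut into thin slices. In a slice the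
Laplace functional equals its first order expansion unless there are two points, an event of second
order, and the expansion only involves the mean measure. Summing the errors gives the Laplace
functional given the past (`lintegral_mul_expNeg`), and these functionals determine the law
(`Conf.ext_of_expNeg`). Stopping times are approximated from the right by times on a grid.

The semigroup property comes from resampling the noise after a fixed time (`map_concat_poissonLaw`).
Measurability rests on two facts: the Borel σ-field of `N(ℝ)` is generated by masses
(`measurableSpace_eq_comap`), and s-finite kernels carry joint measurability through the Picard
iterates, which need not be locally finite. -/

noncomputable section

namespace Hawkes

/-! ### Topology and Borel σ-field of the space of point measures -/

namespace PointMeasure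

@[ext]
theorem ext {ν ν' : PointMeasure} (h : ν.toMeasure = ν'.toMeasure) : ν = ν' := by
  cases ν; cases ν'; simpa using h

instance (ν : PointMeasure) : IsFiniteMeasureOnCompacts ν.toMeasure :=
  ⟨fun _ hK => ν.finite_of_isBounded _ hK.isBounded⟩

theorem continuous_integral (f : C_c(ℝ, ℝ)) :
    Continuous fun ν : PointMeasure => ∫ x, f x ∂ν.toMeasure :=
  continuous_iff_le_induced.2 (iInf_le _ f)

theorem integrable (ν : PointMeasure) (f : C_c(ℝ, ℝ)) : Integrable f ν.toMeasure :=
  f.continuous.integrable_of_hasCompactSupport f.hasCompactSupport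

/-- The trapezoid which is `1` on `[-n, n]` and vanishes outside of `[-n-1, n+1]`. -/
def trapezoid (n : ℕ) : C_c(ℝ, ℝ) where
  toFun x := max 0 (min 1 (n + 1 - |x|))
  continuous_toFun := by fun_prop
  hasCompactSupport' := by
    refine HasCompactSupport.intro (isCompact_Icc (a := -(n + 1 : ℝ)) (b := n + 1)) fun x hx => ?_
    have : (n + 1 : ℝ) < |x| := by
      by_contra! h
      exact hx (abs_le.1 h)
    exact max_eq_left ((min_le_right _ _).trans (by linarith))

theorem trapezoid_nonneg (n : ℕ) (x : ℝ) : 0 ≤ trapezoid n x := le_max_left _ _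

theorem trapezoid_eq_one {n : ℕ} {x : ℝ} (hx : |x| ≤ n) : trapezoid n x = 1 := by
  change max 0 (min 1 ((n : ℝ) + 1 - |x|)) = 1
  rw [min_eq_left (by linarith), max_eq_right zero_le_one]

/-- Continuous functions which vanish outside of `[-n, n]`. -/
abbrev SupportedIn (n : ℕ) : Type := {f : C(ℝ, ℝ) // ∀ x, (n : ℝ) < |x| → f x = 0}

/-- Inherited from the compact-open topology of `C(ℝ, ℝ)`; it supplies the dense sequence behind
`testFunction`. -/
instance (n : ℕ) : SecondCountableTopology (SupportedIn n) :=
  TopologicalSpace.Subtype.secondCountableTopology _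

instance (n : ℕ) : Nonempty (SupportedIn n) := ⟨⟨0, fun _ _ => rfl⟩⟩

theorem SupportedIn.hasCompactSupport {n : ℕ} (f : SupportedIn n) : HasCompactSupport f.1 := by
  refine HasCompactSupport.intro (isCompact_Icc (a := -(n : ℝ)) (b := n)) fun x hx => f.2 x ?_
  by_contra! h
  exact hx (abs_le.1 h)

/-- The compactly supported function underlying a function which vanishes outside of `[-n, n]`. -/
def SupportedIn.toCc {n : ℕ} (f : SupportedIn n) : C_c(ℝ, ℝ) := ⟨f.1, f.hasCompactSupport⟩

/-- A countable family of test functions which determines the topology of `N(ℝ)`. -/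
def testFunction : ℕ × (ℕ ⊕ Unit) → C_c(ℝ, ℝ)
  | (n, Sum.inl k) => (TopologicalSpace.denseSeq (SupportedIn n) k).toCc
  | (n, Sum.inr _) => trapezoid n

/-- The integrals against the countable family of test functions. -/
def testIntegrals (ν : PointMeasure) (i : ℕ × (ℕ ⊕ Unit)) : ℝ :=
  ∫ x, testFunction i x ∂ν.toMeasure

theorem exists_natCast_support_bound (f : C_c(ℝ, ℝ)) : ∃ n : ℕ, ∀ x : ℝ, (n : ℝ) < |x| → f x = 0 := by
  obtain ⟨r, hr⟩ := f.hasCompactSupport.isCompact.isBounded.subset_closedBall 0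
  obtain ⟨n, hn⟩ := exists_nat_ge r
  refine ⟨n, fun x hx => ?_⟩
  by_contra h
  have := hr (subset_tsupport _ h)
  simp at this
  linarith

/-- Density in the compact-open topology gives uniform closeness on `[-n, n]`, and both functions
vanish elsewhere. The error is written as a multiple of the trapezoid because that is itself a test
function, which controls the error after integration. -/
theorem exists_testFunction_near (f : C_c(ℝ, ℝ)) : ∃ n : ℕ, ∀ ε : ℝ, 0 < ε → ∃ k : ℕ,
    ∀ x, |f x - testFunction (n, Sum.inl k) x| ≤ ε * trapezoid n x := by
  obtain ⟨n, hn⟩ := exists_natCast_support_bound f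
  refine ⟨n, fun ε hε => ?_⟩
  let g : SupportedIn n := ⟨f.toContinuousMap, hn⟩
  have hopen : IsOpen {φ : SupportedIn n | ∀ x ∈ Icc (-(n : ℝ)) n, φ.1 x - f x ∈ Ioo (-ε) ε} := by
    have h1 : IsOpen {φ : C(ℝ, ℝ) | MapsTo φ (Icc (-(n : ℝ)) n) (Ioo (-ε) ε)} :=
      ContinuousMap.isOpen_setOfPred_mapsTo isCompact_Icc isOpen_Ioo
    have h2 : Continuous fun φ : SupportedIn n => φ.1 - f.toContinuousMap := by fun_prop
    exact h1.preimage h2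
  obtain ⟨k, hk⟩ := (TopologicalSpace.denseRange_denseSeq (SupportedIn n)).exists_mem_open hopen
    ⟨g, fun x _ => by simp [g, hε]⟩
  refine ⟨k, fun x => ?_⟩
  by_cases hx : |x| ≤ n
  · rw [trapezoid_eq_one hx, mul_one, abs_sub_comm]
    exact abs_le.2 (Ioo_subset_Icc_self (hk x (abs_le.1 hx)))
  · have h1 := hn x (not_le.1 hx)
    have h2 : testFunction (n, Sum.inl k) x = 0 :=
      (TopologicalSpace.denseSeq (SupportedIn n) k).2 x (not_le.1 hx)
    rw [h1, h2]
    simpa using mul_nonneg hε.le (trapezoid_nonneg n x)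

/-- Near a given measure the integral of the trapezoid is bounded, so uniform approximation of `f`
passes to integrals. Countability is the gain: the Borel σ-field of a topology induced by countably
many real functions is generated by these functions. -/
theorem topology_eq_induced_testIntegrals :
    (inferInstance : TopologicalSpace PointMeasure) =
      TopologicalSpace.induced testIntegrals inferInstance := by
  apply le_antisymm
  · exact continuous_iff_le_induced.1 (continuous_pi fun i => continuous_integral _)
  refine le_iInf fun f => ?_
  rw [← continuous_iff_le_induced]
  let _ : TopologicalSpace PointMeasure := TopologicalSpace.induced testIntegrals inferInstance
  have hc : ∀ i, Continuous fun ν : PointMeasure => ∫ x, testFunction i x ∂ν.toMeasure := fun i =>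
    (continuous_apply i).comp (continuous_induced_dom (f := testIntegrals))
  obtain ⟨n, hn⟩ := exists_testFunction_near f
  refine continuous_iff_continuousAt.2 fun ν₀ => ?_
  rw [ContinuousAt, Metric.tendsto_nhds]
  intro ε hε
  set c : ℝ := ∫ x, trapezoid n x ∂ν₀.toMeasure with hc_def
  have hc0 : 0 ≤ c := integral_nonneg fun x => trapezoid_nonneg n x
  -- Measures close to `ν₀` give the trapezoid an integral below `c + 1`, so this uniform error
  -- costs less than `ε / 3` after integration.
  obtain ⟨k, hk⟩ := hn (ε / (3 * (c + 1))) (by positivity)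
  have key : ∀ ν : PointMeasure, ∫ x, trapezoid n x ∂ν.toMeasure < c + 1 →
      |∫ x, f x ∂ν.toMeasure - ∫ x, testFunction (n, Sum.inl k) x ∂ν.toMeasure| < ε / 3 := by
    intro ν hν
    rw [← integral_sub (ν.integrable _) (ν.integrable _)]
    calc _ ≤ ∫ x, |f x - testFunction (n, Sum.inl k) x| ∂ν.toMeasure := abs_integral_le_integral_abs
      _ ≤ ∫ x, ε / (3 * (c + 1)) * trapezoid n x ∂ν.toMeasure :=
        integral_mono ((ν.integrable _).sub (ν.integrable _)).abs
          ((ν.integrable (trapezoid n)).const_mul _) hk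
      _ = ε / (3 * (c + 1)) * ∫ x, trapezoid n x ∂ν.toMeasure := integral_const_mul _ _
      _ < ε / (3 * (c + 1)) * (c + 1) := by gcongr
      _ = ε / 3 := by field_simp
  have e1 := Metric.tendsto_nhds.1 ((hc (n, Sum.inl k)).tendsto ν₀) (ε / 3) (by positivity)
  have e2 := ((hc (n, Sum.inr ())).tendsto ν₀).eventually_lt_const (u := c + 1) (lt_add_one c)
  filter_upwards [e1, e2] with ν h1 h2
  have h3 := key ν h2
  have h4 := key ν₀ (lt_add_one c)
  rw [Real.dist_eq] at h1 ⊢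
  rw [abs_lt] at *
  constructor <;> linarith [h1.1, h1.2, h3.1, h3.2, h4.1, h4.2]

/-- A bump function which increases to the indicator of `(a, b)`. -/
def bump (a b : ℝ) (n : ℕ) : C_c(ℝ, ℝ) where
  toFun x := min 1 (n * max 0 (min (x - a) (b - x)))
  continuous_toFun := by fun_prop
  hasCompactSupport' := by
    refine HasCompactSupport.intro (isCompact_Icc (a := a) (b := b)) fun x hx => ?_
    have : min (x - a) (b - x) ≤ 0 := by
      rw [min_le_iff]
      by_contra! h
      exact hx ⟨by linarith [h.1], by linarith [h.2]⟩
    simp [max_eq_left this]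

theorem tendsto_bump (a b : ℝ) (x : ℝ) :
    Tendsto (fun n => bump a b n x) atTop (𝓝 ((Ioo a b).indicator 1 x)) := by
  change Tendsto (fun n : ℕ => min 1 ((n : ℝ) * max 0 (min (x - a) (b - x)))) atTop _
  by_cases hx : x ∈ Ioo a b
  · have hpos : 0 < max 0 (min (x - a) (b - x)) :=
      lt_max_of_lt_right (lt_min (by linarith [hx.1]) (by linarith [hx.2]))
    rw [indicator_of_mem hx]
    refine tendsto_const_nhds.congr' ?_
    filter_upwards [(tendsto_natCast_atTop_atTop (R := ℝ)).eventually_ge_atTop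
      (max 0 (min (x - a) (b - x)))⁻¹] with n hn
    rw [min_eq_left, Pi.one_apply]
    calc (1 : ℝ) = (max 0 (min (x - a) (b - x)))⁻¹ * max 0 (min (x - a) (b - x)) := by
          field_simp
      _ ≤ _ := by gcongr
  · rw [indicator_of_notMem hx]
    have : min (x - a) (b - x) ≤ 0 := by
      rw [min_le_iff]
      by_contra! h
      exact hx ⟨by linarith [h.1], by linarith [h.2]⟩
    simp [max_eq_left this]

theorem tendsto_integral_bump (ν : PointMeasure) (a b : ℝ) :
    Tendsto (fun n => ∫ x, bump a b n x ∂ν.toMeasure) atTop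
      (𝓝 (ν.toMeasure (Ioo a b)).toReal) := by
  have hfin : ν.toMeasure (Icc a b) < ∞ := ν.finite_of_isBounded _ (Metric.isBounded_Icc _ _)
  have := tendsto_integral_of_dominated_convergence (μ := ν.toMeasure)
    (F := fun n x => bump a b n x) (f := (Ioo a b).indicator 1) ((Icc a b).indicator 1)
    (fun n => (bump a b n).continuous.aestronglyMeasurable)
    ((integrable_indicator_iff measurableSet_Icc).2 (integrableOn_const hfin.ne))
    (fun n => Eventually.of_forall fun x => ?_) (Eventually.of_forall fun x => tendsto_bump a b x)
  · simpa [integral_indicator_one measurableSet_Ioo, Measure.real] using this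
  · have h0 : 0 ≤ bump a b n x := le_min zero_le_one (by positivity)
    rw [Real.norm_of_nonneg h0]
    by_cases hx : x ∈ Icc a b
    · rw [indicator_of_mem hx]; exact min_le_left _ _
    · rw [indicator_of_notMem hx]
      have : min (x - a) (b - x) ≤ 0 := by
        rw [min_le_iff]
        by_contra! h
        exact hx ⟨by linarith [h.1], by linarith [h.2]⟩
      change min 1 ((n : ℝ) * max 0 (min (x - a) (b - x))) ≤ 0
      simp [max_eq_left this]

end PointMeasure

/-- A family of measures on the line is measurable if the masses of open intervals are finite and
measurable. -/
theorem measurable_measure_of_Ioo {α : Type*} [MeasurableSpace α] {f : α → Measure ℝ}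
    (hfin : ∀ x a b, f x (Ioo a b) < ∞)
    (hf : ∀ a b : ℝ, Measurable fun x => f x (Ioo a b)) : Measurable f := by
  have hgen : (inferInstance : MeasurableSpace ℝ) =
      .generateFrom (⋃ (a : ℚ) (b : ℚ) (_ : a < b), {Ioo (a : ℝ) b}) := by
    rw [← Real.borel_eq_generateFrom_Ioo_rat]; exact BorelSpace.measurable_eq
  -- The π-system criterion is for finite measures, hence the localisation.
  have h1 : ∀ n : ℕ, Measurable fun x => (f x).restrict (Ioo (-(n : ℝ)) n) := by
    intro n
    have : ∀ x, IsFiniteMeasure ((f x).restrict (Ioo (-(n : ℝ)) n)) := fun x =>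
      ⟨by simpa using hfin x _ _⟩
    refine Measurable.measure_of_isPiSystem hgen Real.isPiSystem_Ioo_rat ?_ ?_
    · intro s hs
      simp only [mem_iUnion, mem_singleton_iff] at hs
      obtain ⟨a, b, -, rfl⟩ := hs
      simp_rw [Measure.restrict_apply measurableSet_Ioo, Ioo_inter_Ioo]
      exact hf _ _
    · simpa using hf _ _
  refine Measure.measurable_of_measurable_coe _ fun s hs => ?_
  have h2 : ∀ x, f x s = ⨆ n : ℕ, (f x).restrict (Ioo (-(n : ℝ)) n) s := by
    intro x
    simp_rw [Measure.restrict_apply hs]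
    rw [← Monotone.measure_iUnion, ← inter_iUnion]
    · congr 1
      symm
      refine inter_eq_left.2 fun y _ => mem_iUnion.2 ?_
      obtain ⟨n, hn⟩ := exists_nat_gt |y|
      exact ⟨n, abs_lt.1 hn⟩
    · intro m n hmn
      have : (m : ℝ) ≤ n := by exact_mod_cast hmn
      exact inter_subset_inter_right _ (Ioo_subset_Ioo (by linarith) this)
  simp_rw [h2]
  exact Measurable.iSup fun n => (Measure.measurable_coe hs).comp (h1 n)

namespace PointMeasure

theorem measurable_toMeasure : Measurable PointMeasure.toMeasure := by
  refine measurable_measure_of_Ioo (fun ν a b => ν.finite_of_isBounded _ (Metric.isBounded_Ioo _ _))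
    fun a b => ?_
  have h : Measurable fun ν : PointMeasure => (ν.toMeasure (Ioo a b)).toReal :=
    measurable_of_tendsto_metrizable (fun n => (continuous_integral (bump a b n)).measurable)
      (tendsto_pi_nhds.2 fun ν => tendsto_integral_bump ν a b)
  refine (funext fun ν => ?_ : (fun ν : PointMeasure => ν.toMeasure (Ioo a b)) = fun ν =>
    ENNReal.ofReal (ν.toMeasure (Ioo a b)).toReal) ▸ h.ennreal_ofReal
  exact (ENNReal.ofReal_toReal (ν.finite_of_isBounded _ (Metric.isBounded_Ioo _ _)).ne).symm

/-- One inclusion uses that integrals of the countably many test functions are measurable functions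
of the measure; the other that masses of open intervals are limits of integrals of bumps. -/
theorem measurableSpace_eq_comap :
    (instMeasurableSpace : MeasurableSpace PointMeasure) =
      MeasurableSpace.comap PointMeasure.toMeasure inferInstance := by
  apply le_antisymm
  · have h1 : (instMeasurableSpace : MeasurableSpace PointMeasure) =
        MeasurableSpace.comap testIntegrals inferInstance := by
      rw [show (instMeasurableSpace : MeasurableSpace PointMeasure) = borel PointMeasure from rfl]
      rw [BorelSpace.measurable_eq (α := ℕ × (ℕ ⊕ Unit) → ℝ), ← borel_comap]
      exact congrArg (@borel PointMeasure) topology_eq_induced_testIntegrals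
    rw [h1]
    let _ : MeasurableSpace PointMeasure := MeasurableSpace.comap PointMeasure.toMeasure inferInstance
    refine Measurable.comap_le (measurable_pi_lambda _ fun i => ?_)
    have h2 : ∀ ν : PointMeasure, testIntegrals ν i =
        (∫⁻ x, ENNReal.ofReal (testFunction i x) ∂ν.toMeasure).toReal -
          (∫⁻ x, ENNReal.ofReal (-testFunction i x) ∂ν.toMeasure).toReal := fun ν =>
      integral_eq_lintegral_pos_part_sub_lintegral_neg_part (ν.integrable _)
    simp_rw [h2]
    have h3 : Measurable PointMeasure.toMeasure := comap_measurable _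
    have h4 : Measurable (testFunction i) := (testFunction i).continuous.measurable
    exact ((Measure.measurable_lintegral h4.ennreal_ofReal).comp h3).ennreal_toReal.sub
      ((Measure.measurable_lintegral h4.neg.ennreal_ofReal).comp h3).ennreal_toReal
  · exact measurable_toMeasure.comap_le

theorem measurable_iff {α : Type*} [MeasurableSpace α] {f : α → PointMeasure} :
    Measurable f ↔ Measurable fun x => (f x).toMeasure := by
  rw [measurableSpace_eq_comap]
  exact measurable_comap_iff

theorem ext_of_Ioo {ν ν' : PointMeasure}
    (h : ∀ a b : ℚ, ν.toMeasure (Ioo (a : ℝ) b) = ν'.toMeasure (Ioo (a : ℝ) b)) : ν = ν' :=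
  PointMeasure.ext (Real.measure_ext_Ioo_rat h)

/-- A measure is determined by the masses of countably many intervals. This makes `w 0 = x` a
measurable condition on paths. -/
instance : MeasurableSingletonClass PointMeasure := by
  refine ⟨fun ν => ?_⟩
  have : ({ν} : Set PointMeasure) =
      ⋂ (a : ℚ) (b : ℚ), {ν' | ν'.toMeasure (Ioo (a : ℝ) b) = ν.toMeasure (Ioo (a : ℝ) b)} := by
    ext ν'
    simp only [mem_singleton_iff, mem_iInter, mem_ofPred_eq]
    exact ⟨fun h a b => by rw [h], ext_of_Ioo⟩
  rw [this]
  exact MeasurableSet.iInter fun a => MeasurableSet.iInter fun b =>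
    ((Measure.measurable_coe measurableSet_Ioo).comp measurable_toMeasure)
      (measurableSet_singleton _)

end PointMeasure

/-! ### S-finite kernels, and measurability of shifts and restrictions -/

/-- A kernel which gives finite mass to each piece of a fixed countable partition is s-finite. -/
theorem isSFiniteKernel_of_forall_lt_top {α β : Type*} [MeasurableSpace α] [MeasurableSpace β]
    (κ : Kernel α β) (B : ℕ → Set β) (hB : ∀ n, MeasurableSet (B n))
    (hcover : ⋃ n, B n = univ) (hfin : ∀ x n, κ x (B n) < ∞) : IsSFiniteKernel κ := by
  classical
  set D := disjointed B
  have hD : ∀ n, MeasurableSet (D n) := fun n => MeasurableSet.disjointed hB n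
  have hm : ∀ n, Measurable fun x => κ x (D n) := fun n => κ.measurable_coe (hD n)
  -- A finite kernel needs a bound uniform in `x`; sorting the parameters by the integer part of the
  -- mass provides one on each piece.
  let E : ℕ → ℕ → Set α := fun n k => {x | ⌊(κ x (D n)).toReal⌋₊ = k}
  have hE : ∀ n k, MeasurableSet (E n k) := fun n k =>
    (Nat.measurable_floor.comp (hm n).ennreal_toReal) (measurableSet_singleton k)
  let η : ℕ × ℕ → Kernel α β := fun p =>
    Kernel.piecewise (hE p.1 p.2) (κ.restrict (hD p.1)) 0
  have hη : ∀ p, IsFiniteKernel (η p) := by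
    rintro ⟨n, k⟩
    refine ⟨⟨(k + 1 : ℕ), ENNReal.natCast_lt_top _, fun x => ?_⟩⟩
    rw [Kernel.piecewise_apply]
    split_ifs with hx
    · rw [Kernel.restrict_apply' _ _ _ MeasurableSet.univ, univ_inter]
      have h1 : κ x (D n) < ∞ := (measure_mono (disjointed_subset B n)).trans_lt (hfin x n)
      rw [← ENNReal.ofReal_toReal h1.ne, ← ENNReal.ofReal_natCast]
      refine ENNReal.ofReal_le_ofReal ?_
      have h2 : ⌊(κ x (D n)).toReal⌋₊ = k := hx
      rw [← h2]
      push_cast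
      exact (Nat.lt_floor_add_one _).le
    · simp
  have hsum : κ = Kernel.sum η := by
    ext x s hs
    rw [Kernel.sum_apply' _ _ hs, ENNReal.tsum_prod (f := fun n k => η (n, k) x s)]
    have h1 : ∀ n, ∑' k, η (n, k) x s = κ x (s ∩ D n) := by
      intro n
      rw [tsum_eq_single ⌊(κ x (D n)).toReal⌋₊]
      · have hx : x ∈ E n ⌊(κ x (D n)).toReal⌋₊ := rfl
        rw [Kernel.piecewise_apply, if_pos hx, Kernel.restrict_apply' _ _ _ hs]
      · intro k hk
        have hx : x ∉ E n k := fun h => hk (Eq.symm h)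
        rw [Kernel.piecewise_apply, if_neg hx]
        rfl
    simp_rw [h1]
    rw [← measure_iUnion (fun i j hij => ((disjoint_disjointed B hij).mono inter_subset_right
      inter_subset_right)) fun n => hs.inter (hD n), ← inter_iUnion, iUnion_disjointed, hcover,
      inter_univ]
  rw [hsum]
  exact Kernel.isSFiniteKernel_sum

/-- The kernel `ν ↦ ν` from `N(ℝ)` to the line. -/
def pointKernel : Kernel PointMeasure ℝ := ⟨PointMeasure.toMeasure, PointMeasure.measurable_toMeasure⟩

theorem iUnion_Ioo_neg_natCast : ⋃ n : ℕ, Ioo (-(n : ℝ)) n = univ := by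
  refine eq_univ_of_forall fun x => mem_iUnion.2 ?_
  obtain ⟨n, hn⟩ := exists_nat_gt |x|
  exact ⟨n, abs_lt.1 hn⟩

instance : IsSFiniteKernel pointKernel :=
  isSFiniteKernel_of_forall_lt_top _ (fun n : ℕ => Ioo (-(n : ℝ)) n) (fun _ => measurableSet_Ioo)
    iUnion_Ioo_neg_natCast fun ν _ => ν.finite_of_isBounded _ (Metric.isBounded_Ioo _ _)

namespace PointMeasure

/-- S-finiteness of `pointKernel` is what allows the set to vary with `x`. -/
theorem measurable_mass {α : Type*} [MeasurableSpace α] {f : α → PointMeasure} (hf : Measurable f)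
    {D : Set (α × ℝ)} (hD : MeasurableSet D) :
    Measurable fun x => (f x).toMeasure (Prod.mk x ⁻¹' D) :=
  Kernel.measurable_kernel_prodMk_left (κ := pointKernel.comap f hf) hD

/-- Restricting to a measurably varying set after a measurable shift is measurable. -/
theorem measurable_restrict_shift {α : Type*} [MeasurableSpace α] {f : α → PointMeasure}
    (hf : Measurable f) {t : α → ℝ} (ht : Measurable t) {I : Set ℝ} (hI : MeasurableSet I) :
    Measurable fun x => ((f x).shift (t x)).restrict I := by
  rw [measurable_iff]
  refine Measure.measurable_of_measurable_coe _ fun B hB => ?_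
  have h1 : ∀ x, (((f x).shift (t x)).restrict I).toMeasure B =
      (f x).toMeasure (Prod.mk x ⁻¹' {p : α × ℝ | p.2 - t p.1 ∈ B ∩ I}) := by
    intro x
    change (((f x).toMeasure.map (fun y => y - t x)).restrict I) B = _
    rw [Measure.restrict_apply hB, Measure.map_apply (by fun_prop) (hB.inter hI)]
    rfl
  simp_rw [h1]
  refine measurable_mass hf ?_
  exact (measurable_snd.sub (ht.comp measurable_fst)) (hB.inter hI)

theorem measurable_shift : Measurable fun p : PointMeasure × ℝ => p.1.shift p.2 := by
  have h := measurable_restrict_shift (measurable_fst (α := PointMeasure) (β := ℝ)) measurable_snd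
    MeasurableSet.univ
  convert h using 2 with p
  exact PointMeasure.ext (Measure.restrict_univ).symm

theorem measurable_restrict {I : Set ℝ} (hI : MeasurableSet I) :
    Measurable fun ν : PointMeasure => ν.restrict I := by
  rw [measurable_iff]
  refine Measure.measurable_of_measurable_coe _ fun B hB => ?_
  have h : ∀ ν : PointMeasure, (ν.restrict I).toMeasure B = ν.toMeasure (B ∩ I) := fun ν =>
    Measure.restrict_apply hB
  simp_rw [h]
  exact (Measure.measurable_coe (hB.inter hI)).comp measurable_toMeasure

end PointMeasure

theorem measurable_toWindow (A : ℝ≥0) : Measurable (toWindow A) :=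
  (PointMeasure.measurable_restrict measurableSet_Ioc).subtype_mk

/-! ### Regularity of window paths -/

namespace PointMeasure

theorem tendsto_iff {α : Type*} {l : Filter α} {f : α → PointMeasure} {ν : PointMeasure} :
    Tendsto f l (𝓝 ν) ↔ ∀ φ : C_c(ℝ, ℝ),
      Tendsto (fun x => ∫ y, φ y ∂(f x).toMeasure) l (𝓝 (∫ y, φ y ∂ν.toMeasure)) := by
  rw [show 𝓝 ν = ⨅ φ : C_c(ℝ, ℝ), comap (fun ν : PointMeasure => ∫ x, φ x ∂ν.toMeasure)
    (𝓝 (∫ y, φ y ∂ν.toMeasure)) by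
      rw [nhds_iInf]; exact iInf_congr fun φ => nhds_induced _ _]
  simp only [tendsto_iInf, tendsto_comap_iff]
  rfl

theorem integral_restrict_shift (ν : PointMeasure) (s : ℝ) {J : Set ℝ} (hJ : MeasurableSet J)
    (φ : C_c(ℝ, ℝ)) : ∫ y, φ y ∂((ν.shift s).restrict J).toMeasure =
      ∫ u, J.indicator φ (u - s) ∂ν.toMeasure := by
  change ∫ y, φ y ∂((ν.toMeasure.map (fun x => x - s)).restrict J) = _
  rw [← integral_indicator hJ, integral_map (by fun_prop)]
  exact (φ.continuous.measurable.indicator hJ).aestronglyMeasurable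

/-- Dominated convergence, atom by atom. The limiting window `J` may differ from `I`: for limits
from the left an atom leaving through `-A` is still counted, and one at `0` is not yet counted. -/
theorem tendsto_restrict_shift (ν : PointMeasure) {I J : Set ℝ} (hI : MeasurableSet I)
    (hJ : MeasurableSet J) (hIb : Bornology.IsBounded I) {l : Filter ℝ} [l.IsCountablyGenerated]
    {t : ℝ} (hl : l ≤ 𝓝 t) (h : ∀ u, ∀ᶠ s in l, (u - s ∈ I ↔ u - t ∈ J)) :
    Tendsto (fun s => (ν.shift s).restrict I) l (𝓝 ((ν.shift t).restrict J)) := by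
  rw [tendsto_iff]
  intro φ
  simp_rw [integral_restrict_shift ν _ hI φ, integral_restrict_shift ν _ hJ φ]
  obtain ⟨r, hr⟩ := hIb.subset_closedBall 0
  obtain ⟨C, hC⟩ := φ.hasCompactSupport.exists_bound_of_continuous φ.continuous
  have hfin : ν.toMeasure (Icc (t - 1 - r) (t + 1 + r)) < ∞ :=
    ν.finite_of_isBounded _ (Metric.isBounded_Icc _ _)
  have h1 : ∀ᶠ s in l, s ∈ Ioo (t - 1) (t + 1) :=
    hl (Ioo_mem_nhds (by linarith) (by linarith))
  refine tendsto_integral_filter_of_dominated_convergence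
    ((Icc (t - 1 - r) (t + 1 + r)).indicator fun _ => C) ?_ ?_ ?_ ?_
  · exact Eventually.of_forall fun s => ((φ.continuous.measurable.indicator hI).comp
      (measurable_id.sub_const s)).aestronglyMeasurable
  · filter_upwards [h1] with s hs
    refine Eventually.of_forall fun u => ?_
    by_cases hu : u - s ∈ I
    · rw [indicator_of_mem hu, indicator_of_mem]
      · exact hC _
      · have := hr hu
        rw [mem_closedBall_zero_iff, Real.norm_eq_abs, abs_le] at this
        exact ⟨by linarith [hs.1, this.1], by linarith [hs.2, this.2]⟩
    · rw [indicator_of_notMem hu, norm_zero]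
      exact indicator_nonneg (fun _ _ => (norm_nonneg _).trans (hC 0)) _
  · exact (integrable_indicator_iff measurableSet_Icc).2 (integrableOn_const hfin.ne)
  · refine Eventually.of_forall fun u => ?_
    -- The indicator is frozen at its limiting value, to which the moving one is eventually equal by
    -- `h`; only `φ` still moves.
    have h2 : Tendsto (fun s => J.indicator (fun _ => (1 : ℝ)) (u - t) * φ (u - s)) l
        (𝓝 (J.indicator (fun _ => (1 : ℝ)) (u - t) * φ (u - t))) := by
      refine Tendsto.const_mul _ (Tendsto.mono_left ?_ hl)
      exact (φ.continuous.comp (continuous_const.sub continuous_id)).tendsto t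
    have h3 : J.indicator (fun _ => (1 : ℝ)) (u - t) * φ (u - t) = J.indicator φ (u - t) := by
      by_cases hu : u - t ∈ J <;> simp [hu]
    rw [h3] at h2
    refine h2.congr' ?_
    filter_upwards [h u] with s hs
    by_cases hu : u - t ∈ J
    · simp [hu, hs.2 hu]
    · rw [indicator_of_notMem (fun h => hu (hs.1 h)), indicator_of_notMem hu, zero_mul]

theorem restrict_shift_eq (ν : PointMeasure) (t : ℝ) {I : Set ℝ} (hI : MeasurableSet I) :
    (ν.shift t).restrict I = (ν.restrict ((fun x => x - t) ⁻¹' I)).shift t :=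
  PointMeasure.ext (Measure.restrict_map (by fun_prop) hI)

end PointMeasure

theorem tendsto_coe_nhdsWithin {t : ℝ≥0} {s : Set ℝ≥0} {s' : Set ℝ} (h : ∀ x ∈ s, (x : ℝ) ∈ s') :
    Tendsto ((↑) : ℝ≥0 → ℝ) (𝓝[s] t) (𝓝[s'] (t : ℝ)) :=
  tendsto_nhdsWithin_of_tendsto_nhds_of_eventually_within _
    ((NNReal.continuous_coe.tendsto t).mono_left nhdsWithin_le_nhds)
    (eventually_mem_nhdsWithin.mono h)

/-- The window path seen by a point measure has left limits, in which the window is open on the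
right and closed on the left. -/
theorem tendsto_window_left (A : ℝ≥0) (ν : PointMeasure) (t : ℝ≥0) :
    Tendsto (fun s : ℝ≥0 => (toWindow A (ν.shift s)).1) (𝓝[<] t)
      (𝓝 ((ν.restrict (Ico ((t : ℝ) - A) t)).shift t)) := by
  have h1 : (ν.restrict (Ico ((t : ℝ) - A) t)).shift t = (ν.shift t).restrict (Ico (-(A : ℝ)) 0) := by
    rw [PointMeasure.restrict_shift_eq _ _ measurableSet_Ico]
    congr 2
    ext x
    simp only [mem_preimage, mem_Ico]
    constructor <;> rintro ⟨h, h'⟩ <;> constructor <;> linarith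
  rw [h1]
  refine (ν.tendsto_restrict_shift (I := Ioc (-(A : ℝ)) 0) measurableSet_Ioc measurableSet_Ico
    (Metric.isBounded_Ioc _ _) (l := 𝓝[<] (t : ℝ)) nhdsWithin_le_nhds fun u => ?_).comp
    (tendsto_coe_nhdsWithin fun x hx => by simpa using hx)
  rcases lt_or_ge u t with h | h
  · have h2 : ∀ᶠ s in 𝓝[<] (t : ℝ), u < s := nhdsWithin_le_nhds (lt_mem_nhds h)
    rcases lt_or_ge u (t - A) with h' | h'
    · have h3 : ∀ᶠ s in 𝓝[<] (t : ℝ), u + A < s :=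
        nhdsWithin_le_nhds (lt_mem_nhds (by linarith))
      filter_upwards [h3] with s hs
      exact ⟨fun hh => absurd hh.1 (by linarith), fun hh => absurd hh.1 (by linarith)⟩
    · filter_upwards [h2, self_mem_nhdsWithin] with s hs hs'
      rw [mem_Iio] at hs'
      exact ⟨fun _ => ⟨by linarith, by linarith⟩, fun _ => ⟨by linarith, by linarith⟩⟩
  · filter_upwards [self_mem_nhdsWithin] with s hs'
    rw [mem_Iio] at hs'
    exact ⟨fun hh => absurd hh.2 (by linarith), fun hh => absurd hh.2 (by linarith)⟩

theorem isCadlag_window (A : ℝ≥0) (ν : PointMeasure) :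
    IsCadlag fun t : ℝ≥0 => toWindow A (ν.shift t) := by
  refine ⟨fun t => ?_, fun t => ⟨_, tendsto_window_left A ν t⟩⟩
  rw [ContinuousWithinAt, tendsto_subtype_rng]
  refine (ν.tendsto_restrict_shift (I := Ioc (-(A : ℝ)) 0) (J := Ioc (-(A : ℝ)) 0) measurableSet_Ioc
    measurableSet_Ioc (Metric.isBounded_Ioc _ _) (l := 𝓝[≥] (t : ℝ)) nhdsWithin_le_nhds
    fun u => ?_).comp (tendsto_coe_nhdsWithin fun x hx => by simpa using hx)
  rcases lt_or_ge (t : ℝ) u with h | h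
  · have h2 : ∀ᶠ s in 𝓝[≥] (t : ℝ), s < u := nhdsWithin_le_nhds (gt_mem_nhds h)
    filter_upwards [h2] with s hs
    exact ⟨fun hh => absurd hh.2 (by linarith), fun hh => absurd hh.2 (by linarith)⟩
  · rcases lt_or_ge (t - A : ℝ) u with h' | h'
    · have h3 : ∀ᶠ s in 𝓝[≥] (t : ℝ), s < u + A :=
        nhdsWithin_le_nhds (gt_mem_nhds (by linarith))
      filter_upwards [h3, self_mem_nhdsWithin] with s hs hs'
      rw [mem_Ici] at hs'
      exact ⟨fun _ => ⟨by linarith, by linarith⟩, fun _ => ⟨by linarith, by linarith⟩⟩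
    · filter_upwards [self_mem_nhdsWithin] with s hs'
      rw [mem_Ici] at hs'
      exact ⟨fun hh => absurd hh.1 (by linarith), fun hh => absurd hh.1 (by linarith)⟩

/-- The path of the window `(-A, 0]` as the point measure is shifted to the left. -/
def windowPath (A : ℝ≥0) (ν : PointMeasure) : PathSpace A :=
  ⟨fun t => toWindow A (ν.shift t), isCadlag_window A ν⟩

theorem measurable_windowPath (A : ℝ≥0) : Measurable (windowPath A) := by
  refine Measurable.subtype_mk (measurable_pi_lambda _ fun t => ?_)
  exact (measurable_toWindow A).comp
    (PointMeasure.measurable_shift.comp (measurable_id.prodMk measurable_const))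

/-- Atoms only travel to the left, so those at or below `-A` never return to the window and can be
discarded at the time of the shift. -/
theorem windowPath_shift (A : ℝ≥0) (ν : PointMeasure) (s : ℝ≥0) :
    (windowPath A ν).shift s = windowPath A ((ν.shift s).restrict (Ioi (-(A : ℝ)))) := by
  refine Subtype.ext (funext fun t => Subtype.ext (PointMeasure.ext ?_))
  change (ν.toMeasure.map (fun x => x - ((s + t : ℝ≥0) : ℝ))).restrict (Ioc (-(A : ℝ)) 0) =
    (((ν.toMeasure.map (fun x => x - (s : ℝ))).restrict (Ioi (-(A : ℝ)))).map
      (fun x => x - (t : ℝ))).restrict (Ioc (-(A : ℝ)) 0)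
  rw [Measure.restrict_map (by fun_prop) measurableSet_Ioi,
    Measure.map_map (by fun_prop) (by fun_prop), Measure.restrict_map (by fun_prop) measurableSet_Ioc,
    Measure.restrict_map (by fun_prop) measurableSet_Ioc,
    Measure.restrict_restrict]
  · have h1 : ((fun x : ℝ => x - (t : ℝ)) ∘ fun x => x - (s : ℝ)) =
        fun x => x - ((s + t : ℝ≥0) : ℝ) := by
      funext x; simp; ring
    rw [h1]
    congr 2
    ext x
    have := t.2
    simp only [mem_preimage, mem_Ioc, mem_inter_iff, mem_Ioi, NNReal.coe_add]
    constructor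
    · rintro ⟨h, h'⟩; exact ⟨⟨h, h'⟩, by linarith [t.coe_nonneg]⟩
    · rintro ⟨h, -⟩; exact h
  · exact (measurable_id.sub_const _ |>.sub_const _) measurableSet_Ioc

/-! ### Configurations and their Laplace functionals -/

/-- Boundedly finite counting measures on the open quadrant `(0,∞) × (0,∞)`. -/
abbrev Conf : Type := {q : Measure (ℝ × ℝ) //
  (∀ B, MeasurableSet B → ∃ n : ℕ∞, q B = (n : ℝ≥0∞)) ∧
  (∀ B, Bornology.IsBounded B → q B < ∞) ∧ q (Ioi (0 : ℝ) ×ˢ Ioi (0 : ℝ))ᶜ = 0}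

namespace Conf

theorem apply_inter_quadrant (q : Conf) (B : Set (ℝ × ℝ)) :
    q.1 (B ∩ Ioi 0 ×ˢ Ioi 0) = q.1 B :=
  measure_inter_conull q.2.2.2

theorem apply_congr (q : Conf) {B B' : Set (ℝ × ℝ)}
    (h : ∀ p : ℝ × ℝ, 0 < p.1 → 0 < p.2 → (p ∈ B ↔ p ∈ B')) : q.1 B = q.1 B' := by
  rw [← apply_inter_quadrant, ← apply_inter_quadrant q B']
  congr 1
  ext p
  simp only [mem_inter_iff, mem_prod, mem_Ioi]
  exact ⟨fun ⟨h1, h2, h3⟩ => ⟨(h p h2 h3).1 h1, h2, h3⟩,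
    fun ⟨h1, h2, h3⟩ => ⟨(h p h2 h3).2 h1, h2, h3⟩⟩

theorem apply_Iic_prod_Iic (q : Conf) (t a : ℝ) :
    q.1 (Iic t ×ˢ Iic a) = q.1 (Ioc 0 t ×ˢ Ioc 0 a) :=
  q.apply_congr fun p h1 h2 => by simp [h1, h2, Prod.le_def]

theorem apply_Iic_prod_Iic_lt_top (q : Conf) (t a : ℝ) : q.1 (Iic t ×ˢ Iic a) < ∞ := by
  rw [apply_Iic_prod_Iic]
  exact q.2.2.1 _ ((Metric.isBounded_Ioc _ _).prod (Metric.isBounded_Ioc _ _))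

/-- The corners `(-∞, t] × (-∞, a]` with rational `t` and `a`. -/
def corners : Set (Set (ℝ × ℝ)) :=
  image2 (· ×ˢ ·) (⋃ a : ℚ, {Iic (a : ℝ)}) (⋃ a : ℚ, {Iic (a : ℝ)})

theorem isPiSystem_corners : IsPiSystem corners :=
  Real.isPiSystem_Iic_rat.prod Real.isPiSystem_Iic_rat

theorem iUnion_Iic_natCast : ⋃ n : ℕ, Iic (n : ℝ) = univ := by
  refine eq_univ_of_forall fun x => mem_iUnion.2 ?_
  obtain ⟨n, hn⟩ := exists_nat_ge x
  exact ⟨n, hn⟩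

theorem generateFrom_corners :
    (inferInstance : MeasurableSpace (ℝ × ℝ)) = MeasurableSpace.generateFrom corners := by
  have h1 : IsCountablySpanning (⋃ a : ℚ, {Iic (a : ℝ)}) :=
    ⟨fun n => Iic (n : ℝ), fun n => mem_iUnion.2 ⟨n, by simp⟩, iUnion_Iic_natCast⟩
  rw [corners, generateFrom_eq_prod ?_ ?_ h1 h1]
  all_goals
    rw [← Real.borel_eq_generateFrom_Iic_rat]
    exact BorelSpace.measurable_eq.symm

theorem iUnion_corner_natCast : ⋃ n : ℕ, Iic (n : ℝ) ×ˢ Iic (n : ℝ) = univ := by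
  refine eq_univ_of_forall fun x => mem_iUnion.2 ?_
  obtain ⟨n, hn⟩ := exists_nat_ge (max x.1 x.2)
  exact ⟨n, (le_max_left _ _).trans hn, (le_max_right _ _).trans hn⟩

/-- Rational corners form a π-system generating the Borel sets of the plane, and their masses are
finite because the points lie in the open quadrant. -/
theorem measurable_of_corners {α : Type*} [MeasurableSpace α] {f : α → Conf}
    (hf : ∀ t a : ℚ, Measurable fun x => (f x).1 (Iic (t : ℝ) ×ˢ Iic (a : ℝ))) : Measurable f := by
  refine Measurable.subtype_mk (f := fun x => (f x).1) ?_
  have h1 : ∀ n : ℕ, Measurable fun x => (f x).1.restrict (Iic (n : ℝ) ×ˢ Iic (n : ℝ)) := by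
    intro n
    have : ∀ x, IsFiniteMeasure ((f x).1.restrict (Iic (n : ℝ) ×ˢ Iic (n : ℝ))) := fun x =>
      ⟨by simpa using (f x).apply_Iic_prod_Iic_lt_top n n⟩
    refine Measurable.measure_of_isPiSystem generateFrom_corners isPiSystem_corners ?_ ?_
    · intro s hs
      obtain ⟨_, hs1, _, hs2, rfl⟩ := hs
      simp only [mem_iUnion, mem_singleton_iff] at hs1 hs2
      obtain ⟨a, rfl⟩ := hs1
      obtain ⟨b, rfl⟩ := hs2
      simp_rw [Measure.restrict_apply (measurableSet_Iic.prod measurableSet_Iic), prod_inter_prod,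
        Iic_inter_Iic]
      have := hf (min a n) (min b n)
      simpa using this
    · simpa using hf n n
  refine Measure.measurable_of_measurable_coe _ fun s hs => ?_
  have h2 : ∀ x, (f x).1 s = ⨆ n : ℕ, (f x).1.restrict (Iic (n : ℝ) ×ˢ Iic (n : ℝ)) s := by
    intro x
    simp_rw [Measure.restrict_apply hs]
    rw [← Monotone.measure_iUnion, ← inter_iUnion, iUnion_corner_natCast, inter_univ]
    intro m n hmn
    have : (m : ℝ) ≤ n := by exact_mod_cast hmn
    exact inter_subset_inter_right _ (prod_mono (Iic_subset_Iic.2 this) (Iic_subset_Iic.2 this))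
  simp_rw [h2]
  exact Measurable.iSup fun n => (Measure.measurable_coe hs).comp (h1 n)

theorem measurable_apply {B : Set (ℝ × ℝ)} (hB : MeasurableSet B) :
    Measurable fun q : Conf => q.1 B :=
  (Measure.measurable_coe hB).comp measurable_subtype_coe

/-- The exponential of minus the total mass given to a finite family of sets. -/
def expNeg {ι : Type*} [Fintype ι] (B : ι → Set (ℝ × ℝ)) (q : Measure (ℝ × ℝ)) : ℝ :=
  Real.exp (-∑ i, (q (B i)).toReal)

theorem expNeg_nonneg {ι : Type*} [Fintype ι] (B : ι → Set (ℝ × ℝ)) (q : Measure (ℝ × ℝ)) :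
    0 ≤ expNeg B q := (Real.exp_pos _).le

theorem expNeg_le_one {ι : Type*} [Fintype ι] (B : ι → Set (ℝ × ℝ)) (q : Measure (ℝ × ℝ)) :
    expNeg B q ≤ 1 := by
  rw [expNeg, Real.exp_le_one_iff, neg_nonpos]
  exact Finset.sum_nonneg fun _ _ => ENNReal.toReal_nonneg

theorem measurable_expNeg {ι : Type*} [Fintype ι] {B : ι → Set (ℝ × ℝ)}
    (hB : ∀ i, MeasurableSet (B i)) : Measurable fun q : Conf => expNeg B q.1 :=
  Real.measurable_exp.comp (Finset.measurable_sum _ fun i _ =>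
    (measurable_apply (hB i)).ennreal_toReal).neg

/-- The coordinate function `x ↦ exp (-x r)` on `ℝ≥0^(ℚ × ℚ)`. -/
def expCoord (r : ℚ × ℚ) : BoundedContinuousFunction (ℚ × ℚ → ℝ≥0) ℝ :=
  BoundedContinuousFunction.ofNormedAddCommGroup (fun x => Real.exp (-(x r : ℝ)))
    (by fun_prop) 1 fun x => by
      rw [Real.norm_of_nonneg (Real.exp_pos _).le, Real.exp_le_one_iff, neg_nonpos]
      exact (x r).2

/-- The algebra generated by the exponentials of the coordinates. -/
def expAlgebra : StarSubalgebra ℝ (BoundedContinuousFunction (ℚ × ℚ → ℝ≥0) ℝ) :=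
  { Algebra.adjoin ℝ (range expCoord) with
    star_mem' := fun {a} ha => by
      have : star a = a := by ext x; simp
      rw [this]; exact ha }

/-- Products of exponentials are exponentials of sums, so `expAlgebra` is the linear span of Laplace
functionals. Coordinates may repeat, hence a tuple and not a finite set. -/
theorem mem_closure_expCoord {g : BoundedContinuousFunction (ℚ × ℚ → ℝ≥0) ℝ}
    (hg : g ∈ Submonoid.closure (range expCoord)) :
    ∃ (n : ℕ) (r : Fin n → ℚ × ℚ), ∀ x, g x = Real.exp (-∑ i, (x (r i) : ℝ)) := by
  induction hg using Submonoid.closure_induction with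
  | mem g hg =>
    obtain ⟨r, rfl⟩ := hg
    exact ⟨1, fun _ => r, fun x => by simp [expCoord]⟩
  | one => exact ⟨0, Fin.elim0, fun x => by simp⟩
  | mul g g' _ _ h h' =>
    obtain ⟨n, r, hr⟩ := h
    obtain ⟨n', r', hr'⟩ := h'
    refine ⟨n + n', Fin.append r r', fun x => ?_⟩
    rw [BoundedContinuousFunction.mul_apply, hr, hr', ← Real.exp_add, Fin.sum_univ_add]
    simp [add_comm]

theorem expAlgebra_separatesPoints :
    (expAlgebra.map (BoundedContinuousFunction.toContinuousMapStarₐ ℝ)).SeparatesPoints := by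
  intro x y hxy
  obtain ⟨r, hr⟩ := Function.ne_iff.1 hxy
  refine ⟨expCoord r, ⟨_, ⟨expCoord r, Algebra.subset_adjoin ⟨r, rfl⟩, rfl⟩, rfl⟩, ?_⟩
  intro h
  apply hr
  have h1 : Real.exp (-(x r : ℝ)) = Real.exp (-(y r : ℝ)) := h
  exact NNReal.coe_injective (neg_injective (Real.exp_injective h1))

/-- The masses of the rational corners. -/
def cornerMasses (q : Conf) (r : ℚ × ℚ) : ℝ≥0 := (q.1 (Iic (r.1 : ℝ) ×ˢ Iic (r.2 : ℝ))).toNNReal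

theorem measurable_cornerMasses : Measurable cornerMasses :=
  measurable_pi_lambda _ fun _ =>
    (measurable_apply (measurableSet_Iic.prod measurableSet_Iic)).ennreal_toNNReal

theorem measurableSpace_le_comap_cornerMasses :
    (Subtype.instMeasurableSpace : MeasurableSpace Conf) ≤
      MeasurableSpace.comap cornerMasses MeasurableSpace.pi := by
  have h : @Measurable Conf Conf (MeasurableSpace.comap cornerMasses MeasurableSpace.pi)
      Subtype.instMeasurableSpace id := by
    refine @measurable_of_corners Conf (MeasurableSpace.comap cornerMasses MeasurableSpace.pi) id
      fun t a => ?_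
    have h1 : (fun q : Conf => (id q).1 (Iic (t : ℝ) ×ˢ Iic (a : ℝ))) =
        fun q => ((cornerMasses q (t, a) : ℝ≥0) : ℝ≥0∞) :=
      funext fun q => (ENNReal.coe_toNNReal (q.apply_Iic_prod_Iic_lt_top _ _).ne).symm
    rw [h1]
    exact measurable_coe_nnreal_ennreal.comp
      ((measurable_pi_apply (t, a)).comp (comap_measurable cornerMasses))
  exact fun s hs => h hs

/-- The Laplace functional on corners determines finite measures on configurations. -/
theorem ext_of_expNeg {μ μ' : Measure Conf} [IsFiniteMeasure μ] [IsFiniteMeasure μ']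
    (h : ∀ (n : ℕ) (r : Fin n → ℚ × ℚ),
      ∫ q, expNeg (fun i => Iic ((r i).1 : ℝ) ×ˢ Iic ((r i).2 : ℝ)) q.1 ∂μ =
        ∫ q, expNeg (fun i => Iic ((r i).1 : ℝ) ×ˢ Iic ((r i).2 : ℝ)) q.1 ∂μ') : μ = μ' := by
  have key : μ.map cornerMasses = μ'.map cornerMasses := by
    -- A countable power of `ℝ≥0` is Polish, and on it an algebra of bounded continuous functions
    -- which separates points determines finite measures.
    refine ext_of_forall_mem_subalgebra_integral_eq_of_polish expAlgebra_separatesPoints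
      fun g hg => ?_
    have hg' : g ∈ Submodule.span ℝ (Submonoid.closure (range expCoord) : Set _) := by
      rw [← Algebra.adjoin_eq_span]; exact hg
    clear hg
    have hint : ∀ (g : BoundedContinuousFunction (ℚ × ℚ → ℝ≥0) ℝ) (μ : Measure (ℚ × ℚ → ℝ≥0))
        [IsFiniteMeasure μ], Integrable g μ := fun g μ _ => g.integrable μ
    induction hg' using Submodule.span_induction with
    | mem g hg =>
      obtain ⟨n, r, hr⟩ := mem_closure_expCoord hg
      rw [integral_map measurable_cornerMasses.aemeasurable g.continuous.aestronglyMeasurable,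
        integral_map measurable_cornerMasses.aemeasurable g.continuous.aestronglyMeasurable]
      simp_rw [hr]
      exact h n r
    | zero => simp
    | add x y hx hy h1 h2 =>
      simp only [BoundedContinuousFunction.coe_add, Pi.add_apply]
      rw [integral_add (hint _ _) (hint _ _), integral_add (hint _ _) (hint _ _), h1, h2]
    | smul c x hx h1 =>
      simp only [BoundedContinuousFunction.coe_smul, smul_eq_mul]
      rw [integral_const_mul, integral_const_mul, h1]
  ext s hs
  obtain ⟨s', hs', rfl⟩ := measurableSpace_le_comap_cornerMasses s hs
  rw [← Measure.map_apply measurable_cornerMasses hs', key,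
    Measure.map_apply measurable_cornerMasses hs']

end Conf

/-! ### Counting measures -/

/-- A measure whose values on measurable sets are natural numbers or infinite. -/
def IsCounting {α : Type*} [MeasurableSpace α] (μ : Measure α) : Prop :=
  ∀ B, MeasurableSet B → ∃ n : ℕ∞, μ B = (n : ℝ≥0∞)

namespace IsCounting

variable {α β : Type*} [MeasurableSpace α] [MeasurableSpace β]

/-- The image of `ℕ∞` is closed in `ℝ≥0∞`, so limits of finite partial sums stay in it. -/
theorem sum {ι : Type*} {μ : ι → Measure α} (h : ∀ i, IsCounting (μ i)) :
    IsCounting (Measure.sum μ) := by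
  intro B hB
  have h1 : Measure.sum μ B ∈ range (fun n : ℕ∞ => (n : ℝ≥0∞)) := by
    rw [Measure.sum_apply _ hB]
    refine ENat.isClosedEmbedding_toENNReal.isClosed_range.mem_of_tendsto
      (ENNReal.summable (f := fun i => μ i B)).hasSum (Eventually.of_forall fun s => ?_)
    classical
    induction s using Finset.induction_on with
    | empty => exact ⟨0, by simp⟩
    | insert i s hi ih =>
      obtain ⟨n, hn⟩ := ih
      obtain ⟨m, hm⟩ := h i B hB
      refine ⟨m + n, ?_⟩
      rw [Finset.sum_insert hi, hm, ← hn]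
      simp
  obtain ⟨n, hn⟩ := h1
  exact ⟨n, hn.symm⟩

theorem add {μ ν : Measure α} (h : IsCounting μ) (h' : IsCounting ν) : IsCounting (μ + ν) := by
  intro B hB
  obtain ⟨m, hm⟩ := h B hB
  obtain ⟨n, hn⟩ := h' B hB
  exact ⟨m + n, by simp [hm, hn]⟩

theorem restrict {μ : Measure α} (h : IsCounting μ) (S : Set α) :
    IsCounting (μ.restrict S) := by
  intro B hB
  rw [Measure.restrict_apply hB, ← measure_toMeasurable]
  exact h _ (measurableSet_toMeasurable _ _)

theorem map {μ : Measure α} (h : IsCounting μ) {f : α → β} (hf : Measurable f) :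
    IsCounting (μ.map f) := fun B hB => by
  rw [Measure.map_apply hf hB]; exact h _ (hf hB)

theorem dirac (x : α) : IsCounting (Measure.dirac x) := by
  intro B hB
  rw [Measure.dirac_apply' _ hB]
  by_cases hx : x ∈ B
  · exact ⟨1, by simp [hx]⟩
  · exact ⟨0, by simp [hx]⟩

/-- This discreteness replaces any explicit list of atoms: it yields intervals without points and
the case split between zero, one and several points. -/
theorem eq_zero_of_lt_one {μ : Measure α} (h : IsCounting μ) {B : Set α} (hB : MeasurableSet B)
    (hlt : μ B < 1) : μ B = 0 := by
  obtain ⟨n, hn⟩ := h B hB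
  rw [hn] at hlt ⊢
  have : n < 1 := by exact_mod_cast hlt
  simp [Order.lt_one_iff.1 this]

end IsCounting

/-! ### Construction of the Poisson law and its Laplace functional -/

/-- The number of sets of the family which contain the given point. -/
def coverCount {ι : Type*} [Fintype ι] (B : ι → Set (ℝ × ℝ)) (p : ℝ × ℝ) : ℝ :=
  ∑ i, (B i).indicator 1 p

section coverCount

variable {ι : Type*} [Fintype ι] {B : ι → Set (ℝ × ℝ)}

theorem coverCount_nonneg (p : ℝ × ℝ) : 0 ≤ coverCount B p :=
  Finset.sum_nonneg fun _ _ => indicator_nonneg (fun _ _ => zero_le_one) _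

theorem measurable_coverCount (hB : ∀ i, MeasurableSet (B i)) : Measurable (coverCount B) :=
  Finset.measurable_sum _ fun i _ => measurable_one.indicator (hB i)

theorem coverCount_eq_zero {p : ℝ × ℝ} (hp : ∀ i, p ∉ B i) : coverCount B p = 0 :=
  Finset.sum_eq_zero fun i _ => by simp [hp i]

/-- The open quadrant `(0,∞) × (0,∞)`. -/
def quadrant : Set (ℝ × ℝ) := Ioi 0 ×ˢ Ioi 0

theorem measurableSet_quadrant : MeasurableSet quadrant := measurableSet_Ioi.prod measurableSet_Ioi

/-- The logarithm of the Laplace functional of the unit intensity Poisson process on the quadrant,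
with the sign reversed. -/
def laplaceExponent {ι : Type*} [Fintype ι] (B : ι → Set (ℝ × ℝ)) : ℝ :=
  ∫ p in quadrant, (1 - Real.exp (-coverCount B p))

theorem exists_natCast_bound (hb : ∀ i, Bornology.IsBounded (B i)) :
    ∃ n : ℕ, ∀ i, ∀ p ∈ B i, |p.1| ≤ n ∧ |p.2| ≤ n := by
  have h := (Bornology.isBounded_iUnion (s := B)).2 hb
  obtain ⟨r, hr⟩ := h.subset_closedBall 0
  obtain ⟨n, hn⟩ := exists_nat_ge r
  refine ⟨n, fun i p hp => ?_⟩
  have := hr (mem_iUnion.2 ⟨i, hp⟩)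
  rw [mem_closedBall_zero_iff, Prod.norm_def, max_le_iff] at this
  exact ⟨this.1.trans hn, this.2.trans hn⟩

theorem integrable_one_sub_exp (hB : ∀ i, MeasurableSet (B i))
    (hb : ∀ i, Bornology.IsBounded (B i)) :
    Integrable fun p => 1 - Real.exp (-coverCount B p) := by
  obtain ⟨n, hn⟩ := exists_natCast_bound hb
  have hm : Measurable fun p => 1 - Real.exp (-coverCount B p) :=
    measurable_const.sub (Real.measurable_exp.comp (measurable_coverCount hB).neg)
  rw [← integrableOn_iff_integrable_of_support_subset (s := Icc (-(n : ℝ)) n ×ˢ Icc (-(n : ℝ)) n)]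
  · refine Measure.integrableOn_of_bounded (M := 1) ?_ hm.aestronglyMeasurable ?_
    · exact ((isCompact_Icc.prod isCompact_Icc).measure_lt_top).ne
    · refine Eventually.of_forall fun p => ?_
      have h1 : Real.exp (-coverCount B p) ≤ 1 := by
        rw [Real.exp_le_one_iff, neg_nonpos]; exact coverCount_nonneg p
      rw [Real.norm_of_nonneg (by linarith)]
      linarith [Real.exp_pos (-coverCount B p)]
  · intro p hp
    by_contra hp'
    refine hp ?_
    have : coverCount B p = 0 := coverCount_eq_zero fun i hi =>
      hp' ⟨abs_le.1 (hn i p hi).1, abs_le.1 (hn i p hi).2⟩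
    simp [this]

end coverCount

/-- The unit box with lower left corner `(m, n)`. -/
def unitBox (b : ℕ × ℕ) : Set (ℝ × ℝ) :=
  Ioc (b.1 : ℝ) (b.1 + 1) ×ˢ Ioc (b.2 : ℝ) (b.2 + 1)

theorem measurableSet_unitBox (b : ℕ × ℕ) : MeasurableSet (unitBox b) :=
  measurableSet_Ioc.prod measurableSet_Ioc

theorem volume_unitBox (b : ℕ × ℕ) : volume (unitBox b) = 1 := by
  rw [unitBox, Measure.volume_eq_prod, Measure.prod_prod]
  simp

instance (b : ℕ × ℕ) : IsProbabilityMeasure (volume.restrict (unitBox b)) :=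
  ⟨by simpa using volume_unitBox b⟩

theorem eq_of_mem_Ioc_natCast {x : ℝ} {m n : ℕ} (h : x ∈ Ioc (m : ℝ) (m + 1))
    (h' : x ∈ Ioc (n : ℝ) (n + 1)) : m = n := by
  have h1 : (m : ℝ) < n + 1 := h.1.trans_le h'.2
  have h2 : (n : ℝ) < m + 1 := h'.1.trans_le h.2
  norm_cast at h1 h2
  omega

theorem exists_mem_Ioc_natCast {x : ℝ} (hx : 0 < x) : ∃ n : ℕ, x ∈ Ioc (n : ℝ) (n + 1) := by
  refine ⟨⌈x⌉₊ - 1, ?_⟩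
  have h1 : 0 < ⌈x⌉₊ := Nat.ceil_pos.2 hx
  have h2 : ((⌈x⌉₊ - 1 : ℕ) : ℝ) + 1 = ⌈x⌉₊ := by
    rw [Nat.cast_sub h1]; simp
  constructor
  · linarith [Nat.ceil_lt_add_one hx.le]
  · rw [h2]; exact Nat.le_ceil x

theorem pairwise_disjoint_unitBox : Pairwise (Function.onFun Disjoint unitBox) := by
  intro b b' hb
  refine Set.disjoint_left.2 fun p hp hp' => hb ?_
  exact Prod.ext (eq_of_mem_Ioc_natCast hp.1 hp'.1) (eq_of_mem_Ioc_natCast hp.2 hp'.2)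

theorem iUnion_unitBox : ⋃ b, unitBox b = quadrant := by
  ext p
  simp only [mem_iUnion]
  constructor
  · rintro ⟨b, hb⟩
    exact ⟨(Nat.cast_nonneg _).trans_lt hb.1.1, (Nat.cast_nonneg _).trans_lt hb.2.1⟩
  · rintro ⟨h1, h2⟩
    obtain ⟨m, hm⟩ := exists_mem_Ioc_natCast h1
    obtain ⟨n, hn⟩ := exists_mem_Ioc_natCast h2
    exact ⟨(m, n), hm, hn⟩

/-- The number of points in a box, and a sequence of locations. -/
abbrev BoxSample : Type := ℕ × (ℕ → ℝ × ℝ)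

/-- A Poisson number with mean one and independent uniform locations. -/
def boxLaw (b : ℕ × ℕ) : Measure BoxSample :=
  (poissonMeasure 1).prod (Measure.infinitePi fun _ => volume.restrict (unitBox b))

instance (b : ℕ × ℕ) : IsProbabilityMeasure (boxLaw b) := by unfold boxLaw; infer_instance

/-- The points in a box. -/
def boxConf (b : ℕ × ℕ) (s : BoxSample) : Measure (ℝ × ℝ) :=
  Measure.sum fun i : Fin s.1 => (Measure.dirac (s.2 i)).restrict (unitBox b)

theorem boxConf_apply (b : ℕ × ℕ) (s : BoxSample) {D : Set (ℝ × ℝ)} (hD : MeasurableSet D) :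
    boxConf b s D = ∑ i ∈ Finset.range s.1, (D ∩ unitBox b).indicator 1 (s.2 i) := by
  rw [boxConf, Measure.sum_apply _ hD, tsum_fintype, Finset.sum_range]
  refine Finset.sum_congr rfl fun i _ => ?_
  rw [Measure.restrict_apply hD, Measure.dirac_apply' _ (hD.inter (measurableSet_unitBox b))]

theorem measurable_boxSample {g : BoxSample → ℝ≥0∞}
    (hg : ∀ k : ℕ, Measurable fun u => g (k, u)) : Measurable g :=
  measurable_from_prod_countable_right hg

theorem lintegral_poissonMeasure (r : ℝ≥0) (g : ℕ → ℝ≥0∞) :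
    ∫⁻ k, g k ∂poissonMeasure r =
      ∑' k : ℕ, ENNReal.ofReal (Real.exp (-r) * r ^ k / k.factorial) * g k := by
  rw [poissonMeasure, lintegral_sum_measure]
  refine tsum_congr fun k => ?_
  rw [lintegral_smul_measure, lintegral_dirac, smul_eq_mul]

theorem lintegral_id_poissonMeasure (r : ℝ≥0) : ∫⁻ k, (k : ℝ≥0∞) ∂poissonMeasure r = r := by
  rw [lintegral_poissonMeasure, tsum_eq_zero_add' ENNReal.summable]
  simp only [Nat.cast_zero, mul_zero, zero_add]
  have h1 : ∀ k : ℕ, ENNReal.ofReal (Real.exp (-r) * r ^ (k + 1) / (k + 1).factorial) *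
      ((k + 1 : ℕ) : ℝ≥0∞) = r * ENNReal.ofReal (Real.exp (-r) * r ^ k / k.factorial) := by
    intro k
    rw [← ENNReal.ofReal_natCast, ← ENNReal.ofReal_mul (by positivity), ← ENNReal.ofReal_coe_nnreal,
      ← ENNReal.ofReal_mul (by positivity)]
    congr 1
    rw [Nat.factorial_succ]
    push_cast
    field_simp
    ring
  simp_rw [h1]
  rw [ENNReal.tsum_mul_left]
  have h2 := lintegral_poissonMeasure r 1
  simp only [Pi.one_apply, lintegral_one, measure_univ, mul_one] at h2
  rw [← h2, mul_one]

/-- Given their number, the points of a box are independent and uniform, so the mean of the product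
is a power. -/
theorem lintegral_prod_range_boxLaw (b : ℕ × ℕ) {g : ℝ × ℝ → ℝ≥0∞} (hg : Measurable g) :
    ∫⁻ s, ∏ i ∈ Finset.range s.1, g (s.2 i) ∂boxLaw b =
      ∑' k : ℕ, ENNReal.ofReal (Real.exp (-1) / k.factorial) * (∫⁻ p in unitBox b, g p) ^ k := by
  have hm : Measurable fun s : BoxSample => ∏ i ∈ Finset.range s.1, g (s.2 i) :=
    measurable_boxSample fun k => Finset.measurable_prod (Finset.range k) fun i _ =>
      hg.comp (measurable_pi_apply i)
  rw [boxLaw, lintegral_prod _ hm.aemeasurable, lintegral_poissonMeasure]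
  refine tsum_congr fun k => ?_
  have hind : iIndepFun (fun i (u : ℕ → ℝ × ℝ) => g (u i))
      (Measure.infinitePi fun _ => volume.restrict (unitBox b)) :=
    iIndepFun_infinitePi (X := fun _ => g) fun _ => hg
  have hprod := lintegral_prod_eq_prod_lintegral_of_indepFun (Finset.range k)
    (fun i (u : ℕ → ℝ × ℝ) => g (u i)) hind fun i => hg.comp (measurable_pi_apply i)
  refine congrArg₂ _ ?_ (hprod.trans ?_)
  · simp
  · have : ∀ i, ∫⁻ u : ℕ → ℝ × ℝ, g (u i)
        ∂(Measure.infinitePi fun _ => volume.restrict (unitBox b)) = ∫⁻ p in unitBox b, g p := by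
      intro i
      rw [← lintegral_map (μ := Measure.infinitePi fun _ => volume.restrict (unitBox b))
        (f := g) (g := fun u : ℕ → ℝ × ℝ => u i) hg (measurable_pi_apply i)]
      have h := Measure.infinitePi_map_eval (fun _ : ℕ => volume.restrict (unitBox b)) i
      exact congrArg (fun μ => ∫⁻ p, g p ∂μ) h
    simp [this]

/-- Wald's identity: the mean number of points is one and their locations are uniform and
independent of it. -/
theorem lintegral_boxConf (b : ℕ × ℕ) {D : Set (ℝ × ℝ)} (hD : MeasurableSet D) :
    ∫⁻ s, boxConf b s D ∂boxLaw b = volume (D ∩ unitBox b) := by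
  simp_rw [boxConf_apply b _ hD]
  have hDb := hD.inter (measurableSet_unitBox b)
  have hg : Measurable ((D ∩ unitBox b).indicator (1 : ℝ × ℝ → ℝ≥0∞)) :=
    measurable_one.indicator hDb
  have hm : Measurable fun s : BoxSample => ∑ i ∈ Finset.range s.1,
      (D ∩ unitBox b).indicator (1 : ℝ × ℝ → ℝ≥0∞) (s.2 i) :=
    measurable_boxSample fun k => Finset.measurable_sum (Finset.range k) fun i _ =>
      hg.comp (measurable_pi_apply i)
  rw [boxLaw, lintegral_prod _ hm.aemeasurable]
  have h1 : ∀ i, ∫⁻ u : ℕ → ℝ × ℝ, (D ∩ unitBox b).indicator (1 : ℝ × ℝ → ℝ≥0∞) (u i)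
      ∂(Measure.infinitePi fun _ => volume.restrict (unitBox b)) = volume (D ∩ unitBox b) := by
    intro i
    rw [← lintegral_map (μ := Measure.infinitePi fun _ => volume.restrict (unitBox b))
      (g := fun u : ℕ → ℝ × ℝ => u i) hg (measurable_pi_apply i)]
    have h := Measure.infinitePi_map_eval (fun _ : ℕ => volume.restrict (unitBox b)) i
    refine (congrArg (fun μ => ∫⁻ p, (D ∩ unitBox b).indicator (1 : ℝ × ℝ → ℝ≥0∞) p ∂μ) h).trans ?_
    rw [lintegral_indicator_one hDb, Measure.restrict_apply hDb, inter_assoc, inter_self]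
  have h2 : ∀ k : ℕ, ∫⁻ u : ℕ → ℝ × ℝ, ∑ i ∈ Finset.range k,
      (D ∩ unitBox b).indicator (1 : ℝ × ℝ → ℝ≥0∞) (u i)
      ∂(Measure.infinitePi fun _ => volume.restrict (unitBox b)) = k * volume (D ∩ unitBox b) := by
    intro k
    rw [lintegral_finsetSum (f := fun i (u : ℕ → ℝ × ℝ) =>
      (D ∩ unitBox b).indicator (1 : ℝ × ℝ → ℝ≥0∞) (u i)) _
      fun i _ => hg.comp (measurable_pi_apply i)]
    simp [h1]
  simp_rw [h2]
  rw [lintegral_mul_const _ (by fun_prop), lintegral_id_poissonMeasure]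
  simp

theorem Conf.expNeg_boxConf {ι : Type*} [Fintype ι] {B : ι → Set (ℝ × ℝ)}
    (hB : ∀ i, MeasurableSet (B i)) (b : ℕ × ℕ) (s : BoxSample) :
    ENNReal.ofReal (Conf.expNeg B (boxConf b s)) =
      ∏ j ∈ Finset.range s.1, ENNReal.ofReal
        (Real.exp (-coverCount (fun i => B i ∩ unitBox b) (s.2 j))) := by
  rw [← ENNReal.ofReal_prod_of_nonneg fun _ _ => (Real.exp_pos _).le, ← Real.exp_sum,
    Finset.sum_neg_distrib, Conf.expNeg]
  congr 3
  simp only [coverCount]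
  rw [Finset.sum_comm (s := Finset.range s.1)]
  refine Finset.sum_congr rfl fun i _ => ?_
  rw [boxConf_apply b s (hB i), ENNReal.toReal_sum]
  · refine Finset.sum_congr rfl fun j _ => ?_
    by_cases h : s.2 j ∈ B i ∩ unitBox b <;> simp [h]
  · intro j _
    by_cases h : s.2 j ∈ B i ∩ unitBox b <;> simp [h]

/-- With a Poisson number of mean one the mixture of powers is the exponential series `e⁻¹ ∑ cᵏ / k!
= exp (-(1 - c))`, and `1 - c` is the integral in the exponent because the box has unit area. -/
theorem lintegral_expNeg_boxConf {ι : Type*} [Fintype ι] {B : ι → Set (ℝ × ℝ)}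
    (hB : ∀ i, MeasurableSet (B i)) (hb : ∀ i, Bornology.IsBounded (B i)) (b : ℕ × ℕ) :
    ∫⁻ s, ENNReal.ofReal (Conf.expNeg B (boxConf b s)) ∂boxLaw b =
      ENNReal.ofReal (Real.exp (-∫ p in unitBox b, (1 - Real.exp (-coverCount B p)))) := by
  simp_rw [Conf.expNeg_boxConf hB]
  have hm := measurable_coverCount (B := fun i => B i ∩ unitBox b)
    fun i => (hB i).inter (measurableSet_unitBox b)
  have hg : Measurable fun p => ENNReal.ofReal
      (Real.exp (-coverCount (fun i => B i ∩ unitBox b) p)) :=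
    (Real.measurable_exp.comp hm.neg).ennreal_ofReal
  rw [lintegral_prod_range_boxLaw b hg]
  set c : ℝ := ∫ p in unitBox b, Real.exp (-coverCount B p) with hc
  have hint := (integrable_one_sub_exp hB hb).integrableOn (s := unitBox b)
  have h1 : ∫ p in unitBox b, (1 - Real.exp (-coverCount B p)) = 1 - c := by
    have h2 : IntegrableOn (fun p => Real.exp (-coverCount B p)) (unitBox b) := by
      have := (integrable_const (μ := volume.restrict (unitBox b)) (1 : ℝ)).sub hint
      refine this.congr (Eventually.of_forall fun p => ?_)
      simp
    rw [integral_sub (integrable_const _) h2]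
    simp [hc]
  have h3 : ∫⁻ p in unitBox b, ENNReal.ofReal
      (Real.exp (-coverCount (fun i => B i ∩ unitBox b) p)) = ENNReal.ofReal c := by
    rw [hc, ofReal_integral_eq_lintegral_ofReal]
    · refine setLIntegral_congr_fun (measurableSet_unitBox b) fun p hp => ?_
      simp only [coverCount]
      congr 3
      refine Finset.sum_congr rfl fun i _ => ?_
      by_cases h : p ∈ B i <;> simp [h, hp]
    · have := (integrable_const (μ := volume.restrict (unitBox b)) (1 : ℝ)).sub hint
      refine this.congr (Eventually.of_forall fun p => ?_)
      simp
    · exact Eventually.of_forall fun p => (Real.exp_pos _).le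
  have hc0 : 0 ≤ c := integral_nonneg fun p => (Real.exp_pos _).le
  rw [h1, h3]
  have h4 : HasSum (fun k : ℕ => Real.exp (-1) / k.factorial * c ^ k) (Real.exp (-(1 - c))) := by
    have h5 := (NormedSpace.expSeries_div_hasSum_exp c).mul_left (Real.exp (-1))
    rw [← Real.exp_eq_exp_ℝ, ← Real.exp_add] at h5
    convert! h5 using 1
    · funext k; ring
    · congr 1; ring
  rw [← h4.tsum_eq, ENNReal.ofReal_tsum_of_nonneg (fun k => by positivity) h4.summable]
  refine tsum_congr fun k => ?_
  rw [ENNReal.ofReal_mul (by positivity), ENNReal.ofReal_pow hc0]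

/-- The law of the independent samples in all unit boxes. -/
def sampleLaw : Measure (ℕ × ℕ → BoxSample) := Measure.infinitePi boxLaw

instance : IsProbabilityMeasure sampleLaw := by unfold sampleLaw; infer_instance

theorem boxConf_eq_zero {b : ℕ × ℕ} {s : BoxSample} {D : Set (ℝ × ℝ)}
    (h : ∀ p ∈ D, p ∉ unitBox b) : boxConf b s D = 0 := by
  rw [boxConf]
  refine Measure.sum_apply_eq_zero.2 fun i => ?_
  rw [Measure.restrict_apply' (measurableSet_unitBox b),
    (Set.disjoint_left.2 fun p hp hp' => h p hp hp' : Disjoint D (unitBox b)).inter_eq,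
    measure_empty]

theorem boxConf_lt_top (b : ℕ × ℕ) (s : BoxSample) (D : Set (ℝ × ℝ)) : boxConf b s D < ∞ := by
  refine (measure_mono (subset_univ D)).trans_lt ?_
  rw [boxConf_apply b s MeasurableSet.univ]
  refine ENNReal.sum_lt_top.2 fun i _ => ?_
  by_cases h : s.2 i ∈ univ ∩ unitBox b
  · rw [indicator_of_mem h]; exact ENNReal.one_lt_top
  · rw [indicator_of_notMem h]; exact ENNReal.zero_lt_top

theorem notMem_unitBox {n : ℕ} {b : ℕ × ℕ} (hb : b ∉ Finset.range n ×ˢ Finset.range n) {p : ℝ × ℝ}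
    (h1 : |p.1| ≤ n) (h2 : |p.2| ≤ n) : p ∉ unitBox b := by
  intro hp
  apply hb
  have h3 : (b.1 : ℝ) < n := hp.1.1.trans_le ((le_abs_self _).trans h1)
  have h4 : (b.2 : ℝ) < n := hp.2.1.trans_le ((le_abs_self _).trans h2)
  simpa using ⟨(by exact_mod_cast h3 : b.1 < n), (by exact_mod_cast h4 : b.2 < n)⟩

theorem sum_boxConf_apply (ω : ℕ × ℕ → BoxSample) {n : ℕ} {D : Set (ℝ × ℝ)}
    (hD : ∀ p ∈ D, |p.1| ≤ n ∧ |p.2| ≤ n) :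
    Measure.sum (fun b => boxConf b (ω b)) D =
      ∑ b ∈ Finset.range n ×ˢ Finset.range n, boxConf b (ω b) D := by
  rw [Measure.sum_apply_of_countable]
  exact tsum_eq_sum fun b hb => boxConf_eq_zero fun p hp => notMem_unitBox hb (hD p hp).1 (hD p hp).2

/-- The configuration made of the points in all boxes. -/
def sampleConf (ω : ℕ × ℕ → BoxSample) : Conf :=
  ⟨Measure.sum fun b => boxConf b (ω b), by
    refine ⟨?_, ?_, ?_⟩
    · exact IsCounting.sum fun b => IsCounting.sum fun i => (IsCounting.dirac _).restrict _
    · intro B hB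
      obtain ⟨n, hn⟩ := exists_natCast_bound (B := fun _ : Unit => B) fun _ => hB
      rw [sum_boxConf_apply ω (hn ())]
      exact ENNReal.sum_lt_top.2 fun b _ => boxConf_lt_top _ _ _
    · refine Measure.sum_apply_eq_zero.2 fun b => boxConf_eq_zero fun p hp hp' => hp ?_
      change p ∈ quadrant
      rw [← iUnion_unitBox]
      exact mem_iUnion.2 ⟨b, hp'⟩⟩

theorem measurable_boxConf_apply (b : ℕ × ℕ) {D : Set (ℝ × ℝ)} (hD : MeasurableSet D) :
    Measurable fun s => boxConf b s D := by
  simp_rw [boxConf_apply b _ hD]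
  have hg : Measurable ((D ∩ unitBox b).indicator (1 : ℝ × ℝ → ℝ≥0∞)) :=
    measurable_one.indicator (hD.inter (measurableSet_unitBox b))
  exact measurable_boxSample fun k => Finset.measurable_sum (Finset.range k) fun i _ =>
    hg.comp (measurable_pi_apply i)

theorem measurable_sampleConf : Measurable sampleConf := by
  refine Measurable.subtype_mk (Measure.measurable_of_measurable_coe _ fun D hD => ?_)
  simp_rw [Measure.sum_apply _ hD]
  exact Measurable.tsum fun b => (measurable_boxConf_apply b hD).comp (measurable_pi_apply b)

/-- The law of the unit intensity Poisson point process on the open quadrant. -/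
def poissonLaw : Measure Conf := sampleLaw.map sampleConf

instance : IsProbabilityMeasure poissonLaw :=
  Measure.isProbabilityMeasure_map measurable_sampleConf.aemeasurable

theorem lintegral_sampleLaw_eval (b : ℕ × ℕ) {g : BoxSample → ℝ≥0∞} (hg : Measurable g) :
    ∫⁻ ω, g (ω b) ∂sampleLaw = ∫⁻ s, g s ∂boxLaw b := by
  rw [← lintegral_map (μ := sampleLaw) (g := fun ω : ℕ × ℕ → BoxSample => ω b) hg
    (measurable_pi_apply b)]
  exact congrArg (fun μ => ∫⁻ p, g p ∂μ) (Measure.infinitePi_map_eval boxLaw b)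

theorem lintegral_poissonLaw_apply {D : Set (ℝ × ℝ)} (hD : MeasurableSet D) :
    ∫⁻ q, q.1 D ∂poissonLaw = volume (D ∩ quadrant) := by
  rw [poissonLaw, lintegral_map (Conf.measurable_apply hD) measurable_sampleConf]
  change ∫⁻ ω, (Measure.sum fun b => boxConf b (ω b)) D ∂sampleLaw = _
  simp_rw [Measure.sum_apply _ hD]
  rw [lintegral_tsum (f := fun b (ω : ℕ × ℕ → BoxSample) => boxConf b (ω b) D) fun b =>
    ((measurable_boxConf_apply b hD).comp (measurable_pi_apply b)).aemeasurable, ← iUnion_unitBox, inter_iUnion, measure_iUnion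
      (fun b b' hb => (pairwise_disjoint_unitBox hb).mono inter_subset_right inter_subset_right)
      fun b => hD.inter (measurableSet_unitBox b)]
  refine tsum_congr fun b => ?_
  rw [← lintegral_boxConf b hD, lintegral_sampleLaw_eval b (measurable_boxConf_apply b hD)]

theorem measurable_expNeg_boxConf {ι : Type*} [Fintype ι] {B : ι → Set (ℝ × ℝ)}
    (hB : ∀ i, MeasurableSet (B i)) (b : ℕ × ℕ) :
    Measurable fun s => Conf.expNeg B (boxConf b s) :=
  Real.measurable_exp.comp (Finset.measurable_sum _ fun i _ =>
    (measurable_boxConf_apply b (hB i)).ennreal_toReal).neg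

/-- The Laplace functional of the Poisson point process. -/
theorem lintegral_expNeg_poissonLaw {ι : Type*} [Fintype ι] {B : ι → Set (ℝ × ℝ)}
    (hB : ∀ i, MeasurableSet (B i)) (hb : ∀ i, Bornology.IsBounded (B i)) :
    ∫⁻ q, ENNReal.ofReal (Conf.expNeg B q.1) ∂poissonLaw =
      ENNReal.ofReal (Real.exp (-laplaceExponent B)) := by
  obtain ⟨n, hn⟩ := exists_natCast_bound hb
  set S := Finset.range n ×ˢ Finset.range n
  rw [poissonLaw, lintegral_map (Conf.measurable_expNeg hB).ennreal_ofReal measurable_sampleConf]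
  have h1 : ∀ ω, ENNReal.ofReal (Conf.expNeg B (sampleConf ω).1) =
      ∏ b ∈ S, ENNReal.ofReal (Conf.expNeg B (boxConf b (ω b))) := by
    intro ω
    rw [← ENNReal.ofReal_prod_of_nonneg fun _ _ => Conf.expNeg_nonneg _ _]
    simp only [Conf.expNeg]
    rw [← Real.exp_sum, Finset.sum_neg_distrib, Finset.sum_comm]
    congr 3
    refine Finset.sum_congr rfl fun i _ => ?_
    rw [← ENNReal.toReal_sum fun b _ => (boxConf_lt_top _ _ _).ne, ← sum_boxConf_apply ω (hn i)]
    rfl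
  simp_rw [h1]
  have hind : iIndepFun (fun b (ω : ℕ × ℕ → BoxSample) =>
      ENNReal.ofReal (Conf.expNeg B (boxConf b (ω b)))) sampleLaw :=
    iIndepFun_infinitePi (X := fun b s => ENNReal.ofReal (Conf.expNeg B (boxConf b s)))
      fun b => (measurable_expNeg_boxConf hB b).ennreal_ofReal
  rw [lintegral_prod_eq_prod_lintegral_of_indepFun S _ hind fun b =>
    (measurable_expNeg_boxConf hB b).ennreal_ofReal.comp (measurable_pi_apply b)]
  have h2 : ∀ b, ∫⁻ ω, ENNReal.ofReal (Conf.expNeg B (boxConf b (ω b))) ∂sampleLaw =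
      ENNReal.ofReal (Real.exp (-∫ p in unitBox b, (1 - Real.exp (-coverCount B p)))) := fun b => by
    rw [← lintegral_expNeg_boxConf hB hb b, lintegral_sampleLaw_eval b
      (measurable_expNeg_boxConf hB b).ennreal_ofReal]
  simp_rw [h2]
  rw [← ENNReal.ofReal_prod_of_nonneg fun _ _ => (Real.exp_pos _).le, ← Real.exp_sum,
    Finset.sum_neg_distrib, laplaceExponent]
  congr 3
  have h3 := hasSum_integral_iUnion measurableSet_unitBox pairwise_disjoint_unitBox
    (integrable_one_sub_exp hB hb).integrableOn
  rw [iUnion_unitBox] at h3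
  -- Boxes outside the finite square `S` meet no `B i`, so the integrand vanishes on them.
  refine (hasSum_sum_of_ne_finset_zero fun b hbS => ?_).unique h3
  rw [setIntegral_congr_fun (g := fun _ => (0 : ℝ)) (measurableSet_unitBox b)]
  · simp
  · intro p hp
    have : coverCount B p = 0 := coverCount_eq_zero fun i hi =>
      notMem_unitBox hbS (hn i p hi).1 (hn i p hi).2 hp
    simp [this]

theorem integral_expNeg_eq {α : Type*} [MeasurableSpace α] {μ : Measure α} {ι : Type*} [Fintype ι]
    {B : ι → Set (ℝ × ℝ)} {f : α → Conf} (hf : Measurable f)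
    (hB : ∀ i, MeasurableSet (B i)) :
    ∫ x, Conf.expNeg B (f x).1 ∂μ = (∫⁻ x, ENNReal.ofReal (Conf.expNeg B (f x).1) ∂μ).toReal :=
  integral_eq_lintegral_of_nonneg_ae (Eventually.of_forall fun _ => Conf.expNeg_nonneg _ _)
    ((Conf.measurable_expNeg hB).comp hf).aestronglyMeasurable

theorem integral_expNeg_poissonLaw {ι : Type*} [Fintype ι] {B : ι → Set (ℝ × ℝ)}
    (hB : ∀ i, MeasurableSet (B i)) (hb : ∀ i, Bornology.IsBounded (B i)) :
    ∫ q, Conf.expNeg B q.1 ∂poissonLaw = Real.exp (-laplaceExponent B) := by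
  have h := integral_expNeg_eq (μ := poissonLaw) measurable_id hB
  simp only [id_eq] at h
  rw [h, lintegral_expNeg_poissonLaw hB hb, ENNReal.toReal_ofReal (Real.exp_pos _).le]

/-! ### Restarting a configuration at a fixed time -/

namespace Conf

/-- The points after time `s`, seen from time `s`. -/
def shift (s : ℝ≥0) (q : Conf) : Conf :=
  ⟨(q.1.restrict (Ioi (s : ℝ) ×ˢ univ)).map fun p => (p.1 - (s : ℝ), p.2), by
    have hm : Measurable fun p : ℝ × ℝ => (p.1 - (s : ℝ), p.2) := by fun_prop
    refine ⟨(IsCounting.restrict (α := ℝ × ℝ) q.2.1 _).map hm, fun B hB => ?_, ?_⟩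
    · obtain ⟨n, hn⟩ := exists_natCast_bound (B := fun _ : Unit => B) fun _ => hB
      refine (measure_mono (t := Icc (-(n : ℝ)) n ×ˢ Icc (-(n : ℝ)) n)
        fun p hp => ⟨abs_le.1 (hn () p hp).1, abs_le.1 (hn () p hp).2⟩).trans_lt ?_
      rw [Measure.map_apply hm (measurableSet_Icc.prod measurableSet_Icc)]
      refine (Measure.restrict_apply_le _ _).trans_lt (q.2.2.1 _ ?_)
      refine ((Metric.isBounded_Icc (-(n : ℝ) + s) (n + s)).prod
        (Metric.isBounded_Icc (-(n : ℝ)) n)).subset fun p hp => ⟨⟨?_, ?_⟩, hp.2⟩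
      · linarith [hp.1.1]
      · linarith [hp.1.2]
    · rw [Measure.map_apply hm (measurableSet_Ioi.prod measurableSet_Ioi).compl,
        Measure.restrict_apply (hm (measurableSet_Ioi.prod measurableSet_Ioi).compl)]
      refine measure_mono_null (t := (Ioi (0 : ℝ) ×ˢ Ioi (0 : ℝ))ᶜ) (fun p hp hp' => hp.1 ⟨?_, hp'.2⟩) q.2.2.2
      have h1 : (s : ℝ) < p.1 := hp.2.1
      change 0 < p.1 - s
      linarith⟩

/-- The configuration which follows `q` up to time `s`, and then starts afresh with `q'`. -/
def concat (s : ℝ≥0) (q q' : Conf) : Conf :=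
  ⟨q.1.restrict (Iic (s : ℝ) ×ˢ univ) + q'.1.map fun p => (p.1 + (s : ℝ), p.2), by
    have hm : Measurable fun p : ℝ × ℝ => (p.1 + (s : ℝ), p.2) := by fun_prop
    refine ⟨(IsCounting.restrict (α := ℝ × ℝ) q.2.1 _).add (IsCounting.map (α := ℝ × ℝ) q'.2.1 hm),
      fun B hB => ?_, ?_⟩
    · rw [Measure.add_apply]
      refine ENNReal.add_lt_top.2 ⟨(Measure.restrict_apply_le _ _).trans_lt (q.2.2.1 _ hB), ?_⟩
      obtain ⟨n, hn⟩ := exists_natCast_bound (B := fun _ : Unit => B) fun _ => hB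
      refine (measure_mono (t := Icc (-(n : ℝ)) n ×ˢ Icc (-(n : ℝ)) n)
        fun p hp => ⟨abs_le.1 (hn () p hp).1, abs_le.1 (hn () p hp).2⟩).trans_lt ?_
      rw [Measure.map_apply hm (measurableSet_Icc.prod measurableSet_Icc)]
      refine q'.2.2.1 _ (((Metric.isBounded_Icc (-(n : ℝ) - s) (n - s)).prod
        (Metric.isBounded_Icc (-(n : ℝ)) n)).subset fun p hp => ⟨⟨?_, ?_⟩, hp.2⟩)
      · linarith [hp.1.1]
      · linarith [hp.1.2]
    · have hq : MeasurableSet (Ioi (0 : ℝ) ×ˢ Ioi (0 : ℝ))ᶜ :=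
        (measurableSet_Ioi.prod measurableSet_Ioi).compl
      rw [Measure.add_apply, add_eq_zero]
      refine ⟨measure_mono_null subset_rfl
        (le_antisymm ((Measure.restrict_apply_le _ _).trans q.2.2.2.le) bot_le), ?_⟩
      rw [Measure.map_apply hm hq]
      refine measure_mono_null (t := (Ioi (0 : ℝ) ×ˢ Ioi (0 : ℝ))ᶜ) (fun p hp hp' => hp ⟨?_, hp'.2⟩) q'.2.2.2
      have h1 : (0 : ℝ) < p.1 := hp'.1
      change 0 < p.1 + s
      linarith [s.coe_nonneg]⟩

theorem concat_apply (s : ℝ≥0) (q q' : Conf) {D : Set (ℝ × ℝ)} (hD : MeasurableSet D) :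
    (concat s q q').1 D = q.1 (D ∩ Iic (s : ℝ) ×ˢ univ) +
      q'.1 ((fun p => (p.1 + (s : ℝ), p.2)) ⁻¹' D) := by
  change (q.1.restrict (Iic (s : ℝ) ×ˢ univ) + q'.1.map fun p => (p.1 + (s : ℝ), p.2)) D = _
  rw [Measure.add_apply, Measure.restrict_apply hD, Measure.map_apply (by fun_prop) hD]

theorem shift_apply (s : ℝ≥0) (q : Conf) {D : Set (ℝ × ℝ)} (hD : MeasurableSet D) :
    (shift s q).1 D = q.1 ((fun p => (p.1 - (s : ℝ), p.2)) ⁻¹' D ∩ Ioi (s : ℝ) ×ˢ univ) := by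
  have hm : Measurable fun p : ℝ × ℝ => (p.1 - (s : ℝ), p.2) := by fun_prop
  change ((q.1.restrict (Ioi (s : ℝ) ×ˢ univ)).map fun p => (p.1 - (s : ℝ), p.2)) D = _
  rw [Measure.map_apply hm hD, Measure.restrict_apply (hm hD)]

theorem shift_concat (s : ℝ≥0) (q q' : Conf) : shift s (concat s q q') = q' := by
  refine Subtype.ext (Measure.ext fun D hD => ?_)
  have hm : Measurable fun p : ℝ × ℝ => (p.1 - (s : ℝ), p.2) := by fun_prop
  rw [shift_apply s _ hD, concat_apply s q q'
    ((hm hD).inter (measurableSet_Ioi.prod MeasurableSet.univ))]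
  have h1 : (fun p : ℝ × ℝ => (p.1 - (s : ℝ), p.2)) ⁻¹' D ∩ Ioi (s : ℝ) ×ˢ univ ∩
      Iic (s : ℝ) ×ˢ univ = ∅ := by
    ext p
    simp only [mem_inter_iff, mem_prod, mem_Ioi, mem_Iic, mem_univ, and_true, mem_empty_iff_false,
      iff_false, not_and, not_le]
    exact fun h => h.2
  rw [h1, measure_empty, zero_add]
  refine q'.apply_congr fun p h2 _ => ?_
  simp [h2]

theorem measurable_concat (s : ℝ≥0) : Measurable fun p : Conf × Conf => concat s p.1 p.2 := by
  refine measurable_of_corners fun t a => ?_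
  have hD : MeasurableSet (Iic (t : ℝ) ×ˢ Iic (a : ℝ)) := measurableSet_Iic.prod measurableSet_Iic
  have hm : Measurable fun p : ℝ × ℝ => (p.1 + (s : ℝ), p.2) := by fun_prop
  simp_rw [concat_apply s _ _ hD]
  exact ((measurable_apply (hD.inter (measurableSet_Iic.prod MeasurableSet.univ))).comp
    measurable_fst).add ((measurable_apply (hm hD)).comp measurable_snd)

end Conf

/-- The integral is cut at time `s`, and the later part is moved back to the origin by translation
invariance of Lebesgue measure. -/
theorem laplaceExponent_split {ι : Type*} [Fintype ι] {B : ι → Set (ℝ × ℝ)}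
    (hB : ∀ i, MeasurableSet (B i)) (hb : ∀ i, Bornology.IsBounded (B i)) (s : ℝ≥0) :
    laplaceExponent B = laplaceExponent (fun i => B i ∩ Iic (s : ℝ) ×ˢ univ) +
      laplaceExponent fun i => (fun p => (p.1 + (s : ℝ), p.2)) ⁻¹' B i := by
  have hI : MeasurableSet (Iic (s : ℝ) ×ˢ (univ : Set ℝ)) := measurableSet_Iic.prod MeasurableSet.univ
  have hint := integrable_one_sub_exp hB hb
  simp only [laplaceExponent]
  rw [← integral_inter_add_sdiff hI hint.integrableOn]
  congr 1
  · rw [← integral_indicator (measurableSet_quadrant.inter hI),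
      ← integral_indicator measurableSet_quadrant]
    congr 1
    funext p
    by_cases h1 : p ∈ quadrant
    · by_cases h2 : p ∈ Iic (s : ℝ) ×ˢ (univ : Set ℝ)
      · rw [indicator_of_mem (mem_inter h1 h2), indicator_of_mem h1]
        congr 3
        refine Finset.sum_congr rfl fun i _ => ?_
        by_cases h : p ∈ B i
        · rw [indicator_of_mem h, indicator_of_mem (mem_inter h h2)]
        · rw [indicator_of_notMem h, indicator_of_notMem fun hh => h hh.1]
      · rw [indicator_of_notMem fun hh => h2 hh.2, indicator_of_mem h1,
          coverCount_eq_zero fun i hi => h2 hi.2]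
        simp
    · rw [indicator_of_notMem fun hh => h1 hh.1, indicator_of_notMem h1]
  · rw [← integral_indicator (measurableSet_quadrant.diff hI),
      ← integral_indicator measurableSet_quadrant,
      ← integral_add_right_eq_self _ ((s : ℝ), (0 : ℝ))]
    congr 1
    funext p
    have h0 : p + ((s : ℝ), (0 : ℝ)) = (p.1 + s, p.2) := by ext <;> simp
    rw [h0]
    have h1 : ((p.1 + (s : ℝ), p.2) : ℝ × ℝ) ∈ quadrant \ Iic (s : ℝ) ×ˢ (univ : Set ℝ) ↔
        p ∈ quadrant := by
      simp only [quadrant, Set.mem_sdiff, mem_prod, mem_Ioi, mem_Iic, mem_univ, and_true, not_le]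
      constructor
      · rintro ⟨⟨-, h⟩, h'⟩; exact ⟨by linarith, h⟩
      · rintro ⟨h, h'⟩; exact ⟨⟨by linarith [s.coe_nonneg], h'⟩, by linarith⟩
    by_cases h : p ∈ quadrant
    · rw [indicator_of_mem (h1.2 h), indicator_of_mem h]; rfl
    · rw [indicator_of_notMem (fun hh => h (h1.1 hh)), indicator_of_notMem h]

/-- Starting afresh at a fixed time with an independent copy does not change the Poisson law. -/
theorem map_concat_poissonLaw (s : ℝ≥0) :
    (poissonLaw.prod poissonLaw).map (fun p => Conf.concat s p.1 p.2) = poissonLaw := by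
  have := Measure.isProbabilityMeasure_map (μ := poissonLaw.prod poissonLaw)
    (Conf.measurable_concat s).aemeasurable
  refine Conf.ext_of_expNeg fun n r => ?_
  -- Corners are unbounded; on configurations in the quadrant these bounded rectangles have the same
  -- masses.
  set B : Fin n → Set (ℝ × ℝ) := fun i => Ioc 0 ((r i).1 : ℝ) ×ˢ Ioc 0 ((r i).2 : ℝ) with hB_def
  have hB : ∀ i, MeasurableSet (B i) := fun i => measurableSet_Ioc.prod measurableSet_Ioc
  have hb : ∀ i, Bornology.IsBounded (B i) := fun i =>
    (Metric.isBounded_Ioc _ _).prod (Metric.isBounded_Ioc _ _)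
  have h0 : ∀ q : Conf, Conf.expNeg (fun i => Iic ((r i).1 : ℝ) ×ˢ Iic ((r i).2 : ℝ)) q.1 =
      Conf.expNeg B q.1 := by
    intro q
    simp only [Conf.expNeg, Conf.apply_Iic_prod_Iic, hB_def]
  simp_rw [h0]
  rw [integral_expNeg_poissonLaw hB hb, integral_map (Conf.measurable_concat s).aemeasurable
    (Conf.measurable_expNeg hB).aestronglyMeasurable, laplaceExponent_split hB hb s, neg_add,
    Real.exp_add]
  set B1 : Fin n → Set (ℝ × ℝ) := fun i => B i ∩ Iic (s : ℝ) ×ˢ univ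
  set B2 : Fin n → Set (ℝ × ℝ) := fun i => (fun p => (p.1 + (s : ℝ), p.2)) ⁻¹' B i
  have hB1 : ∀ i, MeasurableSet (B1 i) := fun i =>
    (hB i).inter (measurableSet_Iic.prod MeasurableSet.univ)
  have hb1 : ∀ i, Bornology.IsBounded (B1 i) := fun i => (hb i).subset inter_subset_left
  have hB2 : ∀ i, MeasurableSet (B2 i) := fun i =>
    (by fun_prop : Measurable fun p : ℝ × ℝ => (p.1 + (s : ℝ), p.2)) (hB i)
  have hb2 : ∀ i, Bornology.IsBounded (B2 i) := fun i =>
    ((Metric.isBounded_Ioc (0 - (s : ℝ)) ((r i).1 - s)).prod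
      (Metric.isBounded_Ioc 0 ((r i).2 : ℝ))).subset fun p hp =>
        ⟨⟨by linarith [hp.1.1], by linarith [hp.1.2]⟩, hp.2⟩
  rw [← integral_expNeg_poissonLaw hB1 hb1, ← integral_expNeg_poissonLaw hB2 hb2,
    ← integral_prod_mul]
  congr 1
  funext p
  simp only [Conf.expNeg]
  rw [← Real.exp_add, ← neg_add, ← Finset.sum_add_distrib]
  congr 2
  refine Finset.sum_congr rfl fun i _ => ?_
  rw [Conf.concat_apply s _ _ (hB i), ENNReal.toReal_add (p.1.2.2.1 _ (hb1 i)).ne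
    (p.2.2.2.1 _ (hb2 i)).ne]

/-! ### The thinning equation and its Picard iterates -/

/-- The causal convolution `u ↦ ∫_{(-∞,u)} g(u - s) m(ds)` of a nonnegative function and a
measure. -/
def causalConv (g : ℝ → ℝ≥0∞) (m : Measure ℝ) (u : ℝ) : ℝ≥0∞ := ∫⁻ s in Iio u, g (u - s) ∂m

theorem causalConv_mono {g : ℝ → ℝ≥0∞} {m m' : Measure ℝ} (h : m ≤ m') (u : ℝ) :
    causalConv g m u ≤ causalConv g m' u :=
  lintegral_mono' (Measure.restrict_mono subset_rfl h) le_rfl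

theorem causalConv_congr {g : ℝ → ℝ≥0∞} {m m' : Measure ℝ} {t u : ℝ}
    (h : m.restrict (Iio t) = m'.restrict (Iio t)) (hu : u ≤ t) :
    causalConv g m u = causalConv g m' u := by
  have h1 : ∀ m : Measure ℝ, m.restrict (Iio u) = (m.restrict (Iio t)).restrict (Iio u) := fun m => by
    rw [Measure.restrict_restrict measurableSet_Iio, inter_eq_left.2 (Iio_subset_Iio hu)]
  rw [causalConv, causalConv, h1 m, h1 m', h]

/-- The points under the graph of the intensity of a Hawkes process with the history `m`. -/
def hawkesRegion (lam : ℝ) (h : ℝ → ℝ) (m : Measure ℝ) : Set (ℝ × ℝ) :=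
  {p | ENNReal.ofReal p.2 + causalConv (fun t => ENNReal.ofReal (-h t)) m p.1 ≤
    ENNReal.ofReal lam + causalConv (fun t => ENNReal.ofReal (h t)) m p.1}

/-- The points strictly under the graph of an intensity which dominates the one of the Hawkes
process with the history `m`. -/
def dominatingRegion (lam : ℝ) (h : ℝ → ℝ) (m : Measure ℝ) : Set (ℝ × ℝ) :=
  {p | ENNReal.ofReal p.2 <
    ENNReal.ofReal (lam + 1) + causalConv (fun t => ENNReal.ofReal (h t)) m p.1}

/-- A random region is causal if its part up to time `t` depends on the past of `t` only. -/
def Causal (R : Measure ℝ → Set (ℝ × ℝ)) : Prop :=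
  ∀ (t : ℝ) (m m' : Measure ℝ), m.restrict (Iio t) = m'.restrict (Iio t) →
    ∀ p : ℝ × ℝ, p.1 ≤ t → (p ∈ R m ↔ p ∈ R m')

theorem causal_hawkesRegion (lam : ℝ) (h : ℝ → ℝ) : Causal (hawkesRegion lam h) := by
  intro t m m' hm p hp
  simp only [hawkesRegion, mem_ofPred_eq, causalConv_congr hm hp]

theorem causal_dominatingRegion (lam : ℝ) (h : ℝ → ℝ) : Causal (dominatingRegion lam h) := by
  intro t m m' hm p hp
  simp only [dominatingRegion, mem_ofPred_eq, causalConv_congr hm hp]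

theorem dominatingRegion_mono {lam : ℝ} {h : ℝ → ℝ} {m m' : Measure ℝ} (hm : m ≤ m') :
    dominatingRegion lam h m ⊆ dominatingRegion lam h m' := by
  intro p hp
  change ENNReal.ofReal p.2 < ENNReal.ofReal (lam + 1) +
    causalConv (fun t => ENNReal.ofReal (h t)) m p.1 at hp
  exact hp.trans_le (add_le_add_right (causalConv_mono hm _) _)

/-- Inhibition only lowers the intensity, and the positive part is monotone in the history. Passing
from `lam` to `lam + 1` turns the weak inequality into the strict one, which
`lintegral_dominatingRegion_le` needs; if the convolution is infinite, strictness is automatic. -/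
theorem hawkesRegion_subset_dominatingRegion {lam : ℝ} (hlam : 0 < lam) {h : ℝ → ℝ}
    {m m' : Measure ℝ} (hm : m ≤ m') : hawkesRegion lam h m ⊆ dominatingRegion lam h m' := by
  intro p hp
  have h1 : ENNReal.ofReal p.2 ≤ ENNReal.ofReal lam +
      causalConv (fun t => ENNReal.ofReal (h t)) m p.1 := le_self_add.trans hp
  have h2 := causalConv_mono (g := fun t => ENNReal.ofReal (h t)) hm p.1
  change ENNReal.ofReal p.2 < ENNReal.ofReal (lam + 1) +
    causalConv (fun t => ENNReal.ofReal (h t)) m' p.1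
  rcases eq_or_ne (causalConv (fun t => ENNReal.ofReal (h t)) m' p.1) ∞ with h3 | h3
  · rw [h3, add_top]; exact ENNReal.ofReal_lt_top
  · refine (h1.trans (add_le_add_right h2 _)).trans_lt ?_
    refine ENNReal.add_lt_add_right h3 ?_
    exact (ENNReal.ofReal_lt_ofReal_iff (by linarith)).2 (by linarith)

/-- The measure obtained by adding to `x` the first coordinates of the atoms of `q` in `D`. -/
def thin (D : Set (ℝ × ℝ)) (x : Measure ℝ) (q : Measure (ℝ × ℝ)) : Measure ℝ :=
  x + (q.restrict D).map Prod.fst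

theorem thin_apply (D : Set (ℝ × ℝ)) (x : Measure ℝ) (q : Measure (ℝ × ℝ)) {B : Set ℝ}
    (hB : MeasurableSet B) : thin D x q B = x B + q (Prod.fst ⁻¹' B ∩ D) := by
  rw [thin, Measure.add_apply, Measure.map_apply measurable_fst hB,
    Measure.restrict_apply (measurable_fst hB)]

theorem thin_mono {D D' : Set (ℝ × ℝ)} (h : D ⊆ D') (x : Measure ℝ) (q : Measure (ℝ × ℝ)) :
    thin D x q ≤ thin D' x q := by
  refine Measure.le_iff.2 fun B hB => ?_
  rw [thin_apply _ _ _ hB, thin_apply _ _ _ hB]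
  gcongr

theorem le_thin (D : Set (ℝ × ℝ)) (x : Measure ℝ) (q : Measure (ℝ × ℝ)) : x ≤ thin D x q :=
  Measure.le_add_right le_rfl

theorem isCounting_thin {D : Set (ℝ × ℝ)} {x : Measure ℝ} {q : Measure (ℝ × ℝ)} (hx : IsCounting x)
    (hq : IsCounting q) : IsCounting (thin D x q) :=
  hx.add ((hq.restrict D).map measurable_fst)

theorem thin_restrict_congr {D D' : Set (ℝ × ℝ)} {q q' : Measure (ℝ × ℝ)} {t : ℝ}
    (hD : ∀ p : ℝ × ℝ, p.1 ≤ t → (p ∈ D ↔ p ∈ D'))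
    (hq : q.restrict (Iic t ×ˢ univ) = q'.restrict (Iic t ×ˢ univ)) (x : Measure ℝ) :
    (thin D x q).restrict (Iic t) = (thin D' x q').restrict (Iic t) := by
  ext B hB
  have hBt := hB.inter (measurableSet_Iic (a := t))
  rw [Measure.restrict_apply hB, Measure.restrict_apply hB, thin_apply _ _ _ hBt,
    thin_apply _ _ _ hBt]
  congr 1
  have h1 : Prod.fst ⁻¹' (B ∩ Iic t) ∩ D = Prod.fst ⁻¹' (B ∩ Iic t) ∩ D' := by
    ext p
    constructor
    · exact fun hp => ⟨hp.1, (hD p hp.1.2).1 hp.2⟩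
    · exact fun hp => ⟨hp.1, (hD p hp.1.2).2 hp.2⟩
  have h2 : Prod.fst ⁻¹' (B ∩ Iic t) ∩ D' =
      (Prod.fst ⁻¹' (B ∩ Iic t) ∩ D') ∩ Iic t ×ˢ (univ : Set ℝ) :=
    (inter_eq_left.2 fun p hp => mk_mem_prod hp.1.2 (mem_univ _)).symm
  have hI : MeasurableSet (Iic t ×ˢ (univ : Set ℝ)) := measurableSet_Iic.prod MeasurableSet.univ
  rw [h1, h2, ← Measure.restrict_apply' hI, hq, Measure.restrict_apply' hI]

theorem thin_restrict_Iic_zero (D : Set (ℝ × ℝ)) (x : Measure ℝ) (q : Conf) {t : ℝ} (ht : t ≤ 0) :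
    (thin D x q.1).restrict (Iic t) = x.restrict (Iic t) := by
  ext B hB
  have hBt := hB.inter (measurableSet_Iic (a := t))
  rw [Measure.restrict_apply hB, Measure.restrict_apply hB, thin_apply _ _ _ hBt,
    measure_mono_null (t := (Ioi (0 : ℝ) ×ˢ Ioi (0 : ℝ))ᶜ) _ q.2.2.2, add_zero]
  intro p hp hp'
  have h1 : p.1 ≤ t := hp.1.2
  have h2 : 0 < p.1 := hp'.1
  linarith

/-- The Picard iterates of the thinning equation. -/
def picard (R : Measure ℝ → Set (ℝ × ℝ)) (x : Measure ℝ) (q : Measure (ℝ × ℝ)) : ℕ → Measure ℝ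
  | 0 => x
  | k + 1 => thin (R (picard R x q k)) x q

theorem restrict_Iio_of_restrict_Iic {m m' : Measure ℝ} {t : ℝ}
    (h : m.restrict (Iic t) = m'.restrict (Iic t)) : m.restrict (Iio t) = m'.restrict (Iio t) := by
  have h1 : ∀ m : Measure ℝ, m.restrict (Iio t) = (m.restrict (Iic t)).restrict (Iio t) := fun m => by
    rw [Measure.restrict_restrict measurableSet_Iio, inter_eq_left.2 Iio_subset_Iic_self]
  rw [h1 m, h1 m', h]

theorem picard_restrict_congr {R : Measure ℝ → Set (ℝ × ℝ)} (hR : Causal R) (x : Measure ℝ)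
    {q q' : Measure (ℝ × ℝ)} {t : ℝ}
    (hq : q.restrict (Iic t ×ˢ univ) = q'.restrict (Iic t ×ˢ univ)) (k : ℕ) :
    (picard R x q k).restrict (Iic t) = (picard R x q' k).restrict (Iic t) := by
  induction k with
  | zero => rfl
  | succ k ih => exact thin_restrict_congr (hR t _ _ (restrict_Iio_of_restrict_Iic ih)) hq x

theorem picard_dominating_mono (lam : ℝ) (h : ℝ → ℝ) (x : Measure ℝ) (q : Measure (ℝ × ℝ)) :
    Monotone (picard (dominatingRegion lam h) x q) := by
  refine monotone_nat_of_le_succ fun k => ?_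
  induction k with
  | zero => exact le_thin _ _ _
  | succ k ih => exact thin_mono (dominatingRegion_mono ih) _ _

theorem picard_le_picard_dominating {lam : ℝ} (hlam : 0 < lam) (h : ℝ → ℝ) (x : Measure ℝ)
    (q : Measure (ℝ × ℝ)) (k : ℕ) :
    picard (hawkesRegion lam h) x q k ≤ picard (dominatingRegion lam h) x q k := by
  induction k with
  | zero => exact le_rfl
  | succ k ih => exact thin_mono (hawkesRegion_subset_dominatingRegion hlam ih) _ _

/-- The limit of the dominating Picard iterates. -/
def dominatingLimit (lam : ℝ) (h : ℝ → ℝ) (x : Measure ℝ) (q : Measure (ℝ × ℝ)) : Measure ℝ :=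
  thin (⋃ k, dominatingRegion lam h (picard (dominatingRegion lam h) x q k)) x q

theorem picard_le_dominatingLimit {lam : ℝ} (hlam : 0 < lam) (h : ℝ → ℝ) (x : Measure ℝ)
    (q : Measure (ℝ × ℝ)) (k : ℕ) :
    picard (hawkesRegion lam h) x q k ≤ dominatingLimit lam h x q := by
  cases k with
  | zero => exact le_thin _ _ _
  | succ k =>
    exact thin_mono ((hawkesRegion_subset_dominatingRegion hlam
      (picard_le_picard_dominating hlam h x q k)).trans (subset_iUnion
        (fun k => dominatingRegion lam h (picard (dominatingRegion lam h) x q k)) k)) _ _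

/-- The limit of the Picard iterates of the Hawkes equation. -/
def hawkesLimit (lam : ℝ) (h : ℝ → ℝ) (x : Measure ℝ) (q : Measure (ℝ × ℝ)) : Measure ℝ :=
  thin {p | ∃ K, ∀ k, K ≤ k → p ∈ hawkesRegion lam h (picard (hawkesRegion lam h) x q k)} x q

theorem hawkesLimit_le_dominatingLimit {lam : ℝ} (hlam : 0 < lam) (h : ℝ → ℝ) (x : Measure ℝ)
    (q : Measure (ℝ × ℝ)) : hawkesLimit lam h x q ≤ dominatingLimit lam h x q := by
  refine thin_mono ?_ _ _
  rintro p ⟨K, hK⟩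
  exact mem_iUnion.2 ⟨K, hawkesRegion_subset_dominatingRegion hlam
    (picard_le_picard_dominating hlam h x q K) (hK K le_rfl)⟩

/-! ### Stabilisation of the iterates, existence and uniqueness -/

theorem exists_Ioo_null {M : Measure ℝ} (hM : IsCounting M) {I : ℕ → Set ℝ}
    (hI : ∀ n, MeasurableSet (I n)) (hanti : Antitone I) (hempty : ⋂ n, I n = ∅)
    (hfin : M (I 0) ≠ ∞) : ∃ n, M (I n) = 0 := by
  have h := tendsto_measure_iInter_atTop (μ := M) (fun n => (hI n).nullMeasurableSet) hanti ⟨0, hfin⟩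
  rw [hempty, measure_empty] at h
  obtain ⟨n, hn⟩ := (h.eventually_lt_const zero_lt_one).exists
  exact ⟨n, hM.eq_zero_of_lt_one (hI n) hn⟩

theorem exists_right_null {M : Measure ℝ} (hM : IsCounting M)
    (hfin : ∀ a b, M (Ioo a b) < ∞) (t : ℝ) : ∃ s, t < s ∧ M (Ioo t s) = 0 := by
  have hempty : ⋂ n : ℕ, Ioo t (t + 1 / ((n : ℝ) + 1)) = ∅ := by
    refine eq_empty_of_forall_notMem fun y hy => ?_
    have h0 := mem_iInter.1 hy 0
    obtain ⟨n, hn⟩ := exists_nat_one_div_lt (sub_pos.2 h0.1)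
    have := (mem_iInter.1 hy n).2
    linarith
  obtain ⟨n, hn⟩ := exists_Ioo_null hM (I := fun n : ℕ => Ioo t (t + 1 / ((n : ℝ) + 1)))
    (fun _ => measurableSet_Ioo)
    (fun m n hmn => Ioo_subset_Ioo_right (by
      have := one_div_le_one_div_of_le (by positivity) (by gcongr : (m : ℝ) + 1 ≤ n + 1)
      linarith)) hempty (hfin _ _).ne
  have : (0 : ℝ) < 1 / ((n : ℝ) + 1) := by positivity
  exact ⟨_, by linarith, hn⟩

theorem exists_left_null {M : Measure ℝ} (hM : IsCounting M)
    (hfin : ∀ a b, M (Ioo a b) < ∞) (t : ℝ) : ∃ s, s < t ∧ M (Ioo s t) = 0 := by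
  have hempty : ⋂ n : ℕ, Ioo (t - 1 / ((n : ℝ) + 1)) t = ∅ := by
    refine eq_empty_of_forall_notMem fun y hy => ?_
    have h0 := mem_iInter.1 hy 0
    obtain ⟨n, hn⟩ := exists_nat_one_div_lt (sub_pos.2 h0.2)
    have := (mem_iInter.1 hy n).1
    linarith
  obtain ⟨n, hn⟩ := exists_Ioo_null hM (I := fun n : ℕ => Ioo (t - 1 / ((n : ℝ) + 1)) t)
    (fun _ => measurableSet_Ioo)
    (fun m n hmn => Ioo_subset_Ioo_left (by
      have := one_div_le_one_div_of_le (by positivity) (by gcongr : (m : ℝ) + 1 ≤ n + 1)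
      linarith)) hempty (hfin _ _).ne
  have : (0 : ℝ) < 1 / ((n : ℝ) + 1) := by positivity
  exact ⟨_, by linarith, hn⟩

/-- Nothing happens between the atoms of the dominating measure: both measures vanish on `(s, t)`.
-/
theorem restrict_Iio_congr {a b M : Measure ℝ} {s t : ℝ} (ha : a ≤ M) (hb : b ≤ M)
    (hM : M (Ioo s t) = 0) (hst : s < t) (h : a.restrict (Iic s) = b.restrict (Iic s)) :
    a.restrict (Iio t) = b.restrict (Iio t) := by
  have h1 : ∀ a : Measure ℝ, a ≤ M → a.restrict (Iio t) = a.restrict (Iic s) := by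
    intro a ha
    refine Measure.restrict_congr_set (ae_eq_set.2 ⟨?_, ?_⟩)
    · refine measure_mono_null (t := Ioo s t) (fun x hx => ⟨not_le.1 hx.2, hx.1⟩)
        (le_antisymm ((ha (Ioo s t)).trans hM.le) bot_le)
    · rw [sdiff_eq_empty.2 (Iic_subset_Iio.2 hst), measure_empty]
  rw [h1 a ha, h1 b hb, h]

/-- Two Picard sequences which are dominated by a common boundedly finite counting measure
eventually agree up to any given time. -/
theorem eventually_restrict_eq {R : Measure ℝ → Set (ℝ × ℝ)} (hR : Causal R) {x : Measure ℝ} {q : Conf}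
    {M : Measure ℝ} (hM : IsCounting M) (hfin : ∀ a b, M (Ioo a b) < ∞) {a b : ℕ → Measure ℝ}
    (ha : ∀ k, a (k + 1) = thin (R (a k)) x q.1) (hb : ∀ k, b (k + 1) = thin (R (b k)) x q.1)
    (haM : ∀ k, a k ≤ M) (hbM : ∀ k, b k ≤ M) (t : ℝ) :
    ∃ K, ∀ k, K ≤ k → (a k).restrict (Iic t) = (b k).restrict (Iic t) := by
  -- Induction on continuous time: `S` is a down-set containing `0`, it contains its supremum if
  -- bounded, and no element of it is maximal, so it is the whole line.
  set S : Set ℝ := {t | ∃ K, ∀ k, K ≤ k → (a k).restrict (Iic t) = (b k).restrict (Iic t)}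
  have hmono : ∀ s t, s ≤ t → t ∈ S → s ∈ S := by
    rintro s t hst ⟨K, hK⟩
    refine ⟨K, fun k hk => ?_⟩
    have h1 : ∀ m : Measure ℝ, m.restrict (Iic s) = (m.restrict (Iic t)).restrict (Iic s) :=
      fun m => by
        rw [Measure.restrict_restrict measurableSet_Iic, inter_eq_left.2 (Iic_subset_Iic.2 hst)]
    rw [h1 (a k), h1 (b k), hK k hk]
  have hzero : (0 : ℝ) ∈ S := by
    -- Rank one, since `a 0` and `b 0` are arbitrary; all later terms coincide with `x` up to time
    -- zero.
    refine ⟨1, fun k hk => ?_⟩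
    obtain ⟨k, rfl⟩ : ∃ j, k = j + 1 := ⟨k - 1, by omega⟩
    rw [ha, hb, thin_restrict_Iic_zero _ _ _ le_rfl, thin_restrict_Iic_zero _ _ _ le_rfl]
  -- There is no atom of `M` just before `t`, so agreement holds strictly before `t`. One more
  -- iterate settles time `t` itself, because the region there depends on the strict past only.
  have hclosed : ∀ t, (∀ s < t, s ∈ S) → t ∈ S := by
    intro t ht
    obtain ⟨s, hst, hs⟩ := exists_left_null hM hfin t
    obtain ⟨K, hK⟩ := ht s hst
    refine ⟨K + 1, fun k hk => ?_⟩
    obtain ⟨k, rfl⟩ : ∃ j, k = j + 1 := ⟨k - 1, by omega⟩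
    rw [ha, hb]
    exact thin_restrict_congr (hR t _ _ (restrict_Iio_congr (haM k) (hbM k) hs hst
      (hK k (by omega)))) rfl x
  -- There is no atom of `M` just after `t`, so the same rank `K` still works there.
  have hopen : ∀ t ∈ S, ∃ s ∈ S, t < s := by
    rintro t ⟨K, hK⟩
    obtain ⟨s, hst, hs⟩ := exists_right_null hM hfin t
    refine ⟨(t + s) / 2, ⟨K, fun k hk => ?_⟩, by linarith⟩
    have h2 := restrict_Iio_congr (haM k) (hbM k) hs hst (hK k hk)
    have h1 : ∀ m : Measure ℝ, m.restrict (Iic ((t + s) / 2)) =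
        (m.restrict (Iio s)).restrict (Iic ((t + s) / 2)) := fun m => by
      rw [Measure.restrict_restrict measurableSet_Iic,
        inter_eq_left.2 (Iic_subset_Iio.2 (by linarith))]
    rw [h1 (a k), h1 (b k), h2]
  by_contra htS
  have hbdd : BddAbove S := ⟨t, fun s hs => by
    by_contra! h; exact htS (hmono t s h.le hs)⟩
  have hsup : sSup S ∈ S := hclosed _ fun s hs => by
    obtain ⟨s', hs', h⟩ := exists_lt_of_lt_csSup ⟨0, hzero⟩ hs
    exact hmono _ _ h.le hs'
  obtain ⟨s, hs, h⟩ := hopen _ hsup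
  exact absurd (le_csSup hbdd hs) (not_le.2 h)

theorem measure_ext_of_restrict_Iic {m m' : Measure ℝ}
    (h : ∀ n : ℕ, m.restrict (Iic (n : ℝ)) = m'.restrict (Iic (n : ℝ))) : m = m' :=
  (Measure.ext_iff_of_iUnion_eq_univ Conf.iUnion_Iic_natCast).2 h

/-- The configuration does not make the dominating process explode. -/
def NoExplosion (lam : ℝ) (h : ℝ → ℝ) (x : PointMeasure) (q : Conf) : Prop :=
  ∀ n : ℕ, dominatingLimit lam h x.toMeasure q.1 (Ioo (-(n : ℝ)) n) < ∞

section Solution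

variable {lam : ℝ} {h : ℝ → ℝ} {x : PointMeasure} {q : Conf}

theorem NoExplosion.lt_top (hg : NoExplosion lam h x q) {B : Set ℝ} (hB : Bornology.IsBounded B) :
    dominatingLimit lam h x.toMeasure q.1 B < ∞ := by
  obtain ⟨r, hr⟩ := hB.subset_closedBall 0
  obtain ⟨n, hn⟩ := exists_nat_gt r
  refine (measure_mono fun y hy => ?_).trans_lt (hg n)
  have := hr hy
  rw [mem_closedBall_zero_iff, Real.norm_eq_abs] at this
  exact abs_lt.1 (this.trans_lt hn)

theorem isCounting_dominatingLimit (lam : ℝ) (h : ℝ → ℝ) (x : PointMeasure) (q : Conf) :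
    IsCounting (dominatingLimit lam h x.toMeasure q.1) :=
  isCounting_thin x.counting q.2.1

/-- The Picard sequence is compared with its own shift by one: agreement of successive iterates from
some rank on means that the sequence is constant from there on the half-line. -/
theorem exists_restrict_hawkesLimit (hlam : 0 < lam) (hg : NoExplosion lam h x q) (t : ℝ) :
    ∃ K, ∀ k, K ≤ k → (hawkesLimit lam h x.toMeasure q.1).restrict (Iic t) =
      (picard (hawkesRegion lam h) x.toMeasure q.1 k).restrict (Iic t) := by
  obtain ⟨K, hK⟩ := eventually_restrict_eq (causal_hawkesRegion lam h)
    (isCounting_dominatingLimit lam h x q) (fun a b => hg.lt_top (Metric.isBounded_Ioo a b))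
    (a := picard (hawkesRegion lam h) x.toMeasure q.1)
    (b := fun k => picard (hawkesRegion lam h) x.toMeasure q.1 (k + 1)) (fun _ => rfl) (fun _ => rfl)
    (fun k => picard_le_dominatingLimit hlam h _ _ k)
    (fun k => picard_le_dominatingLimit hlam h _ _ (k + 1)) t
  have hK' : ∀ k, K ≤ k → (picard (hawkesRegion lam h) x.toMeasure q.1 k).restrict (Iic t) =
      (picard (hawkesRegion lam h) x.toMeasure q.1 K).restrict (Iic t) := by
    intro k hk
    induction k, hk using Nat.le_induction with
    | base => rfl
    | succ k hk ih => exact (hK k hk).symm.trans ih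
  refine ⟨K + 1, fun k hk => ?_⟩
  obtain ⟨k, rfl⟩ : ∃ j, k = j + 1 := ⟨k - 1, by omega⟩
  refine thin_restrict_congr (fun p hp => ?_) rfl _
  have h1 : ∀ j, K ≤ j → (p ∈ hawkesRegion lam h (picard (hawkesRegion lam h) x.toMeasure q.1 j) ↔
      p ∈ hawkesRegion lam h (picard (hawkesRegion lam h) x.toMeasure q.1 k)) := fun j hj =>
    causal_hawkesRegion lam h t _ _ (restrict_Iio_of_restrict_Iic
      ((hK' j hj).trans (hK' k (by omega)).symm)) p hp
  constructor
  · rintro ⟨K', hp'⟩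
    exact (h1 (max K K') (le_max_left _ _)).1 (hp' _ (le_max_right _ _))
  · exact fun hp' => ⟨K, fun j hj => (h1 j hj).2 hp'⟩

/-- On each half-line the limit coincides with a late iterate, which a further iteration leaves
unchanged. -/
theorem hawkesLimit_eq_thin (hlam : 0 < lam) (hg : NoExplosion lam h x q) :
    hawkesLimit lam h x.toMeasure q.1 =
      thin (hawkesRegion lam h (hawkesLimit lam h x.toMeasure q.1)) x.toMeasure q.1 := by
  refine measure_ext_of_restrict_Iic fun n => ?_
  obtain ⟨K, hK⟩ := exists_restrict_hawkesLimit hlam hg n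
  rw [hK (K + 1) (by omega)]
  exact (thin_restrict_congr (causal_hawkesRegion lam h n _ _
    (restrict_Iio_of_restrict_Iic (hK K le_rfl))) rfl _).symm

open Classical in
/-- The solution of the Hawkes equation driven by the configuration `q` with the past `x`; it is
`x` if the dominating process explodes. -/
def solution (lam : ℝ) (h : ℝ → ℝ) (x : PointMeasure) (q : Conf) : PointMeasure :=
  if hg : 0 < lam ∧ NoExplosion lam h x q then
    ⟨hawkesLimit lam h x.toMeasure q.1, isCounting_thin x.counting q.2.1, fun _ hB =>
      (hawkesLimit_le_dominatingLimit hg.1 h _ _ _).trans_lt (hg.2.lt_top hB)⟩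
  else x

theorem solution_toMeasure (hlam : 0 < lam) (hg : NoExplosion lam h x q) :
    (solution lam h x q).toMeasure = hawkesLimit lam h x.toMeasure q.1 := by
  rw [solution, dif_pos ⟨hlam, hg⟩]

theorem solution_eq_thin (hlam : 0 < lam) (hg : NoExplosion lam h x q) :
    (solution lam h x q).toMeasure =
      thin (hawkesRegion lam h (solution lam h x q).toMeasure) x.toMeasure q.1 := by
  rw [solution_toMeasure hlam hg]
  exact hawkesLimit_eq_thin hlam hg

/-- Pathwise uniqueness of the solution of the Hawkes equation. -/
theorem eq_solution (hlam : 0 < lam) (hg : NoExplosion lam h x q) {ν : PointMeasure}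
    (hν : ν.toMeasure = thin (hawkesRegion lam h ν.toMeasure) x.toMeasure q.1) :
    ν = solution lam h x q := by
  refine PointMeasure.ext (measure_ext_of_restrict_Iic fun n => ?_)
  obtain ⟨K, hK⟩ := eventually_restrict_eq (causal_hawkesRegion lam h) (q := q)
    (x := x.toMeasure)
    -- Both sequences are constant, and their sum dominates them; `ν` need not be compared with the
    -- dominating process.
    (M := ν.toMeasure + (solution lam h x q).toMeasure)
    (IsCounting.add (α := ℝ) ν.counting (solution lam h x q).counting)
    (fun a b => by
      rw [Measure.add_apply]
      exact ENNReal.add_lt_top.2 ⟨ν.finite_of_isBounded _ (Metric.isBounded_Ioo a b),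
        (solution lam h x q).finite_of_isBounded _ (Metric.isBounded_Ioo a b)⟩)
    (a := fun _ => ν.toMeasure) (b := fun _ => (solution lam h x q).toMeasure)
    (fun _ => hν) (fun _ => solution_eq_thin hlam hg)
    (fun _ => Measure.le_add_right le_rfl) (fun _ => Measure.le_add_left le_rfl) n
  exact hK K le_rfl

theorem solution_restrict_Iic_zero (x : PointMeasure) (q : Conf) :
    (solution lam h x q).toMeasure.restrict (Iic 0) = x.toMeasure.restrict (Iic 0) := by
  unfold solution
  split_ifs with hg
  · exact thin_restrict_Iic_zero _ _ _ le_rfl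
  · rfl

/-- The solution up to time `t` depends on the configuration up to time `t` only. -/
theorem solution_restrict_congr (hlam : 0 < lam) {q' : Conf} (hg : NoExplosion lam h x q)
    (hg' : NoExplosion lam h x q') {t : ℝ}
    (hq : q.1.restrict (Iic t ×ˢ univ) = q'.1.restrict (Iic t ×ˢ univ)) :
    (solution lam h x q).toMeasure.restrict (Iic t) =
      (solution lam h x q').toMeasure.restrict (Iic t) := by
  rw [solution_toMeasure hlam hg, solution_toMeasure hlam hg']
  obtain ⟨K, hK⟩ := exists_restrict_hawkesLimit hlam hg t
  obtain ⟨K', hK'⟩ := exists_restrict_hawkesLimit hlam hg' t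
  rw [hK (max K K') (le_max_left _ _), hK' (max K K') (le_max_right _ _)]
  exact picard_restrict_congr (causal_hawkesRegion lam h) _ hq _

end Solution

/-! ### Joint measurability of the solution in the past and the configuration -/

/-- The identity kernel from configurations to the plane. -/
def confKernel : Kernel Conf (ℝ × ℝ) := ⟨Subtype.val, measurable_subtype_coe⟩

instance : IsSFiniteKernel confKernel :=
  isSFiniteKernel_of_forall_lt_top _ (fun n : ℕ => Iic (n : ℝ) ×ˢ Iic (n : ℝ))
    (fun _ => measurableSet_Iic.prod measurableSet_Iic) Conf.iUnion_corner_natCast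
    fun q n => q.apply_Iic_prod_Iic_lt_top n n

/-- A family of measures on the line which is an s-finite kernel. -/
def SFiniteFamily {S : Type*} [MeasurableSpace S] (F : S → Measure ℝ) : Prop :=
  ∃ η : Kernel S ℝ, IsSFiniteKernel η ∧ ∀ s, η s = F s

section SFiniteFamily

variable {S : Type*} [MeasurableSpace S] {F : S → Measure ℝ}

theorem SFiniteFamily.comp {T : Type*} [MeasurableSpace T] (hF : SFiniteFamily F) {φ : T → S}
    (hφ : Measurable φ) : SFiniteFamily (F ∘ φ) := by
  obtain ⟨η, hη, h⟩ := hF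
  exact ⟨η.comap φ hφ, inferInstance, fun t => by rw [Kernel.comap_apply, h]; rfl⟩

/-- The reason for working with s-finite families: Picard iterates may fail to be locally finite, so
they are not point measures, yet integrals against them must be measurable in the parameter. -/
theorem SFiniteFamily.measurable_lintegral (hF : SFiniteFamily F) {f : S × ℝ → ℝ≥0∞}
    (hf : Measurable f) : Measurable fun s => ∫⁻ y, f (s, y) ∂F s := by
  obtain ⟨η, hη, h⟩ := hF
  simp_rw [← h]
  exact hf.lintegral_kernel_prod_right'

theorem SFiniteFamily.measurable_apply (hF : SFiniteFamily F) {B : Set ℝ} (hB : MeasurableSet B) :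
    Measurable fun s => F s B := by
  obtain ⟨η, hη, h⟩ := hF
  simp_rw [← h]
  exact η.measurable_coe hB

theorem SFiniteFamily.sFinite (hF : SFiniteFamily F) (s : S) : SFinite (F s) := by
  obtain ⟨η, hη, h⟩ := hF
  rw [← h]
  infer_instance

theorem SFiniteFamily.measurable_causalConv (hF : SFiniteFamily F) {g : ℝ → ℝ≥0∞}
    (hg : Measurable g) : Measurable fun p : S × ℝ => causalConv g (F p.1) p.2 := by
  have h1 : ∀ p : S × ℝ, causalConv g (F p.1) p.2 =
      ∫⁻ y, {z : (S × ℝ) × ℝ | z.2 < z.1.2}.indicator (fun z => g (z.1.2 - z.2)) (p, y)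
        ∂(F ∘ Prod.fst) p := by
    intro p
    rw [causalConv, ← lintegral_indicator measurableSet_Iio]
    rfl
  simp_rw [h1]
  refine (hF.comp measurable_fst).measurable_lintegral (Measurable.indicator (by fun_prop) ?_)
  exact measurableSet_lt (by fun_prop) (by fun_prop)

theorem SFiniteFamily.measurable_setLIntegral_Iic (hF : SFiniteFamily F) {g : ℝ → ℝ≥0∞}
    (hg : Measurable g) (s : ℝ) :
    Measurable fun p : S × ℝ => ∫⁻ y in Iic s, g (p.2 - y) ∂F p.1 := by
  have h1 : ∀ p : S × ℝ, ∫⁻ y in Iic s, g (p.2 - y) ∂F p.1 =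
      ∫⁻ y, {z : (S × ℝ) × ℝ | z.2 ≤ s}.indicator (fun z => g (z.1.2 - z.2)) (p, y)
        ∂(F ∘ Prod.fst) p := by
    intro p
    rw [← lintegral_indicator measurableSet_Iic]
    rfl
  simp_rw [h1]
  refine (hF.comp measurable_fst).measurable_lintegral (Measurable.indicator (by fun_prop) ?_)
  exact measurableSet_le (by fun_prop) (by fun_prop)

theorem measurableSet_hawkesRegion (lam : ℝ) {h : ℝ → ℝ} (hh : Measurable h)
    (hF : SFiniteFamily F) :
    MeasurableSet {p : S × (ℝ × ℝ) | p.2 ∈ hawkesRegion lam h (F p.1)} := by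
  have hφ : Measurable fun p : S × (ℝ × ℝ) => (p.1, p.2.1) := by fun_prop
  have h1 := (hF.measurable_causalConv hh.neg.ennreal_ofReal).comp hφ
  have h2 := (hF.measurable_causalConv hh.ennreal_ofReal).comp hφ
  exact measurableSet_le ((by fun_prop : Measurable fun p : S × (ℝ × ℝ) =>
    ENNReal.ofReal p.2.2).add h1) (measurable_const.add h2)

theorem measurableSet_dominatingRegion (lam : ℝ) {h : ℝ → ℝ} (hh : Measurable h)
    (hF : SFiniteFamily F) :
    MeasurableSet {p : S × (ℝ × ℝ) | p.2 ∈ dominatingRegion lam h (F p.1)} := by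
  have hφ : Measurable fun p : S × (ℝ × ℝ) => (p.1, p.2.1) := by fun_prop
  have h2 := (hF.measurable_causalConv hh.ennreal_ofReal).comp hφ
  exact measurableSet_lt (by fun_prop) (measurable_const.add h2)

variable {f : S → PointMeasure} {g : S → Conf}

theorem sFiniteFamily_pointMeasure (hf : Measurable f) :
    SFiniteFamily fun s => (f s).toMeasure :=
  ⟨pointKernel.comap f hf, inferInstance, fun _ => rfl⟩

theorem sFiniteFamily_thin (hf : Measurable f) (hg : Measurable g) {D : S → Set (ℝ × ℝ)}
    (hD : MeasurableSet {p : S × (ℝ × ℝ) | p.2 ∈ D p.1}) :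
    SFiniteFamily fun s => thin (D s) (f s).toMeasure (g s).1 := by
  -- Restriction to a varying set is a density with respect to the kernel; with values in `ℝ≥0` it
  -- preserves s-finiteness.
  let ψ : S → ℝ × ℝ → ℝ≥0 := fun s p => {p : S × (ℝ × ℝ) | p.2 ∈ D p.1}.indicator 1 (s, p)
  have hψ : Measurable (Function.uncurry fun s p => (ψ s p : ℝ≥0∞)) :=
    measurable_coe_nnreal_ennreal.comp (measurable_one.indicator hD)
  let κ := (confKernel.comap g hg).withDensity fun s p => (ψ s p : ℝ≥0∞)
  refine ⟨pointKernel.comap f hf + κ.map Prod.fst, inferInstance, fun s => ?_⟩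
  rw [add_apply, Kernel.map_apply _ measurable_fst, Kernel.withDensity_apply _ hψ]
  have hDs : MeasurableSet (D s) := measurable_prodMk_left hD
  have h1 : (fun p => (ψ s p : ℝ≥0∞)) = (D s).indicator 1 := by
    funext p
    by_cases hp : p ∈ D s <;> simp [ψ, hp]
  rw [h1, withDensity_indicator_one hDs]
  rfl

theorem sFiniteFamily_picard (hf : Measurable f) (hg : Measurable g)
    {R : Measure ℝ → Set (ℝ × ℝ)} (hR : ∀ F : S → Measure ℝ, SFiniteFamily F →
      MeasurableSet {p : S × (ℝ × ℝ) | p.2 ∈ R (F p.1)}) (k : ℕ) :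
    SFiniteFamily fun s => picard R (f s).toMeasure (g s).1 k := by
  induction k with
  | zero => exact sFiniteFamily_pointMeasure hf
  | succ k ih => exact sFiniteFamily_thin hf hg (hR _ ih)

theorem sFiniteFamily_dominatingLimit (lam : ℝ) {h : ℝ → ℝ} (hh : Measurable h) (hf : Measurable f)
    (hg : Measurable g) :
    SFiniteFamily fun s => dominatingLimit lam h (f s).toMeasure (g s).1 := by
  refine sFiniteFamily_thin hf hg ?_
  simp only [mem_iUnion]
  rw [ofPred_exists]
  exact MeasurableSet.iUnion fun k => measurableSet_dominatingRegion lam hh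
    (sFiniteFamily_picard hf hg (fun F hF => measurableSet_dominatingRegion lam hh hF) k)

theorem sFiniteFamily_hawkesLimit (lam : ℝ) {h : ℝ → ℝ} (hh : Measurable h) (hf : Measurable f)
    (hg : Measurable g) :
    SFiniteFamily fun s => hawkesLimit lam h (f s).toMeasure (g s).1 := by
  refine sFiniteFamily_thin hf hg ?_
  have h1 : {p : S × (ℝ × ℝ) | p.2 ∈ {z | ∃ K, ∀ k, K ≤ k → z ∈ hawkesRegion lam h
      (picard (hawkesRegion lam h) (f p.1).toMeasure (g p.1).1 k)}} = ⋃ K : ℕ, ⋂ k : ℕ, ⋂ (_ : K ≤ k),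
      {p : S × (ℝ × ℝ) | p.2 ∈ hawkesRegion lam h
        (picard (hawkesRegion lam h) (f p.1).toMeasure (g p.1).1 k)} := by
    ext p
    simp only [mem_ofPred_eq, mem_iUnion, mem_iInter]
  rw [h1]
  exact MeasurableSet.iUnion fun K => MeasurableSet.iInter fun k => MeasurableSet.iInter fun _ =>
    measurableSet_hawkesRegion lam hh
      (sFiniteFamily_picard hf hg (fun F hF => measurableSet_hawkesRegion lam hh hF) k)

theorem measurableSet_noExplosion (lam : ℝ) {h : ℝ → ℝ} (hh : Measurable h) (hf : Measurable f)
    (hg : Measurable g) : MeasurableSet {s | NoExplosion lam h (f s) (g s)} := by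
  simp only [NoExplosion, ofPred_forall]
  exact MeasurableSet.iInter fun n => measurableSet_lt
    ((sFiniteFamily_dominatingLimit lam hh hf hg).measurable_apply measurableSet_Ioo) measurable_const

theorem measurable_solution {lam : ℝ} (hlam : 0 < lam) {h : ℝ → ℝ} (hh : Measurable h)
    (hf : Measurable f) (hg : Measurable g) : Measurable fun s => solution lam h (f s) (g s) := by
  classical
  rw [PointMeasure.measurable_iff]
  have h1 : ∀ s, (solution lam h (f s) (g s)).toMeasure = if NoExplosion lam h (f s) (g s) then
      hawkesLimit lam h (f s).toMeasure (g s).1 else (f s).toMeasure := by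
    intro s
    split_ifs with hs
    · exact solution_toMeasure hlam hs
    · rw [solution, dif_neg fun h => hs h.2]
  simp_rw [h1]
  refine Measurable.ite (measurableSet_noExplosion lam hh hf hg) ?_
    (PointMeasure.measurable_iff.1 hf)
  obtain ⟨η, hη, h⟩ := sFiniteFamily_hawkesLimit lam hh hf hg
  simp_rw [← h]
  exact η.measurable

end SFiniteFamily

/-! ### Mean number of points and absence of explosion -/

theorem measurable_conf_apply {S : Type*} [MeasurableSpace S] {g : S → Conf} (hg : Measurable g)
    {D : Set (S × (ℝ × ℝ))} (hD : MeasurableSet D) :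
    Measurable fun s => (g s).1 (Prod.mk s ⁻¹' D) :=
  Kernel.measurable_kernel_prodMk_left (κ := confKernel.comap g hg) hD

/-- The area under a nonnegative function. -/
theorem volume_subgraph_le {I : Set ℝ} (hI : MeasurableSet I) {φ : ℝ → ℝ≥0∞} (hφ : Measurable φ) :
    volume {p : ℝ × ℝ | p.1 ∈ I ∧ 0 < p.2 ∧ ENNReal.ofReal p.2 < φ p.1} ≤ ∫⁻ u in I, φ u := by
  have hm : MeasurableSet {p : ℝ × ℝ | p.1 ∈ I ∧ 0 < p.2 ∧ ENNReal.ofReal p.2 < φ p.1} :=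
    (measurable_fst hI).inter ((measurableSet_lt measurable_const measurable_snd).inter
      (measurableSet_lt (by fun_prop) (hφ.comp measurable_fst)))
  rw [Measure.volume_eq_prod, Measure.prod_apply hm, ← lintegral_indicator hI]
  refine lintegral_mono fun u => ?_
  by_cases hu : u ∈ I
  · rw [indicator_of_mem hu]
    rcases eq_or_ne (φ u) ∞ with h | h
    · rw [h]; exact le_top
    · calc volume (Prod.mk u ⁻¹' {p : ℝ × ℝ | p.1 ∈ I ∧ 0 < p.2 ∧ ENNReal.ofReal p.2 < φ p.1})
          ≤ volume (Ioo 0 (φ u).toReal) := by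
            refine measure_mono fun θ hθ => ⟨hθ.2.1, ?_⟩
            exact (ENNReal.ofReal_lt_iff_lt_toReal hθ.2.1.le h).1 hθ.2.2
        _ = φ u := by rw [Real.volume_Ioo, sub_zero, ENNReal.ofReal_toReal h]
  · rw [indicator_of_notMem hu, nonpos_iff_eq_zero]
    refine measure_mono_null (t := ∅) (fun θ hθ => hu hθ.1) measure_empty

/-- The expected number of points of the Poisson process under a predictable piecewise intensity. -/
theorem lintegral_slab_le {M : Conf → Measure ℝ} (hM : SFiniteFamily M) {s : ℝ≥0}
    (hcausal : ∀ q q', (M (Conf.concat s q q')).restrict (Iic (s : ℝ)) = (M q).restrict (Iic (s : ℝ)))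
    {g : ℝ → ℝ≥0∞} (hg : Measurable g) (c : ℝ≥0∞) (r : ℝ) :
    ∫⁻ q, q.1 {p | p.1 ∈ Ioc (s : ℝ) r ∧
        ENNReal.ofReal p.2 < c + ∫⁻ y in Iic (s : ℝ), g (p.1 - y) ∂M q} ∂poissonLaw ≤
      ∫⁻ q, (∫⁻ u in Ioc (s : ℝ) r, (c + causalConv g (M q) u)) ∂poissonLaw := by
  set D : Set (Conf × (ℝ × ℝ)) := {z | z.2.1 ∈ Ioc (s : ℝ) r ∧
        ENNReal.ofReal z.2.2 < c + ∫⁻ y in Iic (s : ℝ), g (z.2.1 - y) ∂M z.1} with hD_def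
  have hφ : Measurable fun z : Conf × ℝ => c + ∫⁻ y in Iic (s : ℝ), g (z.2 - y) ∂M z.1 :=
    measurable_const.add (hM.measurable_setLIntegral_Iic hg s)
  have hD : MeasurableSet D :=
    MeasurableSet.inter ((by fun_prop : Measurable fun z : Conf × (ℝ × ℝ) => z.2.1) measurableSet_Ioc)
      (measurableSet_lt (by fun_prop)
        (hφ.comp (by fun_prop : Measurable fun z : Conf × (ℝ × ℝ) => (z.1, z.2.1))))
  have hDq : ∀ q, MeasurableSet (Prod.mk q ⁻¹' D) := fun q => measurable_prodMk_left hD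
  have hm : Measurable fun p : ℝ × ℝ => (p.1 + (s : ℝ), p.2) := by fun_prop
  have h1 : ∀ q : Conf, q.1 {p | p.1 ∈ Ioc (s : ℝ) r ∧
        ENNReal.ofReal p.2 < c + ∫⁻ y in Iic (s : ℝ), g (p.1 - y) ∂M q} =
      q.1 (Prod.mk q ⁻¹' D) := fun q => rfl
  have h2 : ∀ q q' : Conf, (Conf.concat s q q').1 (Prod.mk (Conf.concat s q q') ⁻¹' D) =
      q'.1 ((fun p => (p.1 + (s : ℝ), p.2)) ⁻¹' (Prod.mk q ⁻¹' D)) := by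
    intro q q'
    have h3 : Prod.mk (Conf.concat s q q') ⁻¹' D = Prod.mk q ⁻¹' D := by
      ext p
      simp only [hD_def, mem_preimage, mem_ofPred_eq, hcausal]
    have h4 : Prod.mk q ⁻¹' D ∩ Iic (s : ℝ) ×ˢ univ = ∅ := by
      refine eq_empty_of_forall_notMem fun p hp => ?_
      exact absurd hp.1.1.1 (not_lt.2 hp.2.1)
    rw [h3, Conf.concat_apply s q q' (hDq q), h4, measure_empty, zero_add]
  simp_rw [h1]
  have hmeas : Measurable fun q : Conf => q.1 (Prod.mk q ⁻¹' D) := measurable_conf_apply measurable_id hD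
  -- The points after `s` are resampled independently. Given `q` the region is then deterministic,
  -- since it reads `M` up to time `s` only, and the mean count is its area.
  have h5 : ∫⁻ q, q.1 (Prod.mk q ⁻¹' D) ∂poissonLaw = ∫⁻ q, (∫⁻ q', (Conf.concat s q q').1
      (Prod.mk (Conf.concat s q q') ⁻¹' D) ∂poissonLaw) ∂poissonLaw := by
    conv_lhs => rw [← map_concat_poissonLaw s]
    rw [lintegral_map hmeas (Conf.measurable_concat s)]
    exact lintegral_prod _ (hmeas.comp (Conf.measurable_concat s)).aemeasurable
  rw [h5]
  refine lintegral_mono fun q => ?_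
  simp_rw [h2]
  rw [lintegral_poissonLaw_apply (hm (hDq q))]
  calc volume ((fun p : ℝ × ℝ => (p.1 + (s : ℝ), p.2)) ⁻¹' (Prod.mk q ⁻¹' D) ∩ quadrant)
      ≤ volume ((fun p : ℝ × ℝ => p + ((s : ℝ), (0 : ℝ))) ⁻¹'
          {p | p.1 ∈ Ioc (s : ℝ) r ∧ 0 < p.2 ∧ ENNReal.ofReal p.2 <
            c + ∫⁻ y in Iic (s : ℝ), g (p.1 - y) ∂M q}) := by
        refine measure_mono fun p hp => ?_
        have h0 : p + ((s : ℝ), (0 : ℝ)) = (p.1 + s, p.2) := by ext <;> simp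
        rw [mem_preimage, h0]
        exact ⟨hp.1.1, hp.2.2, hp.1.2⟩
    _ = volume {p : ℝ × ℝ | p.1 ∈ Ioc (s : ℝ) r ∧ 0 < p.2 ∧ ENNReal.ofReal p.2 <
            c + ∫⁻ y in Iic (s : ℝ), g (p.1 - y) ∂M q} := measure_preimage_add_right _ _ _
    _ ≤ ∫⁻ u in Ioc (s : ℝ) r, (c + ∫⁻ y in Iic (s : ℝ), g (u - y) ∂M q) :=
        volume_subgraph_le measurableSet_Ioc (hφ.comp measurable_prodMk_left)
    _ ≤ _ := by
        refine setLIntegral_mono' measurableSet_Ioc fun u hu => ?_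
        gcongr
        exact lintegral_mono' (Measure.restrict_mono (Iic_subset_Iio.2 hu.1) le_rfl) le_rfl

theorem concat_restrict_Iic (s : ℝ≥0) (q q' : Conf) :
    (Conf.concat s q q').1.restrict (Iic (s : ℝ) ×ˢ univ) = q.1.restrict (Iic (s : ℝ) ×ˢ univ) := by
  have hI : MeasurableSet (Iic (s : ℝ) ×ˢ (univ : Set ℝ)) := measurableSet_Iic.prod MeasurableSet.univ
  ext D hD
  rw [Measure.restrict_apply hD, Measure.restrict_apply hD, Conf.concat_apply s q q' (hD.inter hI),
    inter_assoc, inter_self]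
  have h1 : q'.1 ((fun p : ℝ × ℝ => (p.1 + (s : ℝ), p.2)) ⁻¹' (D ∩ Iic (s : ℝ) ×ˢ univ)) = q'.1 ∅ := by
    refine q'.apply_congr fun p hp _ => ?_
    simp [hp]
  rw [h1, measure_empty, add_zero]

/-- The mean number of points in a dominating region of a causal family of measures is bounded by
the mean of the integrated intensity. -/
theorem lintegral_dominatingRegion_le {M : Conf → Measure ℝ} (hM : SFiniteFamily M)
    (hcausal : ∀ (s : ℝ≥0) q q',
      (M (Conf.concat s q q')).restrict (Iic (s : ℝ)) = (M q).restrict (Iic (s : ℝ)))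
    (lam : ℝ) {h : ℝ → ℝ} (hh : Measurable h) (T : ℕ) :
    ∫⁻ q, q.1 (Prod.fst ⁻¹' Iic (T : ℝ) ∩ dominatingRegion lam h (M q)) ∂poissonLaw ≤
      ∫⁻ q, (∫⁻ u in Ioc (0 : ℝ) T, (ENNReal.ofReal (lam + 1) +
        causalConv (fun t => ENNReal.ofReal (h t)) (M q) u)) ∂poissonLaw := by
  set c := ENNReal.ofReal (lam + 1)
  set g : ℝ → ℝ≥0∞ := fun t => ENNReal.ofReal (h t)
  have hg : Measurable g := hh.ennreal_ofReal
  -- Slabs of length `1 / (n + 1)`; on each, the history is frozen at the left end so that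
  -- `lintegral_slab_le` applies.
  let s : ℕ → ℕ → ℝ≥0 := fun n j => j / ((n : ℝ≥0) + 1)
  have hs : ∀ n j, ((s n j : ℝ≥0) : ℝ) = j / ((n : ℝ) + 1) := fun n j => by simp [s]
  have hsm : ∀ n, Monotone fun j => (s n j : ℝ) := fun n i j hij => by
    simp only [hs]
    have : (i : ℝ) ≤ j := by exact_mod_cast hij
    gcongr
  let D : ℕ → ℕ → Conf → Set (ℝ × ℝ) := fun n j q => {p | p.1 ∈ Ioc (s n j : ℝ) (s n (j + 1)) ∧
    ENNReal.ofReal p.2 < c + ∫⁻ y in Iic (s n j : ℝ), g (p.1 - y) ∂M q}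
  have hD : ∀ n j, MeasurableSet {z : Conf × (ℝ × ℝ) | z.2 ∈ D n j z.1} := fun n j =>
    MeasurableSet.inter ((by fun_prop : Measurable fun z : Conf × (ℝ × ℝ) => z.2.1) measurableSet_Ioc)
      (measurableSet_lt (by fun_prop) ((measurable_const.add
        (hM.measurable_setLIntegral_Iic hg (s n j : ℝ))).comp
        (by fun_prop : Measurable fun z : Conf × (ℝ × ℝ) => (z.1, z.2.1))))
  have hDq : ∀ n j q, MeasurableSet (D n j q) := fun n j q => measurable_prodMk_left (x := q) (hD n j)
  let E : ℕ → Conf → Set (ℝ × ℝ) := fun n q => ⋃ j ∈ Finset.range (T * (n + 1)), D n j q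
  -- The intensity at `p` is the supremum of those computed from the history up to `p.1 - 1 / (k +
  -- 1)`. As the inequality is strict, one such cut already exceeds the height of `p`, and finer
  -- slabs see at least that much history.
  have hcover : ∀ q, ∀ p ∈ Prod.fst ⁻¹' Iic (T : ℝ) ∩ dominatingRegion lam h (M q), 0 < p.1 →
      ∀ᶠ n in atTop, p ∈ E n q := by
    rintro q p ⟨hpT, hp⟩ hp0
    have hpT : p.1 ≤ T := hpT
    have hp : ENNReal.ofReal p.2 < c + causalConv g (M q) p.1 := hp
    have h1 : Iio p.1 = ⋃ k : ℕ, Iic (p.1 - 1 / ((k : ℝ) + 1)) := by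
      ext y
      simp only [mem_Iio, mem_iUnion, mem_Iic]
      constructor
      · intro hy
        obtain ⟨k, hk⟩ := exists_nat_one_div_lt (sub_pos.2 hy)
        exact ⟨k, by linarith⟩
      · rintro ⟨k, hk⟩
        have : (0 : ℝ) < 1 / ((k : ℝ) + 1) := by positivity
        linarith
    have hdir : Directed (· ⊆ ·) fun k : ℕ => Iic (p.1 - 1 / ((k : ℝ) + 1)) := by
      refine Monotone.directed_le fun m n hmn => Iic_subset_Iic.2 ?_
      have := one_div_le_one_div_of_le (by positivity) (by gcongr : (m : ℝ) + 1 ≤ n + 1)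
      linarith
    rw [causalConv, h1, setLIntegral_iUnion_of_directed _ hdir, ENNReal.add_iSup, lt_iSup_iff] at hp
    obtain ⟨k, hk⟩ := hp
    filter_upwards [eventually_ge_atTop k] with n hn
    have hn0 : (0 : ℝ) < (n : ℝ) + 1 := by positivity
    have hc0 : 0 < ⌈p.1 * ((n : ℝ) + 1)⌉₊ := Nat.ceil_pos.2 (by positivity)
    obtain ⟨j, hj⟩ : ∃ j, ⌈p.1 * ((n : ℝ) + 1)⌉₊ = j + 1 := ⟨_, (Nat.succ_pred_eq_of_pos hc0).symm⟩
    have hj1 : (j : ℝ) < p.1 * ((n : ℝ) + 1) := Nat.lt_ceil.1 (by omega)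
    have hj2 : p.1 * ((n : ℝ) + 1) ≤ ((j + 1 : ℕ) : ℝ) := by rw [← hj]; exact Nat.le_ceil _
    have hj3 : j < T * (n + 1) := by
      have : (j : ℝ) < (T * (n + 1) : ℕ) := by
        push_cast
        exact hj1.trans_le (by gcongr)
      exact_mod_cast this
    refine mem_biUnion (Finset.mem_range.2 hj3) ⟨⟨?_, ?_⟩, hk.trans_le ?_⟩
    · rw [hs]; exact (div_lt_iff₀ hn0).2 hj1
    · rw [hs]; exact (le_div_iff₀ hn0).2 hj2
    · gcongr
      rw [hs, le_div_iff₀ hn0, sub_mul]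
      push_cast at hj2
      have h2 : 1 / ((k : ℝ) + 1) * ((n : ℝ) + 1) ≥ 1 := by
        rw [ge_iff_le, div_mul_eq_mul_div, one_mul, one_le_div (by positivity)]
        gcongr
      linarith
  -- Points are eventually covered but the slabs are not nested in `n`, hence Fatou rather than
  -- monotone convergence.
  have hfatou : ∀ q : Conf, q.1 (Prod.fst ⁻¹' Iic (T : ℝ) ∩ dominatingRegion lam h (M q)) ≤
      liminf (fun n => ∑ j ∈ Finset.range (T * (n + 1)), q.1 (D n j q)) atTop := by
    intro q
    have hE : ∀ n, MeasurableSet (E n q) := fun n => Finset.measurableSet_biUnion _ fun j _ => hDq n j q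
    set B := Prod.fst ⁻¹' Iic (T : ℝ) ∩ dominatingRegion lam h (M q)
    calc q.1 B = q.1 (B ∩ Ioi 0 ×ˢ Ioi 0) := (q.apply_inter_quadrant B).symm
      _ ≤ ∫⁻ p, (B ∩ Ioi 0 ×ˢ Ioi 0).indicator 1 p ∂q.1 := by
        have hBm : MeasurableSet B := (measurable_fst measurableSet_Iic).inter
          (measurable_prodMk_left (x := q) (measurableSet_dominatingRegion lam hh hM))
        rw [lintegral_indicator_one (hBm.inter (measurableSet_Ioi.prod measurableSet_Ioi))]
      _ ≤ ∫⁻ p, liminf (fun n => (E n q).indicator (1 : ℝ × ℝ → ℝ≥0∞) p) atTop ∂q.1 := by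
        refine lintegral_mono fun p => ?_
        by_cases hp : p ∈ B ∩ Ioi 0 ×ˢ Ioi 0
        · rw [indicator_of_mem hp]
          refine le_liminf_of_le (by isBoundedDefault) ?_
          filter_upwards [hcover q p hp.1 hp.2.1] with n hn
          rw [indicator_of_mem hn]
        · rw [indicator_of_notMem hp]; exact bot_le
      _ ≤ liminf (fun n => ∫⁻ p, (E n q).indicator 1 p ∂q.1) atTop :=
        lintegral_liminf_le fun n => measurable_one.indicator (hE n)
      _ ≤ _ := by
        refine liminf_le_liminf (Eventually.of_forall fun n => ?_)
        rw [lintegral_indicator_one (hE n)]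
        exact measure_biUnion_finset_le _ _
  have hDm : ∀ n j, Measurable fun q : Conf => q.1 (D n j q) := fun n j =>
    measurable_conf_apply measurable_id (hD n j)
  calc ∫⁻ q, q.1 (Prod.fst ⁻¹' Iic (T : ℝ) ∩ dominatingRegion lam h (M q)) ∂poissonLaw
      ≤ ∫⁻ q, liminf (fun n => ∑ j ∈ Finset.range (T * (n + 1)), q.1 (D n j q)) atTop ∂poissonLaw :=
        lintegral_mono hfatou
    _ ≤ liminf (fun n => ∫⁻ q, ∑ j ∈ Finset.range (T * (n + 1)), q.1 (D n j q) ∂poissonLaw) atTop :=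
        lintegral_liminf_le fun n => Finset.measurable_sum _ fun j _ => hDm n j
    _ ≤ liminf (fun _ : ℕ => ∫⁻ q, (∫⁻ u in Ioc (0 : ℝ) T, (c + causalConv g (M q) u)) ∂poissonLaw)
          atTop := by
        refine liminf_le_liminf (Eventually.of_forall fun n => ?_)
        have hF : Measurable fun p : Conf × ℝ => c + causalConv g (M p.1) p.2 :=
          measurable_const.add (hM.measurable_causalConv hg)
        rw [lintegral_finsetSum _ fun j _ => hDm n j]
        calc ∑ j ∈ Finset.range (T * (n + 1)), ∫⁻ q, q.1 (D n j q) ∂poissonLaw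
            ≤ ∑ j ∈ Finset.range (T * (n + 1)), ∫⁻ q, (∫⁻ u in Ioc (s n j : ℝ) (s n (j + 1)),
                (c + causalConv g (M q) u)) ∂poissonLaw :=
              Finset.sum_le_sum fun j _ => lintegral_slab_le hM (hcausal (s n j)) hg c _
          _ = ∫⁻ q, (∑ j ∈ Finset.range (T * (n + 1)), ∫⁻ u in Ioc (s n j : ℝ) (s n (j + 1)),
                (c + causalConv g (M q) u)) ∂poissonLaw := by
              rw [lintegral_finsetSum _ fun j _ => ?_]
              exact hF.lintegral_prod_right'
          _ ≤ _ := by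
              refine lintegral_mono fun q => ?_
              rw [← lintegral_biUnion_finset _ (fun j _ => measurableSet_Ioc)]
              · refine lintegral_mono_set (iUnion₂_subset fun j hj => ?_)
                refine Ioc_subset_Ioc (NNReal.coe_nonneg _) ?_
                rw [hs, div_le_iff₀ (by positivity)]
                exact_mod_cast Finset.mem_range.1 hj
              · exact fun i _ j _ hij => (hsm n).pairwise_disjoint_on_Ioc_succ hij
    _ = _ := liminf_const _

/-- Tonelli: an atom at `y ≤ T` contributes at most the total integral of `g`, and later atoms
contribute nothing. -/
theorem setLIntegral_causalConv_le {g : ℝ → ℝ≥0∞} (hg : Measurable g) (m : Measure ℝ) [SFinite m]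
    (T : ℝ) : ∫⁻ u in Ioc 0 T, causalConv g m u ≤ (∫⁻ t in Ioi 0, g t) * m (Iic T) := by
  have h1 : ∀ u, causalConv g m u = ∫⁻ y, {z : ℝ × ℝ | z.2 < z.1}.indicator
      (fun z => g (z.1 - z.2)) (u, y) ∂m := fun u => by
    rw [causalConv, ← lintegral_indicator measurableSet_Iio]
    rfl
  have hm : Measurable ({z : ℝ × ℝ | z.2 < z.1}.indicator fun z => g (z.1 - z.2)) :=
    Measurable.indicator (by fun_prop) (measurableSet_lt (by fun_prop) (by fun_prop))
  simp_rw [h1]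
  rw [lintegral_lintegral_swap (f := fun u y => {z : ℝ × ℝ | z.2 < z.1}.indicator
    (fun z => g (z.1 - z.2)) (u, y)) hm.aemeasurable]
  calc ∫⁻ y, (∫⁻ u in Ioc 0 T, {z : ℝ × ℝ | z.2 < z.1}.indicator (fun z => g (z.1 - z.2)) (u, y)) ∂m
      ≤ ∫⁻ y, (Iic T).indicator (fun _ => ∫⁻ t in Ioi 0, g t) y ∂m := by
        refine lintegral_mono fun y => ?_
        by_cases hy : y ≤ T
        · rw [indicator_of_mem (mem_Iic.2 hy)]
          calc ∫⁻ u in Ioc 0 T, {z : ℝ × ℝ | z.2 < z.1}.indicator (fun z => g (z.1 - z.2)) (u, y)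
              ≤ ∫⁻ u, {z : ℝ × ℝ | z.2 < z.1}.indicator (fun z => g (z.1 - z.2)) (u, y) :=
                setLIntegral_le_lintegral _ _
            _ = ∫⁻ u, (Ioi 0).indicator g (u - y) := by
                refine lintegral_congr fun u => ?_
                by_cases hu : y < u
                · rw [indicator_of_mem (by exact hu), indicator_of_mem (by simpa using hu)]
                · rw [indicator_of_notMem (by exact hu), indicator_of_notMem (by simpa using hu)]
            _ = _ := by
                rw [lintegral_sub_right_eq_self (fun u => (Ioi (0 : ℝ)).indicator g u) y,
                  lintegral_indicator measurableSet_Ioi]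
        · refine (le_of_eq ?_).trans bot_le
          refine (setLIntegral_congr_fun (g := fun _ => 0) measurableSet_Ioc fun u hu => ?_).trans
            lintegral_zero
          refine indicator_of_notMem (fun h => ?_) _
          have h : y < u := h
          exact hy (h.le.trans hu.2)
    _ = _ := by rw [lintegral_indicator measurableSet_Iic, setLIntegral_const]

/-- Each dominating iterate has mean mass up to `T` at most `B` plus `ρ < 1` times that of the
previous one. The means stay below the fixed point of this recursion, and the bound passes to the
increasing limit by monotone convergence. -/
theorem ae_noExplosion (lam : ℝ) {h : ℝ → ℝ} (hh : Measurable h)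
    (hnorm : (∫⁻ t in Ioi (0 : ℝ), ENNReal.ofReal (h t)) < 1) (x : PointMeasure)
    (hx : x.toMeasure univ < ∞) : ∀ᵐ q ∂poissonLaw, NoExplosion lam h x q := by
  set M : ℕ → Conf → Measure ℝ := fun k q => picard (dominatingRegion lam h) x.toMeasure q.1 k with hM_def
  set ρ := ∫⁻ t in Ioi (0 : ℝ), ENNReal.ofReal (h t)
  have hM : ∀ k, SFiniteFamily (M k) := fun k =>
    sFiniteFamily_picard (f := fun _ => x) (g := id) measurable_const measurable_id
      (fun F hF => measurableSet_dominatingRegion lam hh hF) k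
  have hcausal : ∀ k (s : ℝ≥0) q q',
      (M k (Conf.concat s q q')).restrict (Iic (s : ℝ)) = (M k q).restrict (Iic (s : ℝ)) :=
    fun k s q q' => picard_restrict_congr (causal_dominatingRegion lam h) _
      (concat_restrict_Iic s q q') k
  rw [show (∀ᵐ q ∂poissonLaw, NoExplosion lam h x q) ↔ ∀ᵐ q ∂poissonLaw, ∀ n : ℕ,
    dominatingLimit lam h x.toMeasure q.1 (Ioo (-(n : ℝ)) n) < ∞ from Iff.rfl, ae_all_iff]
  intro T
  set B := x.toMeasure univ + ENNReal.ofReal (lam + 1) * T with hB_def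
  have hB : B < ∞ := ENNReal.add_lt_top.2 ⟨hx, ENNReal.mul_lt_top ENNReal.ofReal_lt_top (by simp)⟩
  -- The fixed point of `c ↦ B + ρ * c`.
  set C := B * (1 - ρ)⁻¹ with hC_def
  have hρ : 1 - ρ ≠ 0 := (tsub_pos_of_lt hnorm).ne'
  have hC : C < ∞ := ENNReal.mul_lt_top hB (ENNReal.inv_lt_top.2 (tsub_pos_of_lt hnorm))
  have hBC : B + ρ * C = C := by
    have h1 : B = (1 - ρ) * C := by
      rw [hC_def, mul_left_comm, ENNReal.mul_inv_cancel hρ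
        (ne_top_of_le_ne_top ENNReal.one_ne_top tsub_le_self), mul_one]
    conv_lhs => rw [h1]
    rw [← add_mul, tsub_add_cancel_of_le hnorm.le, one_mul]
  have hmean : ∀ k, ∫⁻ q, M k q (Iic (T : ℝ)) ∂poissonLaw ≤ C := by
    intro k
    induction k with
    | zero =>
      change ∫⁻ q, x.toMeasure (Iic (T : ℝ)) ∂poissonLaw ≤ C
      rw [lintegral_const, measure_univ, mul_one, ← hBC, hB_def, add_assoc]
      exact (measure_mono (subset_univ _)).trans le_self_add
    | succ k ih =>
      calc ∫⁻ q, M (k + 1) q (Iic (T : ℝ)) ∂poissonLaw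
          = ∫⁻ q, (x.toMeasure (Iic (T : ℝ)) +
              q.1 (Prod.fst ⁻¹' Iic (T : ℝ) ∩ dominatingRegion lam h (M k q))) ∂poissonLaw :=
            lintegral_congr fun q => thin_apply _ _ _ measurableSet_Iic
        _ = x.toMeasure (Iic (T : ℝ)) +
              ∫⁻ q, q.1 (Prod.fst ⁻¹' Iic (T : ℝ) ∩ dominatingRegion lam h (M k q)) ∂poissonLaw := by
            rw [lintegral_add_left measurable_const, lintegral_const, measure_univ, mul_one]
        _ ≤ x.toMeasure univ + ∫⁻ q, (∫⁻ u in Ioc (0 : ℝ) T, (ENNReal.ofReal (lam + 1) +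
              causalConv (fun t => ENNReal.ofReal (h t)) (M k q) u)) ∂poissonLaw :=
            add_le_add (measure_mono (subset_univ _))
              (lintegral_dominatingRegion_le (hM k) (hcausal k) lam hh T)
        _ ≤ x.toMeasure univ + ∫⁻ q, (ENNReal.ofReal (lam + 1) * T + ρ * M k q (Iic (T : ℝ)))
              ∂poissonLaw := by
            gcongr with q
            have := (hM k).sFinite q
            rw [lintegral_add_left measurable_const, setLIntegral_const, Real.volume_Ioc, sub_zero,
              ENNReal.ofReal_natCast]
            gcongr
            exact setLIntegral_causalConv_le hh.ennreal_ofReal _ _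
        _ = B + ρ * ∫⁻ q, M k q (Iic (T : ℝ)) ∂poissonLaw := by
            rw [lintegral_add_left measurable_const, lintegral_const, measure_univ (μ := poissonLaw), mul_one,
              lintegral_const_mul _ ((hM k).measurable_apply measurableSet_Iic), ← add_assoc]
        _ ≤ B + ρ * C := by gcongr
        _ = C := hBC
  have hlim : ∀ q : Conf, dominatingLimit lam h x.toMeasure q.1 (Iic (T : ℝ)) ≤
      ⨆ k, M k q (Iic (T : ℝ)) := by
    intro q
    have hmono : Monotone fun k => Prod.fst ⁻¹' Iic (T : ℝ) ∩ dominatingRegion lam h (M k q) :=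
      fun i j hij => inter_subset_inter_right _ (dominatingRegion_mono (picard_dominating_mono _ _ _ _ hij))
    rw [dominatingLimit, thin_apply _ _ _ measurableSet_Iic, inter_iUnion, hmono.measure_iUnion,
      ENNReal.add_iSup]
    refine iSup_le fun k => le_iSup_of_le (k + 1) ?_
    exact (thin_apply _ _ _ measurableSet_Iic).ge
  have hmono : Monotone fun k q => M k q (Iic (T : ℝ)) := fun i j hij q =>
    picard_dominating_mono lam h x.toMeasure q.1 hij _
  have hfin : ∫⁻ q, ⨆ k, M k q (Iic (T : ℝ)) ∂poissonLaw ≠ ∞ := by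
    rw [lintegral_iSup (fun k => (hM k).measurable_apply measurableSet_Iic) hmono]
    exact ((iSup_le hmean).trans_lt hC).ne
  filter_upwards [ae_lt_top (Measurable.iSup fun k => (hM k).measurable_apply measurableSet_Iic) hfin]
    with q hq
  exact (measure_mono fun y hy => hy.2.le).trans_lt ((hlim q).trans_lt hq)

/-! ### The Laplace functional of an adapted Poisson process, given the past -/

/-- The number of points of a configuration in a set if there are at least two of them. -/
def excess (x : ℝ≥0∞) : ℝ≥0∞ := if x ≤ 1 then 0 else x

theorem measurable_excess : Measurable excess :=
  Measurable.ite measurableSet_Iic measurable_const measurable_id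

/-- The left side is the mean minus the probability of the value one, that is `r - r e⁻ʳ`, and `1 -
e⁻ʳ ≤ r`. -/
theorem lintegral_excess_poissonMeasure_le (r : ℝ≥0) :
    ∫⁻ k, excess (k : ℝ≥0∞) ∂poissonMeasure r ≤ ENNReal.ofReal ((r : ℝ) ^ 2) := by
  have h1 : ∀ k : ℕ, excess (k : ℝ≥0∞) + ({1} : Set ℕ).indicator 1 k = k := by
    intro k
    rcases k with _ | _ | k
    · simp [excess]
    · simp [excess]
    · have h2 : ¬(((k + 1 + 1 : ℕ) : ℝ≥0∞) ≤ 1) := by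
        rw [not_le]; exact_mod_cast (by omega : 1 < k + 1 + 1)
      rw [excess, if_neg h2, indicator_of_notMem (by simp), add_zero]
  have h2 : ∫⁻ k : ℕ, ({1} : Set ℕ).indicator 1 k ∂poissonMeasure r =
      ENNReal.ofReal (Real.exp (-r) * r) := by
    rw [lintegral_indicator_one (measurableSet_singleton _), poissonMeasure_singleton]
    simp
  have h3 : ∫⁻ k, excess (k : ℝ≥0∞) ∂poissonMeasure r + ENNReal.ofReal (Real.exp (-r) * r) = r := by
    rw [← h2, ← lintegral_add_left (measurable_of_countable _)]
    simp_rw [h1]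
    exact lintegral_id_poissonMeasure r
  refine ENNReal.le_of_add_le_add_right (a := ENNReal.ofReal (Real.exp (-r) * r))
    ENNReal.ofReal_ne_top ?_
  rw [h3, ← ENNReal.ofReal_add (by positivity) (by positivity), ← ENNReal.ofReal_coe_nnreal]
  refine ENNReal.ofReal_le_ofReal ?_
  have h4 := Real.add_one_le_exp (-(r : ℝ))
  nlinarith [r.coe_nonneg]

theorem one_sub_exp_coverCount_nonneg {ι : Type*} [Fintype ι] (B : ι → Set (ℝ × ℝ)) (p : ℝ × ℝ) :
    0 ≤ 1 - Real.exp (-coverCount B p) := by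
  rw [sub_nonneg, Real.exp_le_one_iff, neg_nonpos]
  exact coverCount_nonneg p

/-- The first order expansion of the Laplace functional is exact unless there are two points. -/
theorem Conf.expNeg_expansion {ι : Type*} [Fintype ι] {B : ι → Set (ℝ × ℝ)} {R : Set (ℝ × ℝ)}
    (hB : ∀ i, MeasurableSet (B i)) (hBR : ∀ i, B i ⊆ R) (hR : MeasurableSet R) (q : Conf) :
    ENNReal.ofReal (expNeg B q.1) + ∫⁻ p in R, ENNReal.ofReal (1 - Real.exp (-coverCount B p)) ∂q.1 ≤
        1 + excess (q.1 R) ∧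
      1 ≤ ENNReal.ofReal (expNeg B q.1) +
        ∫⁻ p in R, ENNReal.ofReal (1 - Real.exp (-coverCount B p)) ∂q.1 + excess (q.1 R) := by
  by_cases h : q.1 R ≤ 1
  · have key : ENNReal.ofReal (expNeg B q.1) +
        ∫⁻ p in R, ENNReal.ofReal (1 - Real.exp (-coverCount B p)) ∂q.1 = 1 := by
      rcases h.lt_or_eq with h0 | h1
      · have h0 : q.1 R = 0 := IsCounting.eq_zero_of_lt_one (α := ℝ × ℝ) q.2.1 hR h0
        have h2 : ∀ i, q.1 (B i) = 0 := fun i => measure_mono_null (hBR i) h0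
        rw [setLIntegral_measure_zero _ _ h0]
        simp [expNeg, h2]
      -- With total mass one, each `B i` carries mass zero or one, so its indicator is almost
      -- everywhere equal to its mass; the point itself need not be exhibited.
      · have h2 : ∀ᵐ p ∂q.1.restrict R, ∀ i, (B i).indicator (1 : ℝ × ℝ → ℝ) p = (q.1 (B i)).toReal := by
          refine ae_all_iff.2 fun i => ?_
          rcases ((measure_mono (hBR i)).trans h1.le).lt_or_eq with h0 | h3
          · have h0 : q.1 (B i) = 0 := IsCounting.eq_zero_of_lt_one (α := ℝ × ℝ) q.2.1 (hB i) h0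
            have h4 : ∀ᵐ p ∂q.1.restrict R, p ∉ B i :=
              ae_restrict_of_ae (measure_eq_zero_iff_ae_notMem.1 h0)
            filter_upwards [h4] with p hp
            simp [hp, h0]
          · have h4 : q.1 (R \ B i) = 0 := by
              rw [measure_sdiff (hBR i) (hB i).nullMeasurableSet (by simp [h3]), h1, h3, tsub_self]
            have h5 : ∀ᵐ p ∂q.1.restrict R, p ∉ R \ B i :=
              ae_restrict_of_ae (measure_eq_zero_iff_ae_notMem.1 h4)
            filter_upwards [h5, ae_restrict_mem hR] with p hp hpR
            have hpB : p ∈ B i := by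
              by_contra hc; exact hp ⟨hpR, hc⟩
            simp [hpB, h3]
        have h3 : ∀ᵐ p ∂q.1.restrict R, ENNReal.ofReal (1 - Real.exp (-coverCount B p)) =
            ENNReal.ofReal (1 - expNeg B q.1) := by
          filter_upwards [h2] with p hp
          rw [coverCount, expNeg]
          simp_rw [hp]
        rw [lintegral_congr_ae h3, lintegral_const, Measure.restrict_apply_univ, h1, mul_one,
          ← ENNReal.ofReal_add (expNeg_nonneg _ _) (sub_nonneg.2 (expNeg_le_one _ _))]
        simp
    rw [excess, if_pos h, key]
    simp
  · rw [excess, if_neg h]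
    constructor
    · refine add_le_add ?_ ?_
      · exact ENNReal.ofReal_le_one.2 (expNeg_le_one _ _)
      · calc _ ≤ ∫⁻ p in R, 1 ∂q.1 := by
              refine lintegral_mono fun p => ENNReal.ofReal_le_one.2 ?_
              linarith [Real.exp_pos (-coverCount B p)]
          _ = q.1 R := by simp
    · exact (not_le.1 h).le.trans le_add_self

theorem laplaceExponent_eq_setIntegral {ι : Type*} [Fintype ι] {B : ι → Set (ℝ × ℝ)}
    {R : Set (ℝ × ℝ)} (hBR : ∀ i, B i ⊆ R) (hRq : R ⊆ quadrant) :
    laplaceExponent B = ∫ p in R, (1 - Real.exp (-coverCount B p)) :=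
  setIntegral_eq_of_subset_of_forall_sdiff_eq_zero measurableSet_quadrant hRq fun p hp => by
    rw [coverCount_eq_zero fun i hi => hp.2 (hBR i hi)]; simp

theorem lintegral_one_sub_exp {ι : Type*} [Fintype ι] {B : ι → Set (ℝ × ℝ)}
    {R : Set (ℝ × ℝ)} (hB : ∀ i, MeasurableSet (B i)) (hBR : ∀ i, B i ⊆ R) (hRq : R ⊆ quadrant)
    (hRb : Bornology.IsBounded R) :
    ∫⁻ p in R, ENNReal.ofReal (1 - Real.exp (-coverCount B p)) =
      ENNReal.ofReal (laplaceExponent B) := by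
  rw [laplaceExponent_eq_setIntegral hBR hRq, ofReal_integral_eq_lintegral_ofReal]
  · exact (integrable_one_sub_exp hB fun i => hRb.subset (hBR i)).integrableOn
  · exact Eventually.of_forall fun p => one_sub_exp_coverCount_nonneg B p

theorem laplaceExponent_nonneg {ι : Type*} [Fintype ι] (B : ι → Set (ℝ × ℝ)) : 0 ≤ laplaceExponent B :=
  integral_nonneg fun p => one_sub_exp_coverCount_nonneg B p

theorem laplaceExponent_le {ι : Type*} [Fintype ι] {B : ι → Set (ℝ × ℝ)} {R : Set (ℝ × ℝ)}
    (hB : ∀ i, MeasurableSet (B i)) (hBR : ∀ i, B i ⊆ R) (hRq : R ⊆ quadrant)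
    (hRb : Bornology.IsBounded R) : ENNReal.ofReal (laplaceExponent B) ≤ volume R := by
  rw [← lintegral_one_sub_exp hB hBR hRq hRb]
  calc _ ≤ ∫⁻ p in R, 1 := by
        refine lintegral_mono fun p => ENNReal.ofReal_le_one.2 ?_
        linarith [Real.exp_pos (-coverCount B p)]
    _ = volume R := by simp

theorem laplaceExponent_inter_add {ι : Type*} [Fintype ι] {B : ι → Set (ℝ × ℝ)}
    (hB : ∀ i, MeasurableSet (B i)) (hb : ∀ i, Bornology.IsBounded (B i)) {S S' : Set (ℝ × ℝ)}
    (hS : MeasurableSet S) (hS' : MeasurableSet S') (hSS : Disjoint S S') :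
    laplaceExponent (fun i => B i ∩ (S ∪ S')) =
      laplaceExponent (fun i => B i ∩ S) + laplaceExponent (fun i => B i ∩ S') := by
  have hint : ∀ S, MeasurableSet S → Integrable fun p => 1 - Real.exp (-coverCount (fun i => B i ∩ S) p) :=
    fun S hS => integrable_one_sub_exp (fun i => (hB i).inter hS) fun i => (hb i).subset inter_subset_left
  rw [laplaceExponent, laplaceExponent, laplaceExponent,
    ← integral_add (hint S hS).integrableOn (hint S' hS').integrableOn]
  congr 1
  funext p
  have hin : ∀ S, p ∈ S → coverCount (fun i => B i ∩ S) p = coverCount B p := by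
    intro S hp
    refine Finset.sum_congr rfl fun i _ => ?_
    by_cases h : p ∈ B i
    · rw [indicator_of_mem (mem_inter h hp), indicator_of_mem h]
    · rw [indicator_of_notMem fun hh => h hh.1, indicator_of_notMem h]
  have hout : ∀ S, p ∉ S → coverCount (fun i => B i ∩ S) p = 0 := fun S hp =>
    coverCount_eq_zero fun i hi => hp hi.2
  by_cases h1 : p ∈ S
  · rw [hin _ (Or.inl h1), hin _ h1, hout S' (disjoint_left.1 hSS h1)]
    simp
  · by_cases h2 : p ∈ S'
    · rw [hin _ (Or.inr h2), hin _ h2, hout S h1]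
      simp
    · rw [hout _ (not_or.2 ⟨h1, h2⟩), hout S h1, hout S' h2]
      simp

theorem Conf.expNeg_inter_union {ι : Type*} [Fintype ι] {B : ι → Set (ℝ × ℝ)}
    (hB : ∀ i, MeasurableSet (B i)) (hb : ∀ i, Bornology.IsBounded (B i)) {S S' : Set (ℝ × ℝ)}
    (hS' : MeasurableSet S') (hSS : Disjoint S S') (q : Conf) :
    expNeg (fun i => B i ∩ (S ∪ S')) q.1 =
      expNeg (fun i => B i ∩ S) q.1 * expNeg (fun i => B i ∩ S') q.1 := by
  rw [expNeg, expNeg, expNeg, ← Real.exp_add, ← neg_add, ← Finset.sum_add_distrib]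
  congr 2
  refine Finset.sum_congr rfl fun i _ => ?_
  have hf : ∀ S, q.1 (B i ∩ S) ≠ ∞ := fun S => (q.2.2.1 _ ((hb i).subset inter_subset_left)).ne
  rw [inter_union_distrib_left, measure_union (hSS.mono inter_subset_right inter_subset_right)
    ((hB i).inter hS'), ENNReal.toReal_add (hf S) (hf S')]

/-- The part of a configuration up to time `t`. -/
def Conf.past (t : ℝ) (q : Conf) : Conf :=
  ⟨q.1.restrict (Iic t ×ˢ univ), IsCounting.restrict (α := ℝ × ℝ) q.2.1 _,
    fun _ hB => (Measure.restrict_apply_le _ _).trans_lt (q.2.2.1 _ hB),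
    le_antisymm ((Measure.restrict_apply_le _ _).trans q.2.2.2.le) bot_le⟩

theorem Conf.past_apply (t : ℝ) (q : Conf) {D : Set (ℝ × ℝ)} (hD : MeasurableSet D) :
    (past t q).1 D = q.1 (D ∩ Iic t ×ˢ univ) :=
  Measure.restrict_apply hD

namespace IsPoissonPointProcess

variable {Ω : Type*} {mΩ : MeasurableSpace Ω} {P : Measure Ω} {𝓕 : Filtration ℝ≥0 mΩ}
  {Q : Ω → Measure (ℝ × ℝ)}

/-- The point process as a random configuration. -/
def conf (hQ : IsPoissonPointProcess P 𝓕 Q) (ω : Ω) : Conf := ⟨Q ω, hQ.counting ω, hQ.finite_of_isBounded ω, hQ.support ω⟩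

/-- The rectangles in the definition start at positive times; one starting at time zero is an
increasing union of them. -/
theorem measurable_rect (hQ : IsPoissonPointProcess P 𝓕 Q) 
    (t : ℝ≥0) {s : ℝ} (hs : s ≤ t) (a : ℝ) :
    Measurable[𝓕 t] fun ω => Q ω (Ioc 0 s ×ˢ Ioc 0 a) := by
  rcases le_or_gt s 0 with hs0 | hs0
  · simp [Ioc_eq_empty hs0.not_gt]
  rcases le_or_gt a 0 with ha0 | ha0
  · simp [Ioc_eq_empty ha0.not_gt]
  -- The `+ 2` keeps the left end strictly below `s` already for `n = 0`.
  have h1 : ∀ n : ℕ, 0 < s / (n + 2) ∧ s / (n + 2) < s := fun n => ⟨by positivity, by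
    rw [div_lt_iff₀ (by positivity)]
    nlinarith [(n.cast_nonneg : (0 : ℝ) ≤ n)]⟩
  have h2 : Ioc 0 s ×ˢ Ioc 0 a = ⋃ n : ℕ, Ioc (s / (n + 2)) s ×ˢ Ioc 0 a := by
    rw [← iUnion_prod_const]
    congr 1
    ext y
    simp only [mem_iUnion, mem_Ioc]
    constructor
    · rintro ⟨hy, hys⟩
      obtain ⟨n, hn⟩ := exists_nat_gt (s / y)
      refine ⟨n, ?_, hys⟩
      rw [div_lt_iff₀ hy] at hn
      rw [div_lt_iff₀ (by positivity)]
      nlinarith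
    · rintro ⟨n, hn, hys⟩
      exact ⟨(h1 n).1.trans hn, hys⟩
  have hmono : Monotone fun n : ℕ => Ioc (s / ((n : ℝ) + 2)) s ×ˢ Ioc 0 a := by
    intro m n hmn
    have : (m : ℝ) ≤ n := by exact_mod_cast hmn
    exact prod_mono (Ioc_subset_Ioc_left (by gcongr)) subset_rfl
  have h3 : ∀ ω, Q ω (Ioc 0 s ×ˢ Ioc 0 a) = ⨆ n : ℕ, Q ω (Ioc (s / ((n : ℝ) + 2)) s ×ˢ Ioc 0 a) :=
    fun ω => by rw [h2, hmono.measure_iUnion]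
  simp_rw [h3]
  refine Measurable.iSup fun n => ?_
  lift s to ℝ≥0 using hs0.le
  lift a to ℝ≥0 using ha0.le
  have h4 : s / ((n : ℝ≥0) + 2) < s := by exact_mod_cast (h1 n).2
  have h5 : s / ((n : ℝ≥0) + 2) + (s - s / ((n : ℝ≥0) + 2)) = s := add_tsub_cancel_of_le h4.le
  have h6 := hQ.measurable (s / ((n : ℝ≥0) + 2)) (s - s / ((n : ℝ≥0) + 2)) a
    (by exact_mod_cast (h1 n).1) (tsub_pos_of_lt h4) (by exact_mod_cast ha0)
  have h7 : (((s / ((n : ℝ≥0) + 2) : ℝ≥0) : ℝ) + ((s - s / ((n : ℝ≥0) + 2) : ℝ≥0) : ℝ)) = s := by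
    exact_mod_cast h5
  rw [h5, h7] at h6
  have h8 : ((s / ((n : ℝ≥0) + 2) : ℝ≥0) : ℝ) = (s : ℝ) / ((n : ℝ) + 2) := by push_cast; rfl
  rw [h8] at h6
  exact h6.mono (𝓕.mono (by exact_mod_cast hs)) le_rfl

theorem measurable_past (hQ : IsPoissonPointProcess P 𝓕 Q) 
    (t : ℝ≥0) : Measurable[𝓕 t] fun ω => (hQ.conf ω).past t := by
  refine @Conf.measurable_of_corners Ω (𝓕 t) _ fun s a => ?_
  have h1 : ∀ ω, ((hQ.conf ω).past t).1 (Iic (s : ℝ) ×ˢ Iic (a : ℝ)) =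
      Q ω (Ioc 0 (min (s : ℝ) t) ×ˢ Ioc 0 (a : ℝ)) := fun ω => by
    rw [Conf.past_apply _ _ (measurableSet_Iic.prod measurableSet_Iic), prod_inter_prod,
      Iic_inter_Iic, inter_univ, Conf.apply_Iic_prod_Iic]
    rfl
  simp_rw [h1]
  exact hQ.measurable_rect t (min_le_right _ _) _

theorem measurable_apply_of_subset (hQ : IsPoissonPointProcess P 𝓕 Q) 
    (t : ℝ≥0) {D : Set (ℝ × ℝ)} (hD : MeasurableSet D)
    (hDt : D ⊆ Iic (t : ℝ) ×ˢ univ) : Measurable[𝓕 t] fun ω => Q ω D := by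
  have h1 := (Conf.measurable_apply hD).comp (hQ.measurable_past t)
  have h2 : ∀ ω, ((hQ.conf ω).past t).1 D = Q ω D := fun ω => by
    rw [Conf.past_apply _ _ hD, inter_eq_left.2 hDt]
    rfl
  exact (funext h2 : (fun ω => ((hQ.conf ω).past t).1 D) = _) ▸ h1

theorem measurable_conf (hQ : IsPoissonPointProcess P 𝓕 Q) : Measurable hQ.conf := by
  refine Conf.measurable_of_corners fun s a => ?_
  obtain ⟨n, hn⟩ := exists_nat_ge (s : ℝ)
  refine (hQ.measurable_apply_of_subset n (measurableSet_Iic.prod measurableSet_Iic)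
    (prod_mono (Iic_subset_Iic.2 (by simpa using hn)) (subset_univ _))).mono (𝓕.le _) le_rfl

theorem measurable_toMeasure (hQ : IsPoissonPointProcess P 𝓕 Q) : Measurable Q :=
  measurable_subtype_coe.comp hQ.measurable_conf

theorem lintegral_comp_apply (hQ : IsPoissonPointProcess P 𝓕 Q) 
    {t r a : ℝ≥0} (ht : 0 < t) (hr : 0 < r) (ha : 0 < a) {f : ℝ≥0∞ → ℝ≥0∞}
    (hf : Measurable f) : ∫⁻ ω, f (Q ω (Ioc (t : ℝ) (t + r) ×ˢ Ioc (0 : ℝ) a)) ∂P =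
      ∫⁻ k : ℕ, f k ∂poissonMeasure (r * a) := by
  have hm : Measurable fun ω => Q ω (Ioc (t : ℝ) (t + r) ×ˢ Ioc (0 : ℝ) a) :=
    (hQ.measurable t r a ht hr ha).mono (𝓕.le _) le_rfl
  rw [← lintegral_map hf hm, hQ.law t r a ht hr ha, lintegral_map hf (measurable_of_countable _)]

section Slab

variable [IsProbabilityMeasure P] {t r a : ℝ≥0} {Y : Ω → ℝ≥0∞}

theorem lintegral_mul_apply (hQ : IsPoissonPointProcess P 𝓕 Q) (ht : 0 < t)
    (hY : Measurable[𝓕 t] Y) (r a : ℝ) :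
    ∫⁻ ω, Y ω * Q ω (Ioc (t : ℝ) r ×ˢ Ioc 0 a) ∂P =
      (∫⁻ ω, Y ω ∂P) * volume (Ioc (t : ℝ) r ×ˢ Ioc 0 a) := by
  rcases le_or_gt r t with hr0 | hr0
  · simp [Ioc_eq_empty hr0.not_gt]
  rcases le_or_gt a 0 with ha0 | ha0
  · simp [Ioc_eq_empty ha0.not_gt]
  obtain ⟨r, rfl⟩ : ∃ r' : ℝ≥0, r = t + r' :=
    ⟨(r - t).toNNReal, by rw [Real.coe_toNNReal _ (by linarith)]; ring⟩
  lift a to ℝ≥0 using ha0.le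
  have hr : 0 < r := by
    have : (0 : ℝ) < r := by linarith
    exact_mod_cast this
  have ha : 0 < a := by exact_mod_cast ha0
  have hm := hQ.measurable t r a ht hr ha
  rw [lintegral_mul_eq_lintegral_mul_lintegral_of_independent_measurableSpace (𝓕.le t)
    (hm.mono (𝓕.le _) le_rfl).comap_le (hQ.indep t r a ht hr ha).symm hY (comap_measurable _),
    show ∫⁻ ω, Q ω (Ioc (t : ℝ) (t + r) ×ˢ Ioc (0 : ℝ) a) ∂P = _ from
      hQ.lintegral_comp_apply ht hr ha measurable_id]
  simp only [id_eq]
  rw [lintegral_id_poissonMeasure, Measure.volume_eq_prod, Measure.prod_prod, Real.volume_Ioc,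
    Real.volume_Ioc]
  simp

/-- The mean measure of `Q` weighted by `Y` is a multiple of Lebesgue measure on the slab.
Rectangles based at height zero suffice to see this: they are the traces of the corners, where the
formula is independence of the past. -/
theorem lintegral_mul_setLIntegral (hQ : IsPoissonPointProcess P 𝓕 Q) (ht : 0 < t)
    (hY : Measurable[𝓕 t] Y) (hY1 : ∀ ω, Y ω ≤ 1) {f : ℝ × ℝ → ℝ≥0∞} (hf : Measurable f) :
    ∫⁻ ω, Y ω * ∫⁻ p in Ioc (t : ℝ) (t + r) ×ˢ Ioc (0 : ℝ) a, f p ∂Q ω ∂P =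
      (∫⁻ ω, Y ω ∂P) * ∫⁻ p in Ioc (t : ℝ) (t + r) ×ˢ Ioc (0 : ℝ) a, f p := by
  set R : Set (ℝ × ℝ) := Ioc (t : ℝ) (t + r) ×ˢ Ioc (0 : ℝ) a with hR_def
  have hR : MeasurableSet R := measurableSet_Ioc.prod measurableSet_Ioc
  have hYm : Measurable Y := hY.mono (𝓕.le t) le_rfl
  have hbind : ∀ {f : ℝ × ℝ → ℝ≥0∞}, Measurable f →
      ∫⁻ p, f p ∂(P.withDensity Y).bind Q = ∫⁻ ω, Y ω * ∫⁻ p, f p ∂Q ω ∂P := by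
    intro f hf
    rw [Measure.lintegral_bind hQ.measurable_toMeasure.aemeasurable hf.aemeasurable]
    exact lintegral_withDensity_eq_lintegral_mul _ hYm
      ((Measure.measurable_lintegral hf).comp hQ.measurable_toMeasure)
  have happly : ∀ {D}, MeasurableSet D → (P.withDensity Y).bind Q D = ∫⁻ ω, Y ω * Q ω D ∂P := by
    intro D hD
    have := hbind (measurable_one.indicator hD)
    simpa only [lintegral_indicator_one hD] using this
  have hY2 : ∫⁻ ω, Y ω ∂P ≠ ∞ := by
    refine ne_top_of_le_ne_top ENNReal.one_ne_top ((lintegral_mono hY1).trans ?_)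
    simp
  have key : ((P.withDensity Y).bind Q).restrict R = (∫⁻ ω, Y ω ∂P) • volume.restrict R := by
    have huniv : ((P.withDensity Y).bind Q).restrict R univ =
        ((∫⁻ ω, Y ω ∂P) • (volume : Measure (ℝ × ℝ)).restrict R) univ := by
      rw [Measure.restrict_apply_univ, Measure.smul_apply, Measure.restrict_apply_univ, happly hR,
        smul_eq_mul]
      exact hQ.lintegral_mul_apply ht hY _ _
    have hfin : IsFiniteMeasure (((P.withDensity Y).bind Q).restrict R) := by
      refine ⟨?_⟩
      rw [huniv, Measure.smul_apply, Measure.restrict_apply_univ, smul_eq_mul, hR_def,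
        Measure.volume_eq_prod, Measure.prod_prod]
      exact ENNReal.mul_lt_top hY2.lt_top (ENNReal.mul_lt_top measure_Ioc_lt_top measure_Ioc_lt_top)
    refine ext_of_generate_finite Conf.corners Conf.generateFrom_corners Conf.isPiSystem_corners ?_ huniv
    rintro _ ⟨_, hs1, _, hs2, rfl⟩
    simp only [mem_iUnion, mem_singleton_iff] at hs1 hs2
    obtain ⟨s, rfl⟩ := hs1
    obtain ⟨b, rfl⟩ := hs2
    have hC : MeasurableSet (Iic (s : ℝ) ×ˢ Iic (b : ℝ)) := measurableSet_Iic.prod measurableSet_Iic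
    rw [Measure.restrict_apply hC, Measure.smul_apply, Measure.restrict_apply hC, happly (hC.inter hR),
      smul_eq_mul]
    have h1 : Iic (s : ℝ) ×ˢ Iic (b : ℝ) ∩ R =
        Ioc (t : ℝ) (min (t + r) s) ×ˢ Ioc (0 : ℝ) (min a b) := by
      rw [hR_def, inter_comm, prod_inter_prod, Ioc_inter_Iic, Ioc_inter_Iic]
    rw [h1]
    exact hQ.lintegral_mul_apply ht hY _ _
  have h1 : ∀ (μ : Measure (ℝ × ℝ)), ∫⁻ p in R, f p ∂μ = ∫⁻ p, R.indicator f p ∂μ := fun μ =>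
    (lintegral_indicator hR f).symm
  rw [← smul_eq_mul (a := ∫⁻ ω, Y ω ∂P), ← lintegral_smul_measure, ← key, h1,
    hbind (hf.indicator hR)]
  simp_rw [h1]

/-- The expansion `Conf.expNeg_expansion` is integrated against `Y`. The linear term needs the mean
measure only and the excess needs one rectangle only, so no joint law enters. -/
theorem lintegral_slab (hQ : IsPoissonPointProcess P 𝓕 Q) (ht : 0 < t)
    (hr : 0 < r) (ha : 0 < a) (hY : Measurable[𝓕 t] Y) (hY1 : ∀ ω, Y ω ≤ 1) {ι : Type*} [Fintype ι] {B : ι → Set (ℝ × ℝ)} (hB : ∀ i, MeasurableSet (B i))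
    (hBR : ∀ i, B i ⊆ Ioc (t : ℝ) (t + r) ×ˢ Ioc (0 : ℝ) a) :
    ∫⁻ ω, Y ω * ENNReal.ofReal (Conf.expNeg B (Q ω)) ∂P +
        (∫⁻ ω, Y ω ∂P) * ENNReal.ofReal (laplaceExponent B) ≤
      ∫⁻ ω, Y ω ∂P + ENNReal.ofReal (((r : ℝ) * a) ^ 2) ∧
    ∫⁻ ω, Y ω ∂P ≤ ∫⁻ ω, Y ω * ENNReal.ofReal (Conf.expNeg B (Q ω)) ∂P +
        (∫⁻ ω, Y ω ∂P) * ENNReal.ofReal (laplaceExponent B) + ENNReal.ofReal (((r : ℝ) * a) ^ 2) := by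
  set R : Set (ℝ × ℝ) := Ioc (t : ℝ) (t + r) ×ˢ Ioc (0 : ℝ) a with hR_def
  have hR : MeasurableSet R := measurableSet_Ioc.prod measurableSet_Ioc
  have hRq : R ⊆ quadrant := fun p hp => ⟨t.coe_nonneg.trans_lt hp.1.1, hp.2.1⟩
  have hRb : Bornology.IsBounded R := (Metric.isBounded_Ioc _ _).prod (Metric.isBounded_Ioc _ _)
  have hYm : Measurable Y := hY.mono (𝓕.le t) le_rfl
  have hφ : Measurable fun p => ENNReal.ofReal (1 - Real.exp (-coverCount B p)) :=
    (measurable_const.sub (Real.measurable_exp.comp (measurable_coverCount hB).neg)).ennreal_ofReal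
  have hZ : Measurable fun ω => ENNReal.ofReal (Conf.expNeg B (Q ω)) :=
    ((Conf.measurable_expNeg hB).comp hQ.measurable_conf).ennreal_ofReal
  have hV : Measurable fun ω => ∫⁻ p in R, ENNReal.ofReal (1 - Real.exp (-coverCount B p)) ∂Q ω := by
    simp_rw [← lintegral_indicator hR]
    exact (Measure.measurable_lintegral (hφ.indicator hR)).comp hQ.measurable_toMeasure
  have hexc : ∫⁻ ω, Y ω * excess (Q ω R) ∂P ≤ ENNReal.ofReal (((r : ℝ) * a) ^ 2) :=
    calc ∫⁻ ω, Y ω * excess (Q ω R) ∂P ≤ ∫⁻ ω, excess (Q ω R) ∂P :=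
          lintegral_mono fun ω => mul_le_of_le_one_left' (hY1 ω)
      _ = ∫⁻ k : ℕ, excess k ∂poissonMeasure (r * a) :=
          hQ.lintegral_comp_apply ht hr ha measurable_excess
      _ ≤ _ := by simpa using lintegral_excess_poissonMeasure_le (r * a)
  have hYZ : Measurable fun ω => Y ω * ENNReal.ofReal (Conf.expNeg B (Q ω)) := hYm.mul hZ
  have hYV : Measurable fun ω =>
      Y ω * ∫⁻ p in R, ENNReal.ofReal (1 - Real.exp (-coverCount B p)) ∂Q ω := hYm.mul hV
  rw [← lintegral_one_sub_exp hB hBR hRq hRb, ← hQ.lintegral_mul_setLIntegral ht hY hY1 hφ,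
    ← lintegral_add_left hYZ]
  constructor
  · refine le_trans ?_ (add_le_add_right hexc _)
    rw [← lintegral_add_left hYm]
    refine lintegral_mono fun ω => ?_
    have := ((hQ.conf ω).expNeg_expansion hB hBR hR).1
    calc _ = Y ω * (ENNReal.ofReal (Conf.expNeg B (Q ω)) +
          ∫⁻ p in R, ENNReal.ofReal (1 - Real.exp (-coverCount B p)) ∂Q ω) := (mul_add _ _ _).symm
      _ ≤ Y ω * (1 + excess (Q ω R)) := mul_le_mul_right this _
      _ = _ := by rw [mul_add, mul_one]
  · refine le_trans ?_ (add_le_add_right hexc _)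
    refine le_trans (lintegral_mono fun ω => ?_) (lintegral_add_left (hYZ.add hYV) _).le
    have := ((hQ.conf ω).expNeg_expansion hB hBR hR).2
    calc Y ω = Y ω * 1 := (mul_one _).symm
      _ ≤ Y ω * (ENNReal.ofReal (Conf.expNeg B (Q ω)) +
          ∫⁻ p in R, ENNReal.ofReal (1 - Real.exp (-coverCount B p)) ∂Q ω + excess (Q ω R)) :=
            mul_le_mul_right this _
      _ = _ := by rw [mul_add, mul_add]; rfl

end Slab

end IsPoissonPointProcess

/-- A recursion which is the Euler scheme of a linear equation up to small errors. -/
theorem abs_sub_mul_exp_le {f ψ Ψ : ℕ → ℝ} {y η : ℝ} (h0 : f 0 = y) (hΨ0 : Ψ 0 = 0)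
    (hΨ : ∀ k, Ψ (k + 1) = Ψ k + ψ k) (hψ0 : ∀ k, 0 ≤ ψ k) (hψ : ∀ k, ψ k ≤ η) (hη : η ≤ 1)
    (hf : ∀ k, |f k| ≤ 1) (hstep : ∀ k, |f (k + 1) - f k * (1 - ψ k)| ≤ η ^ 2) (k : ℕ) :
    |f k - y * Real.exp (-Ψ k)| ≤ 2 * k * η ^ 2 := by
  induction k with
  | zero => simp [h0, hΨ0]
  | succ k ih =>
    have h1 : |1 - ψ k - Real.exp (-ψ k)| ≤ η ^ 2 := by
      have h2 := Real.abs_exp_sub_one_sub_id_le (x := -ψ k) (by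
        rw [abs_neg, abs_of_nonneg (hψ0 k)]; exact (hψ k).trans hη)
      rw [abs_sub_comm]
      calc _ = |Real.exp (-ψ k) - 1 - -ψ k| := by congr 1; ring
        _ ≤ (-ψ k) ^ 2 := h2
        _ ≤ η ^ 2 := by rw [neg_sq]; exact pow_le_pow_left₀ (hψ0 k) (hψ k) 2
    have h3 : Real.exp (-ψ k) ≤ 1 := by rw [Real.exp_le_one_iff, neg_nonpos]; exact hψ0 k
    have h4 : f (k + 1) - y * Real.exp (-Ψ (k + 1)) = (f (k + 1) - f k * (1 - ψ k)) +
        f k * (1 - ψ k - Real.exp (-ψ k)) + Real.exp (-ψ k) * (f k - y * Real.exp (-Ψ k)) := by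
      rw [hΨ, neg_add, Real.exp_add]; ring
    rw [h4]
    refine (abs_add_three _ _ _).trans ?_
    rw [abs_mul, abs_mul, abs_of_pos (Real.exp_pos _)]
    have h5 : |f k| * |1 - ψ k - Real.exp (-ψ k)| ≤ 1 * η ^ 2 :=
      mul_le_mul (hf k) h1 (abs_nonneg _) zero_le_one
    have h6 : Real.exp (-ψ k) * |f k - y * Real.exp (-Ψ k)| ≤ 1 * (2 * k * η ^ 2) :=
      mul_le_mul h3 ih (abs_nonneg _) zero_le_one
    push_cast
    linarith [hstep k]

namespace IsPoissonPointProcess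

variable {Ω : Type*} {mΩ : MeasurableSpace Ω} {P : Measure Ω} {𝓕 : Filtration ℝ≥0 mΩ}
  {Q : Ω → Measure (ℝ × ℝ)} [IsProbabilityMeasure P] {t T a : ℝ≥0} {Y : Ω → ℝ≥0∞}

theorem abs_toReal_sub_le (hQ : IsPoissonPointProcess P 𝓕 Q) (ht : 0 < t) (hT : 0 < T) (ha : 0 < a)
    (hY : Measurable[𝓕 t] Y) (hY1 : ∀ ω, Y ω ≤ 1) {ι : Type*} [Fintype ι] {B : ι → Set (ℝ × ℝ)}
    (hB : ∀ i, MeasurableSet (B i)) (hBR : ∀ i, B i ⊆ Ioc (t : ℝ) (t + T) ×ˢ Ioc (0 : ℝ) a) :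
    |(∫⁻ ω, Y ω * ENNReal.ofReal (Conf.expNeg B (Q ω)) ∂P).toReal -
      (∫⁻ ω, Y ω ∂P).toReal * (1 - laplaceExponent B)| ≤ ((T : ℝ) * a) ^ 2 := by
  have hfin : ∀ Z : Ω → ℝ≥0∞, (∀ ω, Z ω ≤ 1) → ∫⁻ ω, Z ω ∂P ≠ ∞ := fun Z hZ =>
    ne_top_of_le_ne_top ENNReal.one_ne_top ((lintegral_mono hZ).trans (by simp))
  have h1 : ∫⁻ ω, Y ω ∂P ≠ ∞ := hfin _ hY1
  have h2 : ∫⁻ ω, Y ω * ENNReal.ofReal (Conf.expNeg B (Q ω)) ∂P ≠ ∞ := hfin _ fun ω =>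
    mul_le_one' (hY1 ω) (ENNReal.ofReal_le_one.2 (Conf.expNeg_le_one _ _))
  obtain ⟨h3, h4⟩ := hQ.lintegral_slab ht hT ha hY hY1 hB hBR
  have h5 := ENNReal.toReal_mono (by finiteness) h3
  have h6 := ENNReal.toReal_mono (by finiteness) h4
  rw [ENNReal.toReal_add h2 (by finiteness), ENNReal.toReal_add h1 (by finiteness),
    ENNReal.toReal_mul, ENNReal.toReal_ofReal (laplaceExponent_nonneg B),
    ENNReal.toReal_ofReal (by positivity)] at h5
  rw [ENNReal.toReal_add (by finiteness) (by finiteness), ENNReal.toReal_add h2 (by finiteness),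
    ENNReal.toReal_mul, ENNReal.toReal_ofReal (laplaceExponent_nonneg B),
    ENNReal.toReal_ofReal (by positivity)] at h6
  rw [abs_le]
  constructor <;> nlinarith

/-- The Laplace functional of the points after time `t`, given the past of `t`. -/
theorem lintegral_mul_expNeg (hQ : IsPoissonPointProcess P 𝓕 Q) (ht : 0 < t) (hT : 0 < T) (ha : 0 < a)
    (hY : Measurable[𝓕 t] Y) (hY1 : ∀ ω, Y ω ≤ 1) {ι : Type*} [Fintype ι] {B : ι → Set (ℝ × ℝ)}
    (hB : ∀ i, MeasurableSet (B i)) (hBR : ∀ i, B i ⊆ Ioc (t : ℝ) (t + T) ×ˢ Ioc (0 : ℝ) a) :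
    (∫⁻ ω, Y ω * ENNReal.ofReal (Conf.expNeg B (Q ω)) ∂P).toReal =
      (∫⁻ ω, Y ω ∂P).toReal * Real.exp (-laplaceExponent B) := by
  have hb : ∀ i, Bornology.IsBounded (B i) := fun i =>
    ((Metric.isBounded_Ioc _ _).prod (Metric.isBounded_Ioc _ _)).subset (hBR i)
  have key : ∀ M : ℕ, (T : ℝ) * a ≤ (M + 1 : ℕ) →
      |(∫⁻ ω, Y ω * ENNReal.ofReal (Conf.expNeg B (Q ω)) ∂P).toReal -
        (∫⁻ ω, Y ω ∂P).toReal * Real.exp (-laplaceExponent B)| ≤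
        2 * ((T : ℝ) * a) ^ 2 * (1 / ((M : ℝ) + 1)) := by
    intro M hM
    -- Each of the `M + 1` slices costs at most `2 (d a)²`, in total `2 (T a)² / (M + 1)`, which
    -- tends to zero.
    let d : ℝ≥0 := T / ((M : ℝ≥0) + 1)
    have hd : 0 < d := by positivity
    let s : ℕ → ℝ≥0 := fun k => t + k * d
    have hs : ∀ k, ((s (k + 1) : ℝ≥0) : ℝ) = s k + d := fun k => by simp only [s]; push_cast; ring
    have hsM : ((s (M + 1) : ℝ≥0) : ℝ) = t + T := by
      simp only [s, d]; push_cast; field_simp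
    have hst : ∀ k, t ≤ s k := fun k => le_self_add
    let S : ℕ → Set (ℝ × ℝ) := fun k => Iic (s k : ℝ) ×ˢ univ
    let S' : ℕ → Set (ℝ × ℝ) := fun k => Ioc (s k : ℝ) (s k + d) ×ˢ univ
    have hS : ∀ k, MeasurableSet (S k) := fun k => measurableSet_Iic.prod MeasurableSet.univ
    have hS' : ∀ k, MeasurableSet (S' k) := fun k => measurableSet_Ioc.prod MeasurableSet.univ
    have hdisj : ∀ k, Disjoint (S k) (S' k) := fun k => disjoint_left.2 fun p hp hp' =>
      not_lt.2 hp.1 hp'.1.1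
    have hunion : ∀ k, S (k + 1) = S k ∪ S' k := fun k => by
      simp only [S, S', ← union_prod, hs]
      rw [Iic_union_Ioc_eq_Iic (by simp)]
    have hempty : ∀ i, B i ∩ S 0 = ∅ := fun i => by
      refine eq_empty_of_forall_notMem fun p hp => ?_
      have h1 := (hBR i hp.1).1.1
      have h2 : p.1 ≤ ((s 0 : ℝ≥0) : ℝ) := hp.2.1
      simp only [s, Nat.cast_zero, zero_mul, add_zero] at h2
      linarith
    have hlast : (fun i => B i ∩ S (M + 1)) = B := by
      funext i
      refine inter_eq_left.2 fun p hp => ⟨?_, mem_univ _⟩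
      rw [mem_Iic, hsM]
      exact (hBR i hp).1.2
    -- The functional of the slices already treated is absorbed into the weight, which is known at
    -- time `s k`; the next slice is then a single application of `abs_toReal_sub_le`.
    let Yk : ℕ → Ω → ℝ≥0∞ := fun k ω => Y ω * ENNReal.ofReal (Conf.expNeg (fun i => B i ∩ S k) (Q ω))
    have hYk : ∀ k, Measurable[𝓕 (s k)] (Yk k) := fun k => by
      refine Measurable.mul (hY.mono (𝓕.mono (hst k)) le_rfl) (ENNReal.measurable_ofReal.comp ?_)
      refine Real.measurable_exp.comp (Measurable.neg ?_)
      exact Finset.measurable_sum _ fun i _ => ENNReal.measurable_toReal.comp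
        (hQ.measurable_apply_of_subset (s k) ((hB i).inter (hS k)) inter_subset_right)
    have hYk1 : ∀ k ω, Yk k ω ≤ 1 := fun k ω =>
      mul_le_one' (hY1 ω) (ENNReal.ofReal_le_one.2 (Conf.expNeg_le_one _ _))
    have hsub : ∀ k i, B i ∩ S' k ⊆ Ioc (s k : ℝ) (s k + d) ×ˢ Ioc (0 : ℝ) a := fun k i p hp =>
      ⟨hp.2.1, (hBR i hp.1).2⟩
    have h := abs_sub_mul_exp_le (f := fun k => (∫⁻ ω, Yk k ω ∂P).toReal)
      (ψ := fun k => laplaceExponent fun i => B i ∩ S' k)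
      (Ψ := fun k => laplaceExponent fun i => B i ∩ S k) (y := (∫⁻ ω, Y ω ∂P).toReal)
      (η := (d : ℝ) * a) ?_ ?_ ?_ ?_ ?_ ?_ ?_ ?_ (M + 1)
    · simp only [Yk, hlast] at h
      refine h.trans (le_of_eq ?_)
      simp only [d]
      push_cast
      field_simp
    · simp [Yk, hempty, Conf.expNeg]
    · simp [hempty, laplaceExponent, coverCount]
    · intro k
      simp only [hunion]
      exact laplaceExponent_inter_add hB hb (hS k) (hS' k) (hdisj k)
    · exact fun k => laplaceExponent_nonneg _
    · intro k
      have h1 := laplaceExponent_le (fun i => (hB i).inter (hS' k)) (hsub k)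
        (fun p hp => ⟨(s k).coe_nonneg.trans_lt hp.1.1, hp.2.1⟩)
        ((Metric.isBounded_Ioc _ _).prod (Metric.isBounded_Ioc _ _))
      rw [Measure.volume_eq_prod, Measure.prod_prod, Real.volume_Ioc, Real.volume_Ioc, sub_zero,
        add_sub_cancel_left, ← ENNReal.ofReal_mul d.coe_nonneg] at h1
      exact (ENNReal.ofReal_le_ofReal_iff (by positivity)).1 h1
    · have : (d : ℝ) * a = T * a / ((M + 1 : ℕ) : ℝ) := by simp only [d]; push_cast; ring
      rw [this]
      exact div_le_one_of_le₀ hM (by positivity)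
    · intro k
      rw [abs_of_nonneg ENNReal.toReal_nonneg]
      refine ENNReal.toReal_mono ENNReal.one_ne_top ((lintegral_mono (hYk1 k)).trans ?_)
      simp
    · intro k
      have h1 : ∀ ω, Yk (k + 1) ω =
          Yk k ω * ENNReal.ofReal (Conf.expNeg (fun i => B i ∩ S' k) (Q ω)) := fun ω => by
        have h2 := Conf.expNeg_inter_union hB hb (hS' k) (hdisj k) (hQ.conf ω)
        change Conf.expNeg _ (Q ω) = Conf.expNeg _ (Q ω) * Conf.expNeg _ (Q ω) at h2
        simp only [Yk, hunion]
        rw [h2, ENNReal.ofReal_mul (Conf.expNeg_nonneg _ _), mul_assoc]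
      simp_rw [h1]
      exact hQ.abs_toReal_sub_le (ht.trans_le (hst k)) hd ha (hYk k) (hYk1 k)
        (fun i => (hB i).inter (hS' k)) (hsub k)
  have hlim : Tendsto (fun M : ℕ => 2 * ((T : ℝ) * a) ^ 2 * (1 / ((M : ℝ) + 1))) atTop (𝓝 0) := by
    have h := (tendsto_one_div_add_atTop_nhds_zero_nat (𝕜 := ℝ)).const_mul (2 * ((T : ℝ) * a) ^ 2)
    rwa [mul_zero] at h
  obtain ⟨M₀, hM₀⟩ := exists_nat_ge ((T : ℝ) * a)
  have h := ge_of_tendsto hlim (eventually_atTop.2 ⟨M₀, fun M hM => key M (hM₀.trans (by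
    exact_mod_cast hM.trans (Nat.le_succ M)))⟩)
  exact sub_eq_zero.1 (abs_nonpos_iff.1 h)

end IsPoissonPointProcess

/-! ### Strong Markov property of the Poisson process -/

namespace Conf

theorem measurable_shift : Measurable fun z : ℝ≥0 × Conf => shift z.1 z.2 := by
  refine measurable_of_corners fun t a => ?_
  have h1 : ∀ z : ℝ≥0 × Conf, (shift z.1 z.2).1 (Iic (t : ℝ) ×ˢ Iic (a : ℝ)) = z.2.1 (Prod.mk z ⁻¹'
      {x : (ℝ≥0 × Conf) × (ℝ × ℝ) | x.2.1 - (x.1.1 : ℝ) ≤ t ∧ x.2.2 ≤ a ∧ (x.1.1 : ℝ) < x.2.1}) := by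
    intro z
    rw [shift_apply _ _ (measurableSet_Iic.prod measurableSet_Iic)]
    congr 1
    ext p
    simp [and_assoc]
  simp_rw [h1]
  have h2 : Measurable fun x : (ℝ≥0 × Conf) × (ℝ × ℝ) => (x.1.1 : ℝ) := by fun_prop
  have h3 : Measurable fun x : (ℝ≥0 × Conf) × (ℝ × ℝ) => x.2.1 := by fun_prop
  have h4 : Measurable fun x : (ℝ≥0 × Conf) × (ℝ × ℝ) => x.2.2 := by fun_prop
  exact measurable_conf_apply measurable_snd ((measurableSet_le (h3.sub h2) measurable_const).inter
    ((measurableSet_le h4 measurable_const).inter (measurableSet_lt h2 h3)))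

/-- The shift of a configuration is right continuous, in the sense of masses of rectangles. -/
theorem eventually_shift_apply (q : Conf) (s₀ : ℝ≥0) (s a : ℝ) :
    ∀ᶠ r in 𝓝[>] s₀, (shift r q).1 (Ioc 0 s ×ˢ Ioc 0 a) = (shift s₀ q).1 (Ioc 0 s ×ˢ Ioc 0 a) := by
  rcases le_or_gt s 0 with hs | hs
  · simp [Ioc_eq_empty hs.not_gt]
  set M : Measure ℝ := (q.1.restrict (univ ×ˢ Iic a)).map Prod.fst with hM_def
  have hMapply : ∀ {D : Set ℝ}, MeasurableSet D → M D = q.1 (D ×ˢ Iic a) := fun {D} hD => by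
    rw [hM_def, Measure.map_apply measurable_fst hD, Measure.restrict_apply (measurable_fst hD)]
    congr 1
    ext p
    simp
  have hM : IsCounting M := (IsCounting.restrict (α := ℝ × ℝ) q.2.1 _).map measurable_fst
  have hfin : ∀ x y, M (Ioo x y) < ∞ := fun x y => by
    rw [hMapply measurableSet_Ioo]
    exact (measure_mono (prod_mono (fun z hz => hz.2.le) subset_rfl)).trans_lt
      (q.apply_Iic_prod_Iic_lt_top y a)
  have h1 : ∀ r : ℝ≥0, (shift r q).1 (Ioc 0 s ×ˢ Ioc 0 a) = M (Ioc (r : ℝ) (r + s)) := by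
    intro r
    rw [shift_apply _ _ (measurableSet_Ioc.prod measurableSet_Ioc), hMapply measurableSet_Ioc]
    refine q.apply_congr fun p _ hp => ?_
    simp only [mem_inter_iff, mem_preimage, mem_prod, mem_Ioc, mem_Ioi, mem_univ, and_true, mem_Iic]
    constructor
    · rintro ⟨⟨⟨h1, h2⟩, h3, h4⟩, h5⟩; exact ⟨⟨h5, by linarith⟩, h4⟩
    · rintro ⟨⟨h1, h2⟩, h3⟩; exact ⟨⟨⟨by linarith, by linarith⟩, hp, h3⟩, h1⟩
  obtain ⟨s₁, hs₁, hM₁⟩ := exists_right_null hM hfin s₀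
  obtain ⟨s₂, hs₂, hM₂⟩ := exists_right_null hM hfin (s₀ + s)
  have h2 : ∀ᶠ r : ℝ≥0 in 𝓝[>] s₀, (r : ℝ) < min s₁ (s₂ - s) :=
    (NNReal.continuous_coe.tendsto s₀).mono_left nhdsWithin_le_nhds |>.eventually_lt_const
      (lt_min hs₁ (by linarith))
  filter_upwards [h2, self_mem_nhdsWithin] with r hr hr0
  have hr0 : (s₀ : ℝ) < r := by exact_mod_cast hr0
  obtain ⟨hr1, hr2⟩ := lt_min_iff.1 hr
  rw [h1, h1]
  refine measure_congr (ae_eq_set.2 ⟨measure_mono_null (fun y hy => ?_) hM₂,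
    measure_mono_null (fun y hy => ?_) hM₁⟩)
  · refine ⟨?_, by linarith [hy.1.2]⟩
    by_contra! hc
    exact hy.2 ⟨hr0.trans hy.1.1, hc⟩
  · refine ⟨hy.1.1, ?_⟩
    by_contra! hc
    exact hy.2 ⟨hr1.trans_le hc, by linarith [hy.1.2]⟩

end Conf

namespace IsPoissonPointProcess

variable {Ω : Type*} {mΩ : MeasurableSpace Ω} {P : Measure Ω} {𝓕 : Filtration ℝ≥0 mΩ}
  {Q : Ω → Measure (ℝ × ℝ)} [IsProbabilityMeasure P]

/-- Rectangles seen from time `t` are rectangles after `t`, and translation does not change the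
Laplace exponent; the weight is the indicator of `G`. -/
theorem setLIntegral_expNeg_shift (hQ : IsPoissonPointProcess P 𝓕 Q) {t : ℝ≥0} (ht : 0 < t) {G : Set Ω}
    (hG : MeasurableSet[𝓕 t] G) {ι : Type*} [Fintype ι] (s a : ι → ℝ) :
    ∫⁻ ω in G, ENNReal.ofReal (Conf.expNeg (fun i => Ioc 0 (s i) ×ˢ Ioc 0 (a i))
        ((hQ.conf ω).shift t).1) ∂P =
      P G * ENNReal.ofReal (Real.exp (-laplaceExponent fun i => Ioc 0 (s i) ×ˢ Ioc 0 (a i))) := by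
  set C : ι → Set (ℝ × ℝ) := fun i => Ioc 0 (s i) ×ˢ Ioc 0 (a i)
  set B : ι → Set (ℝ × ℝ) := fun i => Ioc (t : ℝ) (t + s i) ×ˢ Ioc 0 (a i)
  have hB : ∀ i, MeasurableSet (B i) := fun i => measurableSet_Ioc.prod measurableSet_Ioc
  have hb : ∀ i, Bornology.IsBounded (B i) := fun i =>
    (Metric.isBounded_Ioc _ _).prod (Metric.isBounded_Ioc _ _)
  obtain ⟨n, hn⟩ := exists_natCast_bound hb
  have hGm : MeasurableSet G := 𝓕.le t _ hG
  have hZ : ∀ ω, Conf.expNeg C ((hQ.conf ω).shift t).1 = Conf.expNeg B (Q ω) := by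
    intro ω
    simp only [Conf.expNeg]
    congr 2
    refine Finset.sum_congr rfl fun i _ => ?_
    rw [Conf.shift_apply _ _ (measurableSet_Ioc.prod measurableSet_Ioc)]
    change (Q ω _).toReal = _
    congr 2
    ext p
    simp only [B, mem_inter_iff, mem_preimage, mem_prod, mem_Ioc, mem_Ioi, mem_univ, and_true]
    constructor
    · rintro ⟨⟨⟨h1, h2⟩, h3⟩, h5⟩; exact ⟨⟨h5, by linarith⟩, h3⟩
    · rintro ⟨⟨h1, h2⟩, h3⟩; exact ⟨⟨⟨by linarith, by linarith⟩, h3⟩, h1⟩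
  have hL : laplaceExponent B = laplaceExponent C := by
    rw [laplaceExponent_split hB hb t]
    have h1 : (fun i => B i ∩ Iic (t : ℝ) ×ˢ univ) = fun _ => ∅ := by
      funext i
      exact eq_empty_of_forall_notMem fun p hp => not_lt.2 hp.2.1 hp.1.1.1
    have h2 : (fun i => (fun p : ℝ × ℝ => (p.1 + (t : ℝ), p.2)) ⁻¹' B i) = C := by
      funext i
      ext p
      simp [B, C, add_comm (p.1)]
    rw [h1, h2]
    simp [laplaceExponent, coverCount]
  have hm : Measurable fun ω => ENNReal.ofReal (Conf.expNeg B (Q ω)) :=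
    ((Conf.measurable_expNeg hB).comp hQ.measurable_conf).ennreal_ofReal
  have hGi : Measurable[𝓕 t] (G.indicator (1 : Ω → ℝ≥0∞)) :=
    Measurable.indicator (@measurable_const _ _ _ (𝓕 t) 1) hG
  have h := hQ.lintegral_mul_expNeg (T := n + 1) (a := n + 1) ht (by positivity) (by positivity)
    (Y := G.indicator 1) hGi
    (fun ω => indicator_le_self' (fun _ _ => zero_le_one) ω) hB (fun i p hp => by
      obtain ⟨h1, h2⟩ := hn i p hp
      refine ⟨⟨hp.1.1, ?_⟩, hp.2.1, ?_⟩
      · push_cast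
        linarith [(abs_le.1 h1).2, t.coe_nonneg]
      · push_cast
        linarith [(abs_le.1 h2).2])
  have h1 : ∫⁻ ω, G.indicator 1 ω * ENNReal.ofReal (Conf.expNeg B (Q ω)) ∂P =
      ∫⁻ ω in G, ENNReal.ofReal (Conf.expNeg B (Q ω)) ∂P := by
    rw [← lintegral_indicator hGm]
    refine lintegral_congr fun ω => ?_
    by_cases hω : ω ∈ G <;> simp [hω]
  rw [h1, lintegral_indicator_one hGm, hL] at h
  simp_rw [hZ]
  refine (ENNReal.toReal_eq_toReal_iff' ?_ (by finiteness)).1 ?_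
  · refine ne_top_of_le_ne_top ENNReal.one_ne_top ((setLIntegral_le_lintegral _ _).trans
      ((lintegral_mono fun ω => ENNReal.ofReal_le_one.2 (Conf.expNeg_le_one B (Q ω))).trans ?_))
    simp
  · rw [h, ENNReal.toReal_mul, ENNReal.toReal_ofReal (Real.exp_pos _).le]

/-- The strong Markov property of the Poisson point process: given the past of a stopping time, the
points after it form a Poisson point process. -/
theorem map_shift_stopping (hQ : IsPoissonPointProcess P 𝓕 Q) {T : Ω → WithTop ℝ≥0}
    (hT : IsStoppingTime 𝓕 T) {G : Set Ω} (hG : MeasurableSet[hT.measurableSpace] G) :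
    (P.restrict (G ∩ {ω | T ω < ⊤})).map (fun ω => (hQ.conf ω).shift ((T ω).untopD 0)) =
      P (G ∩ {ω | T ω < ⊤}) • poissonLaw := by
  set τ : Ω → ℝ≥0 := fun ω => (T ω).untopD 0
  have hle : ∀ ω, ∀ t : ℝ≥0, T ω < ⊤ → (T ω ≤ t ↔ τ ω ≤ t) := by
    intro ω t hω
    obtain ⟨r, hr⟩ := WithTop.ne_top_iff_exists.1 hω.ne
    simp only [τ, ← hr, WithTop.untopD_coe]
    exact WithTop.coe_le_coe
  set G' := G ∩ {ω | T ω < ⊤}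
  have hτm : Measurable τ := hT.measurable'.untopD 0
  have hSm : Measurable fun ω => (hQ.conf ω).shift (τ ω) :=
    Conf.measurable_shift.comp (hτm.prodMk hQ.measurable_conf)
  have hPG : P G' ≠ ∞ := measure_ne_top _ _
  let κ : ℕ → Ω → ℕ := fun n ω => ⌈τ ω * ((n : ℝ≥0) + 1)⌉₊
  -- A grid time just above `τ`. The `+ 1` makes it strictly larger than `τ`, and positive even when
  -- `τ = 0`, as the formula at deterministic times requires.
  let g : ℕ → ℕ → ℝ≥0 := fun n k => ((k : ℝ≥0) + 1) / ((n : ℝ≥0) + 1)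
  have hκ : ∀ n k ω, κ n ω ≤ k ↔ τ ω ≤ (k : ℝ≥0) / ((n : ℝ≥0) + 1) := fun n k ω => by
    rw [Nat.ceil_le, le_div_iff₀ (by positivity)]
  have hlt : ∀ n ω, τ ω < g n (κ n ω) := by
    intro n ω
    rw [lt_div_iff₀ (by positivity)]
    exact (Nat.le_ceil _).trans_lt (lt_add_one _)
  have hge : ∀ n ω, g n (κ n ω) ≤ τ ω + 2 * (1 / ((n : ℝ≥0) + 1)) := by
    intro n ω
    have h1 : (⌈τ ω * ((n : ℝ≥0) + 1)⌉₊ : ℝ≥0) ≤ τ ω * ((n : ℝ≥0) + 1) + 1 :=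
      (Nat.ceil_lt_add_one zero_le).le
    rw [div_le_iff₀ (by positivity)]
    calc (⌈τ ω * ((n : ℝ≥0) + 1)⌉₊ : ℝ≥0) + 1 ≤ τ ω * ((n : ℝ≥0) + 1) + 1 + 1 := by gcongr
      _ = _ := by field_simp; ring
  have htends : ∀ ω, Tendsto (fun n => g n (κ n ω)) atTop (𝓝[>] τ ω) := by
    intro ω
    refine tendsto_nhdsWithin_iff.2 ⟨?_, Eventually.of_forall fun n => hlt n ω⟩
    have h1 : Tendsto (fun n : ℕ => τ ω + 2 * (1 / ((n : ℝ≥0) + 1))) atTop (𝓝 (τ ω)) := by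
      have h := (tendsto_one_div_add_atTop_nhds_zero_nat (𝕜 := ℝ≥0)).const_mul 2
      simpa using h.const_add (τ ω)
    exact tendsto_of_tendsto_of_tendsto_of_le_of_le tendsto_const_nhds h1
      (fun n => (hlt n ω).le) (fun n => hge n ω)
  -- The index `k` is decided at time `k / (n + 1)`, which is before `g n k`.
  have hGk : ∀ n k, MeasurableSet[𝓕 (g n k)] (G' ∩ {ω | κ n ω = k}) := by
    intro n k
    have h1 : ∀ j, j ≤ k → MeasurableSet[𝓕 (g n k)] {ω | T ω ≤ ((j : ℝ≥0) / ((n : ℝ≥0) + 1) : ℝ≥0)} :=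
      fun j hj => 𝓕.mono (by
        have : (j : ℝ≥0) ≤ (k : ℝ≥0) + 1 := by exact_mod_cast hj.trans (Nat.le_succ k)
        simp only [g]; gcongr) _ (hT _)
    have h2 : MeasurableSet[𝓕 (g n k)] (G ∩ {ω | T ω ≤ ((k : ℝ≥0) / ((n : ℝ≥0) + 1) : ℝ≥0)}) :=
      𝓕.mono (by simp only [g]; gcongr; exact le_self_add) _ (hG.2 _)
    have h3 : G' ∩ {ω | κ n ω = k} = (G ∩ {ω | T ω ≤ ((k : ℝ≥0) / ((n : ℝ≥0) + 1) : ℝ≥0)}) ∩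
        ⋂ j ∈ Finset.range k, {ω | T ω ≤ ((j : ℝ≥0) / ((n : ℝ≥0) + 1) : ℝ≥0)}ᶜ := by
      ext ω
      simp only [mem_inter_iff, mem_ofPred_eq, mem_iInter, Finset.mem_range, mem_compl_iff, G']
      constructor
      · rintro ⟨⟨hωG, hω⟩, h⟩
        refine ⟨⟨hωG, ?_⟩, fun j hj => ?_⟩
        · rw [hle ω _ hω, ← hκ]; exact h.le
        · rw [hle ω _ hω, ← hκ]; omega
      · rintro ⟨⟨hωG, hω⟩, h⟩
        have hω' : T ω < ⊤ := hω.trans_lt (WithTop.coe_lt_top _)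
        refine ⟨⟨hωG, hω'⟩, ?_⟩
        rw [hle ω _ hω', ← hκ] at hω
        by_contra hne
        refine h (κ n ω) (by omega) ?_
        rw [hle ω _ hω', ← hκ]
    rw [h3]
    exact h2.inter (Finset.measurableSet_biInter _ fun j hj => (h1 j (Finset.mem_range.1 hj).le).compl)
  have := Measure.isFiniteMeasure_map (P.restrict G') fun ω => (hQ.conf ω).shift (τ ω)
  have : IsFiniteMeasure (P G' • poissonLaw) := poissonLaw.smul_finite hPG
  refine Conf.ext_of_expNeg fun m r => ?_
  set C : Fin m → Set (ℝ × ℝ) := fun i => Ioc 0 ((r i).1 : ℝ) ×ˢ Ioc 0 ((r i).2 : ℝ)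
  have hC : ∀ i, MeasurableSet (C i) := fun i => measurableSet_Ioc.prod measurableSet_Ioc
  have h0 : ∀ q : Conf, Conf.expNeg (fun i => Iic ((r i).1 : ℝ) ×ˢ Iic ((r i).2 : ℝ)) q.1 =
      Conf.expNeg C q.1 := by
    intro q
    simp only [Conf.expNeg, Conf.apply_Iic_prod_Iic, C]
  simp_rw [h0]
  rw [integral_map hSm.aemeasurable (Conf.measurable_expNeg hC).aestronglyMeasurable,
    integral_smul_measure, integral_expNeg_poissonLaw hC fun i =>
      (Metric.isBounded_Ioc _ _).prod (Metric.isBounded_Ioc _ _), integral_expNeg_eq hSm hC]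
  set c := ENNReal.ofReal (Real.exp (-laplaceExponent C))
  suffices hsuff : ∫⁻ ω in G', ENNReal.ofReal (Conf.expNeg C ((hQ.conf ω).shift (τ ω)).1) ∂P =
      P G' * c by
    rw [hsuff, ENNReal.toReal_mul, ENNReal.toReal_ofReal (Real.exp_pos _).le, smul_eq_mul]
  have hgm : ∀ n, Measurable fun ω => g n (κ n ω) := fun n =>
    (measurable_of_countable (g n)).comp (Nat.measurable_ceil.comp (hτm.mul_const ((n : ℝ≥0) + 1)))
  have happrox : ∀ n, ∫⁻ ω in G', ENNReal.ofReal
      (Conf.expNeg C ((hQ.conf ω).shift (g n (κ n ω))).1) ∂P = P G' * c := by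
    intro n
    have hun : G' = ⋃ k, G' ∩ {ω | κ n ω = k} := by
      rw [← inter_iUnion]
      refine (inter_eq_left.2 fun ω _ => mem_iUnion.2 ⟨κ n ω, rfl⟩).symm
    have hdisj : Pairwise (Function.onFun Disjoint fun k => G' ∩ {ω | κ n ω = k}) :=
      fun i j hij => disjoint_left.2 fun ω h h' => hij (h.2.symm.trans h'.2)
    have hmk : ∀ k, MeasurableSet (G' ∩ {ω | κ n ω = k}) := fun k => 𝓕.le _ _ (hGk n k)
    conv_lhs => rw [hun]
    conv_rhs => rw [hun]
    rw [lintegral_iUnion hmk hdisj, measure_iUnion hdisj hmk, ← ENNReal.tsum_mul_right]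
    refine tsum_congr fun k => ?_
    rw [← hQ.setLIntegral_expNeg_shift (t := g n k) (by positivity) (hGk n k)
      (fun i => ((r i).1 : ℝ)) (fun i => ((r i).2 : ℝ))]
    refine setLIntegral_congr_fun (hmk k) fun ω hω => ?_
    have : κ n ω = k := hω.2
    simp only [this, C]
  -- Counts in the shifted rectangles are right continuous in the shift and integer valued, so for
  -- each `ω` the integrand is constant for large `n`.
  refine tendsto_nhds_unique (tendsto_lintegral_of_dominated_convergence (fun _ => 1)
    (F := fun n ω => ENNReal.ofReal (Conf.expNeg C ((hQ.conf ω).shift (g n (κ n ω))).1))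
    (fun n => ?_) (fun n => Eventually.of_forall fun ω => ?_) ?_ (Eventually.of_forall fun ω => ?_)) ?_
  · exact ((Conf.measurable_expNeg hC).comp
      (Conf.measurable_shift.comp ((hgm n).prodMk hQ.measurable_conf))).ennreal_ofReal
  · exact ENNReal.ofReal_le_one.2 (Conf.expNeg_le_one _ _)
  · simp
  · have h1 : ∀ᶠ s in 𝓝[>] τ ω, ∀ i, ((hQ.conf ω).shift s).1 (C i) =
        ((hQ.conf ω).shift (τ ω)).1 (C i) :=
      eventually_all.2 fun i => (hQ.conf ω).eventually_shift_apply _ _ _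
    refine tendsto_const_nhds.congr' ?_
    filter_upwards [(htends ω).eventually h1] with n hn
    simp only [Conf.expNeg, hn]
  · simp_rw [happrox]
    exact tendsto_const_nhds

end IsPoissonPointProcess

/-! ### The Hawkes equation seen from a later time -/

theorem eq_zero_of_supportBound_lt {h : ℝ → ℝ} {A : ℝ≥0} (hA : supportBound h ≤ A) {t : ℝ}
    (ht : (A : ℝ) < t) : h t = 0 := by
  by_contra hne
  have ht0 : 0 < t := A.coe_nonneg.trans_lt ht
  have h1 : ENNReal.ofReal t ≤ supportBound h :=
    le_iSup₂ (f := fun t (_ : t ∈ {t : ℝ | 0 < t ∧ 0 < |h t|}) => ENNReal.ofReal t) t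
      ⟨ht0, abs_pos.2 hne⟩
  have h2 := h1.trans hA
  rw [← ENNReal.ofReal_coe_nnreal, ENNReal.ofReal_le_ofReal_iff A.coe_nonneg] at h2
  linarith

/-- A measurable function is bounded almost everywhere for a finite counting measure. -/
theorem IsCounting.exists_ae_bound {M : Measure ℝ} (hM : IsCounting M) (hfin : M univ < ∞) {f : ℝ → ℝ}
    (hf : Measurable f) : ∃ n : ℕ, ∀ᵐ x ∂M, |f x| < n := by
  obtain ⟨n, hn⟩ := exists_Ioo_null hM (I := fun n : ℕ => {x | (n : ℝ) ≤ |f x|})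
    (fun n => measurableSet_le measurable_const hf.abs)
    (fun m n hmn x hx => le_trans (by exact_mod_cast hmn) (show (n : ℝ) ≤ |f x| from hx))
    (eq_empty_of_forall_notMem fun x hx => by
      obtain ⟨n, hn⟩ := exists_nat_gt |f x|
      exact not_lt.2 (mem_iInter.1 hx n) hn) ((measure_mono (subset_univ _)).trans_lt hfin).ne
  exact ⟨n, (measure_eq_zero_iff_ae_notMem.1 hn).mono fun x hx => not_le.1 hx⟩

/-- Although `h` may be unbounded, only the finitely many atoms within distance `A` matter, and a
function is bounded on finitely many atoms. -/
theorem integrableOn_kernel {h : ℝ → ℝ} (hmeas : Measurable h) {A : ℝ≥0} (hA : supportBound h ≤ A)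
    (ν : PointMeasure) (u : ℝ) : IntegrableOn (fun s => h (u - s)) (Iio u) ν.toMeasure := by
  have hf : Measurable fun s => h (u - s) := hmeas.comp (by fun_prop)
  have hJ : ν.toMeasure (Ico (u - A) u) < ∞ := ν.finite_of_isBounded _ (Metric.isBounded_Ico _ _)
  have h1 : IntegrableOn (fun s => h (u - s)) (Ico (u - A) u) ν.toMeasure := by
    obtain ⟨n, hn⟩ := IsCounting.exists_ae_bound (M := ν.toMeasure.restrict (Ico (u - A) u))
      (IsCounting.restrict (α := ℝ) ν.counting _) (by simpa using hJ) hf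
    exact Measure.integrableOn_of_bounded hJ.ne hf.aestronglyMeasurable (M := n)
      (hn.mono fun x hx => hx.le)
  refine h1.of_forall_sdiff_eq_zero measurableSet_Iio fun s hs => ?_
  refine eq_zero_of_supportBound_lt hA ?_
  by_contra! hc
  exact hs.2 ⟨by linarith, hs.1⟩

/-- At a positive height the truncation at zero in the intensity plays no role, and both
convolutions are finite, so the negative part can be moved to the other side in `ℝ≥0∞`. -/
theorem le_intensity_iff {lam : ℝ} (hlam : 0 < lam) {h : ℝ → ℝ} (hmeas : Measurable h) {A : ℝ≥0}
    (hA : supportBound h ≤ A) (ν : PointMeasure) {p : ℝ × ℝ} (hp : 0 < p.2) :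
    p.2 ≤ intensity lam h ν p.1 ↔ p ∈ hawkesRegion lam h ν.toMeasure := by
  have hint := integrableOn_kernel hmeas hA ν p.1
  have hpos : causalConv (fun t => ENNReal.ofReal (h t)) ν.toMeasure p.1 ≠ ∞ := hint.lintegral_lt_top.ne
  have hneg : causalConv (fun t => ENNReal.ofReal (-h t)) ν.toMeasure p.1 ≠ ∞ :=
    hint.neg.lintegral_lt_top.ne
  have h1 : ∫ s in Iio p.1, h (p.1 - s) ∂ν.toMeasure =
      (causalConv (fun t => ENNReal.ofReal (h t)) ν.toMeasure p.1).toReal -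
        (causalConv (fun t => ENNReal.ofReal (-h t)) ν.toMeasure p.1).toReal :=
    integral_eq_lintegral_pos_part_sub_lintegral_neg_part hint
  rw [intensity, h1]
  change _ ↔ ENNReal.ofReal p.2 + causalConv (fun t => ENNReal.ofReal (-h t)) ν.toMeasure p.1 ≤
    ENNReal.ofReal lam + causalConv (fun t => ENNReal.ofReal (h t)) ν.toMeasure p.1
  rw [← ENNReal.toReal_le_toReal (by finiteness) (by finiteness),
    ENNReal.toReal_add (by finiteness) hneg, ENNReal.toReal_add (by finiteness) hpos,
    ENNReal.toReal_ofReal hp.le, ENNReal.toReal_ofReal hlam.le, le_max_iff]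
  constructor
  · rintro (h | h) <;> linarith
  · intro h; left; linarith

theorem restrict_intensity_eq {lam : ℝ} (hlam : 0 < lam) {h : ℝ → ℝ} (hmeas : Measurable h) {A : ℝ≥0}
    (hA : supportBound h ≤ A) (ν : PointMeasure) (q : Conf) :
    q.1.restrict {p | p.2 ≤ intensity lam h ν p.1} = q.1.restrict (hawkesRegion lam h ν.toMeasure) := by
  refine Measure.restrict_congr_set ?_
  filter_upwards [measure_eq_zero_iff_ae_notMem.1 q.2.2.2] with p hp
  have hp : p ∈ Ioi (0 : ℝ) ×ˢ Ioi (0 : ℝ) := not_not.1 hp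
  exact propext (le_intensity_iff hlam hmeas hA ν hp.2)

/-- An atom at or before `T - A` is at distance more than `A` from `u > T`, where `g` vanishes. -/
theorem causalConv_shift {g : ℝ → ℝ≥0∞} (hg : Measurable g) {A : ℝ≥0} (hgA : ∀ t, (A : ℝ) < t → g t = 0)
    (ν : PointMeasure) {T : ℝ} {u : ℝ} (hu : T < u) :
    causalConv g ((ν.shift T).restrict (Ioi (-(A : ℝ)))).toMeasure (u - T) =
      causalConv g ν.toMeasure u := by
  change ∫⁻ s in Iio (u - T), g (u - T - s) ∂((ν.toMeasure.map fun x => x - T).restrict (Ioi (-(A : ℝ))))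
    = ∫⁻ s in Iio u, g (u - s) ∂ν.toMeasure
  have hm : Measurable fun x : ℝ => x - T := by fun_prop
  have hgm : Measurable fun s => g (u - T - s) := hg.comp (by fun_prop)
  rw [Measure.restrict_restrict measurableSet_Iio,
    setLIntegral_map (measurableSet_Iio.inter measurableSet_Ioi) hgm hm,
    ← lintegral_indicator (hm (measurableSet_Iio.inter measurableSet_Ioi)),
    ← lintegral_indicator measurableSet_Iio]
  refine lintegral_congr fun s => ?_
  by_cases hs : s < u
  · by_cases hs' : -(A : ℝ) < s - T
    · have hmem : s ∈ (fun x => x - T) ⁻¹' (Iio (u - T) ∩ Ioi (-(A : ℝ))) := ⟨by simpa using hs, hs'⟩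
      rw [indicator_of_mem hmem, indicator_of_mem (by exact hs)]
      congr 1; ring
    · rw [indicator_of_notMem fun h => hs' h.2, indicator_of_mem (by exact hs), hgA]
      push Not at hs'
      linarith
  · rw [indicator_of_notMem fun h => hs (by simpa using h.1), indicator_of_notMem (by exact hs)]

theorem measurableSet_hawkesRegion_pointMeasure (lam : ℝ) {h : ℝ → ℝ} (hh : Measurable h)
    (ν : PointMeasure) : MeasurableSet (hawkesRegion lam h ν.toMeasure) :=
  measurable_prodMk_left (x := ()) (measurableSet_hawkesRegion lam hh
    (sFiniteFamily_pointMeasure (f := fun _ : Unit => ν) measurable_const))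

theorem mem_hawkesRegion_shift {lam : ℝ} {h : ℝ → ℝ} (hmeas : Measurable h) {A : ℝ≥0}
    (hA : supportBound h ≤ A) (ν : PointMeasure) {T : ℝ} {p : ℝ × ℝ} (hp : T < p.1) :
    (p.1 - T, p.2) ∈ hawkesRegion lam h ((ν.shift T).restrict (Ioi (-(A : ℝ)))).toMeasure ↔
      p ∈ hawkesRegion lam h ν.toMeasure := by
  simp only [hawkesRegion, mem_ofPred_eq]
  rw [causalConv_shift (g := fun t => ENNReal.ofReal (-h t)) hmeas.neg.ennreal_ofReal
      (fun t ht => by simp [eq_zero_of_supportBound_lt hA ht]) ν hp,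
    causalConv_shift (g := fun t => ENNReal.ofReal (h t)) hmeas.ennreal_ofReal
      (fun t ht => by simp [eq_zero_of_supportBound_lt hA ht]) ν hp]

/-- The Hawkes equation seen from time `T`: the past before the window does not matter. -/
theorem shift_eq_thin {lam : ℝ} {h : ℝ → ℝ} (hmeas : Measurable h) {A : ℝ≥0}
    (hA : supportBound h ≤ A) {x : Measure ℝ} (hx : x (Ioi 0) = 0) {q : Conf} {ν : PointMeasure}
    (hν : ν.toMeasure = thin (hawkesRegion lam h ν.toMeasure) x q.1) (T : ℝ≥0) :
    ((ν.shift T).restrict (Ioi (-(A : ℝ)))).toMeasure =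
      thin (hawkesRegion lam h ((ν.shift T).restrict (Ioi (-(A : ℝ)))).toMeasure)
        (toWindow A (ν.shift T)).1.toMeasure (q.shift T).1 := by
  have hm : Measurable fun x : ℝ => x - (T : ℝ) := by fun_prop
  have hsr : ∀ {I B : Set ℝ}, MeasurableSet I → MeasurableSet B →
      ((ν.shift T).restrict I).toMeasure B = ν.toMeasure ((fun x => x - (T : ℝ)) ⁻¹' (B ∩ I)) := by
    intro I B hI hB
    change ((ν.toMeasure.map fun x => x - (T : ℝ)).restrict I) B = _
    rw [Measure.restrict_apply hB, Measure.map_apply hm (hB.inter hI)]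
  ext B hB
  have hR := measurableSet_hawkesRegion_pointMeasure lam hmeas ((ν.shift T).restrict (Ioi (-(A : ℝ))))
  -- Atoms up to the new origin make up the window, which is the new past; atoms after it come from
  -- the noise only, since `x` has none at positive times.
  have h1 : B ∩ Ioi (-(A : ℝ)) = (B ∩ Ioc (-(A : ℝ)) 0) ∪ (B ∩ Ioi 0) := by
    rw [← inter_union_distrib_left, Ioc_union_Ioi_eq_Ioi (by simp)]
  have h2 : Disjoint (B ∩ Ioc (-(A : ℝ)) 0) (B ∩ Ioi 0) :=
    disjoint_left.2 fun y hy hy' => not_lt.2 hy.2.2 hy'.2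
  have h3 : x ((fun x => x - (T : ℝ)) ⁻¹' (B ∩ Ioi 0)) = 0 := by
    refine measure_mono_null (fun y hy => ?_) hx
    have : 0 < y - (T : ℝ) := hy.2
    exact mem_Ioi.2 (by linarith [T.coe_nonneg])
  rw [thin_apply _ _ _ hB, hsr measurableSet_Ioi hB, h1, preimage_union,
    measure_union (h2.preimage _) (hm (hB.inter measurableSet_Ioi))]
  congr 1
  · exact (hsr measurableSet_Ioc hB).symm
  · rw [hν, thin_apply _ _ _ (hm (hB.inter measurableSet_Ioi)), h3, zero_add,
      Conf.shift_apply _ _ ((measurable_fst hB).inter hR)]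
    congr 1
    ext p
    simp only [mem_inter_iff, mem_preimage, mem_Ioi, mem_prod, mem_univ, and_true, sub_pos]
    constructor
    · rintro ⟨⟨h4, h5⟩, h6⟩
      exact ⟨⟨h4, (mem_hawkesRegion_shift hmeas hA ν h5).2 h6⟩, h5⟩
    · rintro ⟨⟨h4, h6⟩, h5⟩
      exact ⟨⟨h4, h5⟩, (mem_hawkesRegion_shift hmeas hA ν h5).1 h6⟩

theorem windowSpace_Ioi {A : ℝ≥0} (x : WindowSpace A) : x.1.toMeasure (Ioi 0) = 0 :=
  measure_mono_null (t := (Ioc (-(A : ℝ)) 0)ᶜ) (fun _ hy hy' => not_lt.2 hy'.2 hy) x.2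

theorem windowSpace_univ_lt_top {A : ℝ≥0} (x : WindowSpace A) : x.1.toMeasure univ < ∞ := by
  rw [← measure_inter_conull x.2]
  exact x.1.finite_of_isBounded _ ((Metric.isBounded_Ioc _ _).subset inter_subset_right)

theorem toWindow_congr {A : ℝ≥0} {ν ν' : PointMeasure}
    (h : ν.toMeasure.restrict (Iic 0) = ν'.toMeasure.restrict (Iic 0)) : toWindow A ν = toWindow A ν' := by
  have h1 : ∀ ν : PointMeasure, ν.toMeasure.restrict (Ioc (-(A : ℝ)) 0) =
      (ν.toMeasure.restrict (Iic 0)).restrict (Ioc (-(A : ℝ)) 0) := fun ν => by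
    rw [Measure.restrict_restrict measurableSet_Ioc, inter_eq_left.2 fun y hy => hy.2]
  refine Subtype.ext (PointMeasure.ext ?_)
  change ν.toMeasure.restrict _ = ν'.toMeasure.restrict _
  rw [h1 ν, h1 ν', h]

theorem toWindow_coe {A : ℝ≥0} (x : WindowSpace A) : toWindow A x.1 = x := by
  refine Subtype.ext (PointMeasure.ext ?_)
  exact Measure.restrict_eq_self_of_ae_mem ((measure_eq_zero_iff_ae_notMem.1 x.2).mono
    fun _ hy => not_not.1 hy)

theorem shift_zero (ν : PointMeasure) : ν.shift 0 = ν := by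
  refine PointMeasure.ext ?_
  change ν.toMeasure.map (fun x => x - 0) = _
  simp

theorem shift_restrict_Iic (ν : PointMeasure) {s t : ℝ} (hst : s ≤ t) :
    (ν.shift s).toMeasure.restrict (Iic 0) = ((ν.restrict (Iic t)).shift s).toMeasure.restrict (Iic 0) := by
  have hm : Measurable fun x : ℝ => x - s := by fun_prop
  change (ν.toMeasure.map _).restrict _ = ((ν.toMeasure.restrict _).map _).restrict _
  rw [Measure.restrict_map hm measurableSet_Iic, Measure.restrict_map hm measurableSet_Iic,
    Measure.restrict_restrict (hm measurableSet_Iic)]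
  congr 2
  ext y
  simp only [mem_preimage, mem_Iic, mem_inter_iff, tsub_le_iff_right, zero_add, iff_self_and]
  exact fun h => h.trans hst

theorem toWindow_shift_restrict_Iic (A : ℝ≥0) (ν : PointMeasure) {s t : ℝ} (hst : s ≤ t) :
    toWindow A (ν.shift s) = toWindow A ((ν.restrict (Iic t)).shift s) :=
  toWindow_congr (shift_restrict_Iic ν hst)

/-! ### The path kernel and its semigroup property -/

section Kernel

variable {lam : ℝ} {h : ℝ → ℝ} {A : ℝ≥0}

/-- The path of the window process driven by the configuration `q` with the initial value `x`. -/
def flow (lam : ℝ) (h : ℝ → ℝ) (A : ℝ≥0) (x : WindowSpace A) (q : Conf) : PathSpace A :=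
  windowPath A (solution lam h x.1 q)

theorem measurable_flow (hlam : 0 < lam) (hmeas : Measurable h) :
    Measurable fun p : WindowSpace A × Conf => flow lam h A p.1 p.2 :=
  (measurable_windowPath A).comp (measurable_solution hlam hmeas
    (measurable_subtype_coe.comp measurable_fst) measurable_snd)

theorem flow_zero (x : WindowSpace A) (q : Conf) : (flow lam h A x q).1 0 = x := by
  change toWindow A ((solution lam h x.1 q).shift ((0 : ℝ≥0) : ℝ)) = x
  rw [NNReal.coe_zero, shift_zero, toWindow_congr (solution_restrict_Iic_zero x.1 q), toWindow_coe]

/-- The shifted window path of a solution is the flow started from the current window. -/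
theorem windowPath_shift_eq_flow (hlam : 0 < lam) (hmeas : Measurable h) (hA : supportBound h ≤ A)
    {x : Measure ℝ} (hx : x (Ioi 0) = 0) {q : Conf} {ν : PointMeasure}
    (hν : ν.toMeasure = thin (hawkesRegion lam h ν.toMeasure) x q.1) (T : ℝ≥0)
    (hg : NoExplosion lam h (toWindow A (ν.shift T)).1 (q.shift T)) :
    (windowPath A ν).shift T = flow lam h A ((windowPath A ν).1 T) (q.shift T) := by
  rw [windowPath_shift, eq_solution hlam hg (shift_eq_thin hmeas hA hx hν T)]
  rfl

/-- The flow at time `s` depends on the configuration up to time `s` only. -/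
theorem flow_concat (hlam : 0 < lam) {x : WindowSpace A} {q q' : Conf} {s : ℝ≥0}
    (hg : NoExplosion lam h x.1 q) (hg' : NoExplosion lam h x.1 (Conf.concat s q q')) :
    (flow lam h A x (Conf.concat s q q')).1 s = (flow lam h A x q).1 s := by
  change toWindow A ((solution lam h x.1 (Conf.concat s q q')).shift s) =
    toWindow A ((solution lam h x.1 q).shift s)
  rw [toWindow_shift_restrict_Iic A _ (le_refl (s : ℝ)),
    toWindow_shift_restrict_Iic A (solution lam h x.1 q) (le_refl (s : ℝ))]
  congr 2
  exact PointMeasure.ext (solution_restrict_congr hlam hg' hg (concat_restrict_Iic s q q'))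

/-- The path laws of the window process. -/
def pathKernel (hlam : 0 < lam) (hmeas : Measurable h) (A : ℝ≥0) : Kernel (WindowSpace A) (PathSpace A) :=
  ⟨fun x => poissonLaw.map (flow lam h A x), by
    refine Measure.measurable_of_measurable_coe _ fun C hC => ?_
    have h1 : ∀ x, poissonLaw.map (flow lam h A x) C =
        poissonLaw (Prod.mk x ⁻¹' ((fun p : WindowSpace A × Conf => flow lam h A p.1 p.2) ⁻¹' C)) :=
      fun x => Measure.map_apply ((measurable_flow hlam hmeas).comp measurable_prodMk_left) hC
    simp_rw [h1]
    exact measurable_measure_prodMk_left (measurable_flow hlam hmeas hC)⟩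

theorem pathKernel_apply (hlam : 0 < lam) (hmeas : Measurable h) (x : WindowSpace A) :
    pathKernel hlam hmeas A x = poissonLaw.map (flow lam h A x) := rfl

theorem measurable_flow_right (hlam : 0 < lam) (hmeas : Measurable h) (x : WindowSpace A) :
    Measurable (flow lam h A x) := by
  have h1 := (measurable_flow (A := A) hlam hmeas).comp (measurable_prodMk_left (x := x))
  exact h1

instance (hlam : 0 < lam) (hmeas : Measurable h) : IsMarkovKernel (pathKernel hlam hmeas A) :=
  ⟨fun x => Measure.isProbabilityMeasure_map (measurable_flow_right hlam hmeas x).aemeasurable⟩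

theorem measurable_path_apply (s : ℝ≥0) : Measurable fun w : PathSpace A => w.1 s :=
  (measurable_pi_apply s).comp measurable_subtype_coe

theorem measurable_path_shift (s : ℝ≥0) : Measurable fun w : PathSpace A => w.shift s :=
  Measurable.subtype_mk (measurable_pi_lambda _ fun t => measurable_path_apply (s + t))

/-- Resampling the noise after `s` leaves its law unchanged. In the concatenated configuration the
window at time `s` depends on the first part only and the shifted noise is the second part, so
Fubini gives the composition of kernels. -/
theorem isMarkovFamily_pathKernel (hlam : 0 < lam) (hmeas : Measurable h)
    (hnorm : (∫⁻ t in Ioi (0 : ℝ), ENNReal.ofReal (h t)) < 1) (hA : supportBound h ≤ A) :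
    IsMarkovFamily (pathKernel hlam hmeas A) := by
  refine ⟨inferInstance, fun x => ?_, fun x s C hC => ?_⟩
  · rw [pathKernel_apply]
    refine (ae_map_iff (measurable_flow_right hlam hmeas x).aemeasurable
      (measurable_path_apply 0 (measurableSet_singleton x))).2 (Eventually.of_forall fun q => ?_)
    exact flow_zero x q
  · have hfm := measurable_flow_right hlam hmeas x
    have hCs : MeasurableSet {w : PathSpace A | w.shift s ∈ C} := measurable_path_shift s hC
    have hy : Measurable fun q : Conf => (flow lam h A x q).1 s := (measurable_path_apply s).comp hfm
    have hD : MeasurableSet {p : Conf × Conf | flow lam h A ((flow lam h A x p.1).1 s) p.2 ∈ C} :=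
      (measurable_flow hlam hmeas).comp ((hy.comp measurable_fst).prodMk measurable_snd) hC
    have hae := ae_noExplosion lam hmeas hnorm
    have hg1 : ∀ᵐ p ∂poissonLaw.prod poissonLaw, NoExplosion lam h x.1 p.1 :=
      Measure.quasiMeasurePreserving_fst.ae (hae x.1 (windowSpace_univ_lt_top x))
    have hg2 : ∀ᵐ p ∂poissonLaw.prod poissonLaw, NoExplosion lam h x.1 (Conf.concat s p.1 p.2) :=
      ae_of_ae_map (Conf.measurable_concat s).aemeasurable (by
        rw [map_concat_poissonLaw]; exact hae x.1 (windowSpace_univ_lt_top x))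
    -- For a fixed first part the window at time `s` is a fixed initial condition of finite mass,
    -- independent of the second part.
    have hg3 : ∀ᵐ p ∂poissonLaw.prod poissonLaw,
        NoExplosion lam h ((flow lam h A x p.1).1 s).1 p.2 := by
      have hm1 : Measurable fun p : Conf × Conf => ((flow lam h A x p.1).1 s).1 :=
        measurable_subtype_coe.comp (hy.comp measurable_fst)
      have hm2 : MeasurableSet {p : Conf × Conf | NoExplosion lam h ((flow lam h A x p.1).1 s).1 p.2} :=
        measurableSet_noExplosion lam hmeas hm1 measurable_snd
      have h5 : ∀ y : WindowSpace A, ∀ᵐ q ∂poissonLaw, NoExplosion lam h y.1 q := fun y =>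
        hae y.1 (windowSpace_univ_lt_top y)
      have h6 : ∀ᵐ q ∂poissonLaw, ∀ᵐ q' ∂poissonLaw,
          NoExplosion lam h ((flow lam h A x q).1 s).1 q' :=
        Eventually.of_forall fun q => h5 ((flow lam h A x q).1 s)
      exact (Measure.ae_prod_iff_ae_ae
        (p := fun p : Conf × Conf => NoExplosion lam h ((flow lam h A x p.1).1 s).1 p.2) hm2).2 h6
    calc pathKernel hlam hmeas A x {w | w.shift s ∈ C}
        = poissonLaw (flow lam h A x ⁻¹' {w | w.shift s ∈ C}) := by
          rw [pathKernel_apply, Measure.map_apply hfm hCs]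
      _ = poissonLaw.prod poissonLaw
            ((fun p => Conf.concat s p.1 p.2) ⁻¹' (flow lam h A x ⁻¹' {w | w.shift s ∈ C})) := by
          rw [← Measure.map_apply (Conf.measurable_concat s) (hfm hCs), map_concat_poissonLaw]
      _ = poissonLaw.prod poissonLaw
            {p : Conf × Conf | flow lam h A ((flow lam h A x p.1).1 s) p.2 ∈ C} := by
          refine measure_congr ?_
          filter_upwards [hg1, hg2, hg3] with p h1 h2 h3
          refine propext ?_
          change (flow lam h A x (Conf.concat s p.1 p.2)).shift s ∈ C ↔
            flow lam h A ((flow lam h A x p.1).1 s) p.2 ∈ C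
          have h4 : (flow lam h A x (Conf.concat s p.1 p.2)).shift s =
              flow lam h A ((flow lam h A x (Conf.concat s p.1 p.2)).1 s)
                ((Conf.concat s p.1 p.2).shift s) := by
            refine windowPath_shift_eq_flow hlam hmeas hA (windowSpace_Ioi x)
              (solution_eq_thin hlam h2) s ?_
            rw [Conf.shift_concat]
            rw [← flow_concat hlam h1 h2] at h3
            exact h3
          rw [h4, Conf.shift_concat, flow_concat hlam h1 h2]
      _ = ∫⁻ q, pathKernel hlam hmeas A ((flow lam h A x q).1 s) C ∂poissonLaw := by
          rw [Measure.prod_apply hD]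
          refine lintegral_congr fun q => ?_
          rw [pathKernel_apply, Measure.map_apply (measurable_flow_right hlam hmeas _) hC]
          rfl
      _ = ∫⁻ w, pathKernel hlam hmeas A (w.1 s) C ∂pathKernel hlam hmeas A x := by
          rw [pathKernel_apply hlam hmeas x, lintegral_map _ hfm]
          exact ((pathKernel hlam hmeas A).measurable_coe hC).comp (measurable_path_apply s)

end Kernel

/-! ### The window at a stopping time -/

section StoppingTime

variable {Ω : Type*} {mΩ : MeasurableSpace Ω} {P : Measure Ω} {𝓕 : Filtration ℝ≥0 mΩ}
  {T : Ω → WithTop ℝ≥0}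

theorem measurable_min_stopping (hT : IsStoppingTime 𝓕 T) (i : ℝ≥0) :
    Measurable[𝓕 i] fun ω => ((min (T ω) i).untopD 0 : ℝ≥0) :=
  ((hT.min_const i).measurable_of_le fun _ => min_le_right _ _).untopD 0

theorem setOf_lt_top_eq (T : Ω → WithTop ℝ≥0) : {ω | T ω < ⊤} = ⋃ n : ℕ, {ω | T ω ≤ ((n : ℝ≥0) : WithTop ℝ≥0)} := by
  ext ω
  simp only [mem_ofPred_eq, mem_iUnion]
  constructor
  · intro h
    obtain ⟨r, hr⟩ := WithTop.ne_top_iff_exists.1 h.ne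
    obtain ⟨n, hn⟩ := exists_nat_ge r
    exact ⟨n, hr ▸ WithTop.coe_le_coe.2 hn⟩
  · rintro ⟨n, hn⟩
    exact hn.trans_lt (WithTop.coe_lt_top _)

theorem measurableSet_lt_top (hT : IsStoppingTime 𝓕 T) :
    MeasurableSet[hT.measurableSpace] {ω | T ω < ⊤} :=
  hT.measurable measurableSet_Iio

variable {N : Ω → PointMeasure} (A : ℝ≥0)

theorem measurable_windowPath_apply (hN : ∀ t : ℝ≥0, Measurable[𝓕 t] fun ω => (N ω).restrict (Iic (t : ℝ)))
    (t : ℝ≥0) : Measurable[𝓕 t] fun ω => (windowPath A (N ω)).1 t := by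
  have h1 : ∀ ω, (windowPath A (N ω)).1 t = toWindow A (((N ω).restrict (Iic (t : ℝ))).shift t) :=
    fun ω => toWindow_shift_restrict_Iic A (N ω) le_rfl
  simp_rw [h1]
  have h2 : Measurable fun ν : PointMeasure => toWindow A (ν.shift t) :=
    (measurable_toWindow A).comp (PointMeasure.measurable_shift.comp (measurable_id.prodMk measurable_const))
  exact h2.comp (hN t)

/-- The window process at a stopping time is measurable with respect to the past of the stopping
time. -/
theorem measurable_windowPath_stopping
    (hN : ∀ t : ℝ≥0, Measurable[𝓕 t] fun ω => (N ω).restrict (Iic (t : ℝ)))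
    (hT : IsStoppingTime 𝓕 T) :
    Measurable[hT.measurableSpace] fun ω => (windowPath A (N ω)).1 ((T ω).untopD 0) := by
  intro D hD
  set Z : Ω → WindowSpace A := fun ω => (windowPath A (N ω)).1 ((T ω).untopD 0) with hZ_def
  -- On `T ≤ i` the window is a measurable function of the point process up to time `i` and of `min
  -- T i`, both known at time `i`.
  have hloc : ∀ i : ℝ≥0, MeasurableSet[𝓕 i] (Z ⁻¹' D ∩ {ω | T ω ≤ i}) := by
    intro i
    have h1 : Measurable[𝓕 i] fun ω => toWindow A
        (((N ω).restrict (Iic (i : ℝ))).shift (((min (T ω) i).untopD 0 : ℝ≥0) : ℝ)) :=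
      ((measurable_toWindow A).comp PointMeasure.measurable_shift).comp
        (Measurable.prodMk (hN i) (NNReal.continuous_coe.measurable.comp (measurable_min_stopping hT i)))
    have h2 : Z ⁻¹' D ∩ {ω | T ω ≤ i} = (fun ω => toWindow A
        (((N ω).restrict (Iic (i : ℝ))).shift (((min (T ω) i).untopD 0 : ℝ≥0) : ℝ))) ⁻¹' D ∩
          {ω | T ω ≤ i} := by
      ext ω
      simp only [mem_inter_iff, mem_preimage, mem_ofPred_eq, and_congr_left_iff]
      intro hω
      obtain ⟨r, hr⟩ := WithTop.ne_top_iff_exists.1 (hω.trans_lt (WithTop.coe_lt_top i)).ne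
      rw [← hr, WithTop.coe_le_coe] at hω
      have h3 : Z ω = toWindow A (((N ω).restrict (Iic (i : ℝ))).shift r) := by
        simp only [hZ_def, ← hr, WithTop.untopD_coe]
        exact toWindow_shift_restrict_Iic A (N ω) (by exact_mod_cast hω)
      rw [h3, ← hr, ← WithTop.coe_min, min_eq_left hω, WithTop.untopD_coe]
    rw [h2]
    exact (h1 hD).inter (hT i)
  have htop := (measurableSet_lt_top hT).compl
  -- Where `T` is infinite, the default value `0` of `untopD` makes `Z` the window at time zero.
  have hdec : Z ⁻¹' D = (⋃ n : ℕ, Z ⁻¹' D ∩ {ω | T ω ≤ ((n : ℝ≥0) : WithTop ℝ≥0)}) ∪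
      ((fun ω => (windowPath A (N ω)).1 0) ⁻¹' D ∩ {ω | T ω < ⊤}ᶜ) := by
    rw [← inter_iUnion, ← setOf_lt_top_eq]
    ext ω
    by_cases hω : T ω < ⊤
    · simp [hω]
    · have h2 : T ω = ⊤ := not_lt_top_iff.1 hω
      simp [hZ_def, h2]
  refine ⟨?_, fun i => ?_⟩
  · rw [hdec]
    exact (MeasurableSet.iUnion fun n : ℕ => le_iSup 𝓕 (n : ℝ≥0) _ (hloc n)).union
      (MeasurableSet.inter (le_iSup 𝓕 0 _ (measurable_windowPath_apply A hN 0 hD)) htop.1)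
  · exact hloc i

end StoppingTime

/-! ### Strong Markov property of the window process -/

section StrongMarkov

variable {Ω : Type*} {mΩ : MeasurableSpace Ω} {P : Measure Ω}
  {𝓕 : Filtration ℝ≥0 mΩ} {Q : Ω → Measure (ℝ × ℝ)} {N0 N : Ω → PointMeasure}
  {lam : ℝ} {h : ℝ → ℝ} {A : ℝ≥0}

/-- At a stopping time the window process and the future of the Poisson process are independent. -/
theorem map_window_shift [IsProbabilityMeasure P] (hQ : IsPoissonPointProcess P 𝓕 Q)
    (hN : ∀ t : ℝ≥0, Measurable[𝓕 t] fun ω => (N ω).restrict (Iic (t : ℝ)))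
    {T : Ω → WithTop ℝ≥0} (hT : IsStoppingTime 𝓕 T) {G : Set Ω}
    (hG : MeasurableSet[hT.measurableSpace] G)
    (hS : Measurable fun ω => (hQ.conf ω).shift ((T ω).untopD 0)) :
    (P.restrict (G ∩ {ω | T ω < ⊤})).map (fun ω => ((windowPath A (N ω)).1 ((T ω).untopD 0),
        (hQ.conf ω).shift ((T ω).untopD 0))) =
      ((P.restrict (G ∩ {ω | T ω < ⊤})).map fun ω => (windowPath A (N ω)).1 ((T ω).untopD 0)).prod
        poissonLaw := by
  have hZ' := measurable_windowPath_stopping A hN hT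
  have hZ : Measurable fun ω => (windowPath A (N ω)).1 ((T ω).untopD 0) :=
    hZ'.mono hT.measurableSpace_le le_rfl
  refine (Measure.prod_eq fun D C hD hC => ?_).symm
  have hDT : MeasurableSet[hT.measurableSpace]
      ((fun ω => (windowPath A (N ω)).1 ((T ω).untopD 0)) ⁻¹' D) := hZ' hD
  -- The event that the window lies in `D` belongs to the past of `T`, so it can be absorbed into
  -- `G`.
  have h1 := congrArg (fun μ => μ C) (hQ.map_shift_stopping hT (hDT.inter hG))
  simp only [Measure.smul_apply, smul_eq_mul] at h1
  rw [Measure.map_apply hS hC, Measure.restrict_apply (hS hC)] at h1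
  rw [Measure.map_apply (hZ.prodMk hS) (hD.prod hC), Measure.restrict_apply
    ((hZ.prodMk hS) (hD.prod hC)), Measure.map_apply hZ hD, Measure.restrict_apply (hZ hD),
    ← inter_assoc, ← inter_assoc, ← h1]
  congr 1
  ext ω
  simp only [mem_inter_iff, mem_preimage, mem_prod, mem_ofPred_eq]
  tauto

theorem IsHawkesSolution.ae_eq_thin (hlam : 0 < lam) (hmeas : Measurable h) (hA : supportBound h ≤ A)
    (hQ : IsPoissonPointProcess P 𝓕 Q) (hsol : IsHawkesSolution P 𝓕 lam h Q N0 N) :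
    ∀ᵐ ω ∂P, (N ω).toMeasure =
      thin (hawkesRegion lam h (N ω).toMeasure) (N0 ω).toMeasure (hQ.conf ω).1 := by
  filter_upwards [hsol.equation] with ω hω
  rw [thin, ← restrict_intensity_eq hlam hmeas hA (N ω) (hQ.conf ω)]
  exact hω

/-- The future is almost surely the flow applied to the pair of current window and shifted noise. On
every event of the past this pair has a product law, so integrating out the noise leaves
`pathKernel` at the current window. -/
theorem isStrongMarkov_windowPath [IsProbabilityMeasure P] (hlam : 0 < lam) (hmeas : Measurable h)
    (hnorm : (∫⁻ t in Ioi (0 : ℝ), ENNReal.ofReal (h t)) < 1) (hA : supportBound h ≤ A)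
    (hQ : IsPoissonPointProcess P 𝓕 Q) (hN0 : IsInitialCondition 𝓕 N0)
    (hsol : IsHawkesSolution P 𝓕 lam h Q N0 N) :
    IsStrongMarkov P 𝓕 (pathKernel hlam hmeas A) fun ω => windowPath A (N ω) := by
  refine ⟨measurable_windowPath_apply A hsol.adapted, fun T hT F hF hFb => ?_⟩
  obtain ⟨c, hc⟩ := hFb
  set τ : Ω → ℝ≥0 := fun ω => (T ω).untopD 0
  set Z : Ω → WindowSpace A := fun ω => (windowPath A (N ω)).1 (τ ω)
  set S : Ω → Conf := fun ω => (hQ.conf ω).shift (τ ω)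
  set k : WindowSpace A → ℝ := fun x => ∫ w, F w ∂pathKernel hlam hmeas A x
  have hZ' : Measurable[hT.measurableSpace] Z := measurable_windowPath_stopping A hsol.adapted hT
  have hle := hT.measurableSpace_le
  have hZ : Measurable Z := hZ'.mono hle le_rfl
  have hfin' := measurableSet_lt_top hT
  have hfin : MeasurableSet {ω | T ω < ⊤} := hle _ hfin'
  have hτ : Measurable τ := hT.measurable'.untopD 0
  have hS : Measurable S := Conf.measurable_shift.comp (hτ.prodMk hQ.measurable_conf)
  have hZS : Measurable fun ω => (Z ω, S ω) := hZ.prodMk hS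
  have hΦ : Measurable fun p : WindowSpace A × Conf => F (flow lam h A p.1 p.2) :=
    hF.comp (measurable_flow hlam hmeas)
  have hk : Measurable k := (hF.stronglyMeasurable.integral_kernel).measurable
  have hkb : ∀ x, |k x| ≤ c := fun x => by
    have := norm_integral_le_of_norm_le_const (μ := pathKernel hlam hmeas A x)
      (f := F) (C := c) (Eventually.of_forall fun w => hc w)
    simpa using this
  have hk_eq : ∀ x, k x = ∫ q, F (flow lam h A x q) ∂poissonLaw := fun x => by
    simp only [k, pathKernel_apply]
    exact integral_map (measurable_flow_right hlam hmeas x).aemeasurable hF.aestronglyMeasurable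
  have hlaw : ∀ G, MeasurableSet[hT.measurableSpace] G →
      (P.restrict (G ∩ {ω | T ω < ⊤})).map (fun ω => (Z ω, S ω)) =
        ((P.restrict (G ∩ {ω | T ω < ⊤})).map Z).prod poissonLaw := fun G hG =>
    map_window_shift hQ hsol.adapted hT hG hS
  -- `ae_noExplosion` is for deterministic initial windows; the product law of `(Z, S)` transfers it
  -- to the random window at time `T`.
  have hgood : ∀ᵐ ω ∂P, T ω < ⊤ → NoExplosion lam h (Z ω).1 (S ω) := by
    have hm : MeasurableSet {p : WindowSpace A × Conf | NoExplosion lam h p.1.1 p.2} :=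
      measurableSet_noExplosion lam hmeas (measurable_subtype_coe.comp measurable_fst) measurable_snd
    have h1 : ∀ᵐ p ∂((P.restrict (univ ∩ {ω | T ω < ⊤})).map Z).prod poissonLaw,
        NoExplosion lam h p.1.1 p.2 :=
      (Measure.ae_prod_iff_ae_ae (p := fun p : WindowSpace A × Conf => NoExplosion lam h p.1.1 p.2)
        hm).2 (Eventually.of_forall fun x => ae_noExplosion lam hmeas hnorm x.1
          (windowSpace_univ_lt_top x))
    rw [← hlaw univ MeasurableSet.univ, univ_inter] at h1
    exact (ae_restrict_iff' hfin).1 (ae_of_ae_map hZS.aemeasurable h1)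
  have hflow : {ω | T ω < ⊤}.indicator (fun ω => F ((windowPath A (N ω)).shift (τ ω))) =ᵐ[P]
      {ω | T ω < ⊤}.indicator fun ω => F (flow lam h A (Z ω) (S ω)) := by
    filter_upwards [hgood, hsol.ae_eq_thin hlam hmeas hA hQ] with ω h1 h2
    by_cases hω : T ω < ⊤
    · rw [indicator_of_mem (by exact hω), indicator_of_mem (by exact hω),
        windowPath_shift_eq_flow hlam hmeas hA (hN0.support ω) h2 (τ ω) (h1 hω)]
    · rw [indicator_of_notMem (by exact hω), indicator_of_notMem (by exact hω)]
  have hint1 : Integrable ({ω | T ω < ⊤}.indicator fun ω => F (flow lam h A (Z ω) (S ω))) P :=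
    (Integrable.of_bound (hΦ.comp hZS).aestronglyMeasurable c
      (Eventually.of_forall fun ω => hc _)).indicator hfin
  have hgm : Measurable[hT.measurableSpace] ({ω | T ω < ⊤}.indicator fun ω => k (Z ω)) :=
    Measurable.indicator (hk.comp hZ') hfin'
  have hint2 : Integrable ({ω | T ω < ⊤}.indicator fun ω => k (Z ω)) P :=
    (Integrable.of_bound (hk.comp hZ).aestronglyMeasurable c
      (Eventually.of_forall fun ω => hkb _)).indicator hfin
  refine (ae_eq_condExp_of_forall_setIntegral_eq hle (hint1.congr hflow.symm)
    (fun G _ _ => hint2.integrableOn) (fun G hG _ => ?_) hgm.aestronglyMeasurable).symm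
  rw [setIntegral_congr_ae₀ (hle _ hG).nullMeasurableSet (hflow.mono fun ω hω _ => hω),
    setIntegral_indicator hfin, setIntegral_indicator hfin]
  have hG' := hlaw G hG
  have hZint : ∀ f : WindowSpace A → ℝ, Measurable f → ∫ ω in G ∩ {ω | T ω < ⊤}, f (Z ω) ∂P =
      ∫ x, f x ∂(P.restrict (G ∩ {ω | T ω < ⊤})).map Z := fun f hf =>
    (integral_map hZ.aemeasurable hf.aestronglyMeasurable).symm
  rw [hZint k hk]
  have h1 : ∫ ω in G ∩ {ω | T ω < ⊤}, F (flow lam h A (Z ω) (S ω)) ∂P =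
      ∫ p, F (flow lam h A p.1 p.2) ∂(P.restrict (G ∩ {ω | T ω < ⊤})).map fun ω => (Z ω, S ω) :=
    (integral_map hZS.aemeasurable hΦ.aestronglyMeasurable).symm
  rw [h1, hG', integral_prod]
  · simp_rw [hk_eq]
  · exact Integrable.of_bound hΦ.aestronglyMeasurable c (Eventually.of_forall fun p => hc _)

end StrongMarkov

end Hawkes

end

theorem proposition3p1
    (lam : ℝ) (hlam : 0 < lam)
    (h : ℝ → ℝ) (hmeas : Measurable h)
    (hL : supportBound h < ∞)
    (hnorm : (∫⁻ t in Ioi (0 : ℝ), ENNReal.ofReal (h t)) < 1)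
    (A : ℝ≥0) (hA : supportBound h ≤ A) :
    ∃ κ : Kernel (WindowSpace A) (PathSpace A), IsMarkovFamily κ ∧
      ∀ (Ω : Type*) (mΩ : MeasurableSpace Ω) (P : Measure Ω) (_ : IsProbabilityMeasure P)
        (𝓕 : Filtration ℝ≥0 mΩ) (_ : UsualConditions P 𝓕)
        (Q : Ω → Measure (ℝ × ℝ)) (_ : IsPoissonPointProcess P 𝓕 Q)
        (N0 : Ω → PointMeasure) (_ : IsInitialCondition 𝓕 N0)
        (_ : ∫⁻ ω, (N0 ω).toMeasure (Ioc (-(supportBound h).toReal) 0) ∂P < ∞)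
        (N : Ω → PointMeasure) (_ : IsHawkesSolution P 𝓕 lam h Q N0 N),
        ∃ X : Ω → PathSpace A,
          (∀ ω t, (X ω).1 t = toWindow A ((N ω).shift t)) ∧
          (∀ ω (t : ℝ≥0), 0 < t → Tendsto (fun s => ((X ω).1 s).1) (𝓝[<] t)
            (𝓝 (((N ω).restrict (Ico ((t : ℝ) - A) t)).shift t))) ∧
          (∀ᵐ ω ∂P, (X ω).1 0 = toWindow A (N0 ω)) ∧
          IsStrongMarkov P 𝓕 κ X := by
  refine ⟨pathKernel hlam hmeas A, isMarkovFamily_pathKernel hlam hmeas hnorm hA, ?_⟩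
  intro Ω mΩ P _ 𝓕 _ Q hQ N0 hN0 _ N hsol
  refine ⟨fun ω => windowPath A (N ω), fun _ _ => rfl, fun ω t _ => tendsto_window_left A (N ω) t, ?_,
    isStrongMarkov_windowPath hlam hmeas hnorm hA hQ hN0 hsol⟩
  -- Thinning adds points at positive times only, so up to time zero `N` coincides with `N0`.
  filter_upwards [hsol.ae_eq_thin hlam hmeas hA hQ] with ω hω
  change toWindow A ((N ω).shift ((0 : ℝ≥0) : ℝ)) = toWindow A (N0 ω)
  rw [NNReal.coe_zero, shift_zero]
  refine toWindow_congr ?_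
  rw [hω]
  exact thin_restrict_Iic_zero _ _ (hQ.conf ω) le_rfl
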